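/- All vector spaces are over $\mathbb Q$ and graded; a lower degree $n$ is an upper degree $-n$, and differentials have lower degree $-1$. Let $L=L_{\ge 1}$ be a differential graded Lie algebra with every $L_n$ finite dimensional (for instance such a Lie model of a $1$-connected closed oriented manifold $M$ of dimension $m$), let $C_*L=(\land sL,d)$ be its chain coalgebra, with coproduct $\Delta c=\sum c'\otimes c''$, and let $C^*L=\operatorname{Hom}(C_*L,\mathbb Q)=(\land V,d)$, $V=(sL)^\vee$, be its cochain algebra. For a differential graded left $L$-module $N$ (also regarded as a right module by $n\cdot x=-(-1)^{|n||x|}x\cdot n$) let $C_*(L;N)=C_*L\otimes N$, with $$d(c\otimes n)=dc\otimes n+(-1)^{|c|}c\otimes dn-\sum(-1)^{|c'|}c'\otimes\tau(c'')\cdot n ,$$ where $\tau:C_*L\to sL\cong L$ is the projection, and $C^*(L;N)=\operatorname{Hom}_{UL}(C_*(L;UL),N)=\operatorname{Hom}(C_*L,N)$, where $\operatorname{Hom}$ is the graded $\operatorname{Hom}$. Cup products are $f\cup g=(f\otimes g)\circ\Delta$; they make $C^*(L;N)$ a right $C^*L$-module. Let $(UL)^\vee_a$ be the graded dual of the enveloping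 algebra, with the action dual to the adjoint action; tensor products of modules carry the diagonal action. Let $m\ge 0$, let $u\in C_m(L)$ be a cycle (the fundamental cycle), let $a_1,\dots,a_p$ be homogeneous cocycles of $C^*L$ whose classes form a basis of $H^*(L;\mathbb Q)$, let $a_i^{\#}$ be cocycles of degree $m-|a_i|$ with $\langle a_i\cup a_j^{\#},u\rangle=\delta_{ij}$, and let $T=\sum_i(-1)^{|a_i|}a_i\otimes a_i^{\#}\in C^*L\otimes C^*L$ (a cocycle representing the diagonal class). For each $N$ the cap product is $$cap_u:C^*(L;N)\to C_*(L;N),\qquad cap_u(f)=(-1)^m\sum(-1)^{|f||u'|}\,u'\otimes f(u''),$$ where $\Delta u=\sum u'\otimes u''$; put $(cap_u\otimes cap_u)(x\otimes y)=(-1)^{m|y|}cap_u(x)\otimes cap_u(y)$. The diagonal map $C_*(\Delta;id):C_*(L;N\otimes N)\to C_*(L;N)\otimes C_*(L;N)$ is $c\otimes(n\otimes n')\mapsto\sum(-1)^{|c''||n|}(c'\otimes n)\otimes(c''\otimes n')$. Let $V'$ be a copy of $V$ and $\bar V=L^\vee$ (so $\bar V^n=V^{n+1}$), and let $D$ be a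 differential on $\land V\otimes\land V'\otimes\land\bar V$ making it a differential graded algebra that extends $\land V\otimes\land V'=C^*L\otimes C^*L$, together with a quasi-isomorphism of differential graded algebras $\varphi:(\land V\otimes\land V'\otimes\land\bar V,D)\to\land V$ that extends the multiplication $\land V\otimes\land V'\to\land V$. Let $\mu_T:(\land V\otimes\land V'\otimes\land\bar V,D)\to\land V\otimes\land V'$ be a morphism of differential $\land V\otimes\land V'$-modules of degree $m$ whose restriction to $\land V\otimes\land V'$ induces in homology the multiplication by $T$, $r\mapsto rT$. Put $E=C^*(L;(UL)^\vee_a)$. Identify $E\otimes E\otimes\land\bar V$ with $(E\otimes E)\otimes_{\land V\otimes\land V'}(\land V\otimes\land V'\otimes\land\bar V,D)$, which gives its differential, and put $$\Phi(f\otimes g\otimes w)=(f\cup g)\cdot\varphi(w),\qquad(\mu_T\otimes1)(f\otimes g\otimes w)=(f\otimes g)\cdot\mu_T(w).$$ **Theorem.** In the diagram $$\begin{array}{ccc} C_*(L;(UL)^\vee_a\otimes(UL)^\vee_a)&\xrightarrow{\;C_*(\Delta;id)\;}&C_*(L;(UL)^\vee_a)\otimes C_*(L;(UL)^\vee_a)\\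 {\scriptstyle cap_u}\uparrow&&\\ C^*(L;(UL)^\vee_a\otimes(UL)^\vee_a)&&\uparrow{\scriptstyle cap_u\otimes cap_u}\\ {\scriptstyle\Phi}\uparrow{\scriptstyle\cong}&&\\ C^*(L;(UL)^\vee_a)\otimes C^*(L;(UL)^\vee_a)\otimes\land\bar V&\xrightarrow{\;\mu_T\otimes1\;}&C^*(L;(UL)^\vee_a)\otimes C^*(L;(UL)^\vee_a) \end{array}$$ all five maps commute with the differentials, $\Phi$ is a quasi-isomorphism, and the diagram commutes in homology: $C_*(\Delta;id)\circ cap_u\circ\Phi$ and $(cap_u\otimes cap_u)\circ(\mu_T\otimes1)$ induce the same map in homology. -/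

import Mathlib

open scoped TensorProduct

namespace LieLoop
noncomputable section

/-- A `ℤ`-graded rational vector space `X = ⨁ deg n`.  Degrees are lower degrees; an upper
degree `n` is the lower degree `-n`.  The field `wt` is the operator that multiplies `deg n` by
`t ^ n`; it is determined by `deg`, its existence makes the sum of the `deg n` direct (see
`isInternal_deg`), and `wt (-1)` is the sign operator `x ↦ (-1)^{|x|} x`. -/
class GradedSpace (X : Type*) [AddCommGroup X] [Module ℚ X] where
  deg : ℤ → Submodule ℚ X
  wt : ℚˣ → X →ₗ[ℚ] X
  wt_of_mem : ∀ (t : ℚˣ) (n : ℤ) (x : X), x ∈ deg n → wt t x = (t : ℚ) ^ n • x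
  iSup_deg : ⨆ n, deg n = ⊤

/-- The component of degree `n`. -/
abbrev deg (X : Type*) [AddCommGroup X] [Module ℚ X] [GradedSpace X] (n : ℤ) : Submodule ℚ X :=
  GradedSpace.deg n

/-- The sign operator `x ↦ (-1)^{|x|} x`. -/
def sgn (X : Type*) [AddCommGroup X] [Module ℚ X] [GradedSpace X] : X →ₗ[ℚ] X :=
  GradedSpace.wt (-1)

section Basic
variable {X Y Z : Type*} [AddCommGroup X] [Module ℚ X] [AddCommGroup Y] [Module ℚ Y]
  [AddCommGroup Z] [Module ℚ Z] [GradedSpace X] [GradedSpace Y] [GradedSpace Z]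

theorem sgn_of_mem {n : ℤ} {x : X} (hx : x ∈ deg X n) : sgn X x = (-1 : ℚ) ^ n • x := by
  simpa [sgn] using GradedSpace.wt_of_mem (-1) n x hx

theorem sgn_mem {n : ℤ} {x : X} (hx : x ∈ deg X n) : sgn X x ∈ deg X n := by
  rw [sgn_of_mem hx]; exact Submodule.smul_mem _ _ hx

theorem deg_induction {P : X → Prop} (x : X) (h : ∀ n, ∀ y ∈ deg X n, P y) (h0 : P 0)
    (hadd : ∀ y z, P y → P z → P (y + z)) : P x := by
  have hx : x ∈ ⨆ n, deg X n := by rw [GradedSpace.iSup_deg]; trivial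
  exact Submodule.iSup_induction _ (motive := P) hx h h0 hadd

theorem hom_ext_deg {A : Type*} [AddCommGroup A] [Module ℚ A] {f g : X →ₗ[ℚ] A}
    (h : ∀ n, ∀ x ∈ deg X n, f x = g x) : f = g := by
  ext x
  induction x using deg_induction with
  | h n y hy => exact h n y hy
  | h0 => simp
  | hadd y z hy hz => simp [hy, hz]

/-- The homogeneous components form a direct sum decomposition. -/
theorem isInternal_deg : DirectSum.IsInternal (deg X) := by
  refine DirectSum.isInternal_submodule_of_iSupIndep_of_iSup_eq_top ?_ GradedSpace.iSup_deg
  let t : ℚˣ := Units.mk0 2 (by norm_num)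
  have hinj : Function.Injective fun n : ℤ => (2 : ℚ) ^ n :=
    zpow_right_injective₀ (by norm_num) (by norm_num)
  refine ((Module.End.eigenspaces_iSupIndep (GradedSpace.wt t : Module.End ℚ X)).comp hinj).mono ?_
  intro n x hx
  exact Module.End.mem_eigenspace_iff.2 (GradedSpace.wt_of_mem t n x hx)

/-- Every direct sum decomposition indexed by `ℤ` is a grading. -/
@[reducible]
def GradedSpace.ofIsInternal {X : Type*} [AddCommGroup X] [Module ℚ X] (A : ℤ → Submodule ℚ X)
    (h : DirectSum.IsInternal A) : GradedSpace X :=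
  have hb : Function.Bijective (DirectSum.coeLinearMap A) := h
  { deg := A
    wt := fun t => (DirectSum.toModule ℚ ℤ X fun n => (t : ℚ) ^ n • (A n).subtype) ∘ₗ
      (LinearEquiv.ofBijective (DirectSum.coeLinearMap A) hb).symm.toLinearMap
    wt_of_mem := fun t n x hx => by
      have : (LinearEquiv.ofBijective (DirectSum.coeLinearMap A) hb).symm x
          = DirectSum.lof ℚ ℤ (fun n => A n) n ⟨x, hx⟩ := by
        rw [LinearEquiv.symm_apply_eq]
        simp
      simp [this]
    iSup_deg := h.submodule_iSup_eq_top }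

/-! ### Signs -/

/-- For commuting sign operators `s`, `t` with parities `p`, `q`: multiplication by `(-1)^{pq}`. -/
def koszul (s t : X →ₗ[ℚ] X) : X →ₗ[ℚ] X := (1 / 2 : ℚ) • (LinearMap.id + s + t - s ∘ₗ t)

theorem koszul_apply {A : Type*} [AddCommGroup A] [Module ℚ A] {s t : A →ₗ[ℚ] A} {p q : ℤ} {x : A}
    (hs : s x = (-1 : ℚ) ^ p • x)
    (ht : t x = (-1 : ℚ) ^ q • x) : koszul s t x = (-1 : ℚ) ^ (p * q) • x := by
  simp only [koszul, LinearMap.smul_apply, LinearMap.sub_apply, LinearMap.add_apply,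
    LinearMap.id_apply, LinearMap.comp_apply, hs, ht, map_smul]
  rw [zpow_mul]
  rcases Int.even_or_odd p with hp | hp <;> rcases Int.even_or_odd q with hq | hq <;>
    simp only [hp.neg_one_zpow, hq.neg_one_zpow, one_zpow] <;> module

/-! ### Standard gradings -/

instance : GradedSpace ℚ where
  deg n := if n = 0 then ⊤ else ⊥
  wt _ := LinearMap.id
  wt_of_mem t n x hx := by
    split_ifs at hx with h
    · simp [h]
    · simp [(Submodule.mem_bot ℚ).1 hx]
  iSup_deg := eq_top_iff.2 (le_trans (by simp) (le_iSup _ (0 : ℤ)))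

instance : GradedSpace (X ⊗[ℚ] Y) where
  deg n := Submodule.span ℚ {z | ∃ p q, p + q = n ∧ ∃ x ∈ deg X p, ∃ y ∈ deg Y q, z = x ⊗ₜ y}
  wt t := TensorProduct.map (GradedSpace.wt t) (GradedSpace.wt t)
  wt_of_mem t n z hz := by
    induction hz using Submodule.span_induction with
    | mem z hz =>
      obtain ⟨p, q, rfl, x, hx, y, hy, rfl⟩ := hz
      rw [TensorProduct.map_tmul, GradedSpace.wt_of_mem t p x hx, GradedSpace.wt_of_mem t q y hy,
        TensorProduct.smul_tmul_smul, zpow_add₀ t.ne_zero]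
    | zero => simp
    | add x y _ _ hx hy => simp [hx, hy]
    | smul a x _ hx => simp [hx, smul_comm a]
  iSup_deg := by
    rw [eq_top_iff]
    rintro z -
    induction z using TensorProduct.induction_on with
    | zero => simp
    | add x y hx hy => exact add_mem hx hy
    | tmul x y =>
      induction x using deg_induction with
      | h0 => simp
      | hadd a b ha hb => rw [TensorProduct.add_tmul]; exact add_mem ha hb
      | h p x hx =>
        induction y using deg_induction with
        | h0 => simp
        | hadd a b ha hb => rw [TensorProduct.tmul_add]; exact add_mem ha hb
        | h q y hy =>
          exact Submodule.mem_iSup_of_mem (p + q)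
            (Submodule.subset_span ⟨p, q, rfl, x, hx, y, hy, rfl⟩)

theorem tmul_mem {p q n : ℤ} (h : p + q = n) {x : X} {y : Y} (hx : x ∈ deg X p)
    (hy : y ∈ deg Y q) : x ⊗ₜ[ℚ] y ∈ deg (X ⊗[ℚ] Y) n :=
  Submodule.subset_span ⟨p, q, h, x, hx, y, hy, rfl⟩

/-- To bound the degree of a map on a tensor product it suffices to look at pure tensors. -/
theorem tensor_homDeg {T : X ⊗[ℚ] Y →ₗ[ℚ] Z} {s : ℤ}
    (h : ∀ p q, ∀ x ∈ deg X p, ∀ y ∈ deg Y q, T (x ⊗ₜ y) ∈ deg Z (p + q + s))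
    (k : ℤ) (z : X ⊗[ℚ] Y) (hz : z ∈ deg (X ⊗[ℚ] Y) k) : T z ∈ deg Z (k + s) := by
  induction hz using Submodule.span_induction with
  | mem z hz =>
    obtain ⟨p, q, rfl, x, hx, y, hy, rfl⟩ := hz
    exact h p q x hx y hy
  | zero => simp
  | add x y _ _ hx hy => rw [map_add]; exact add_mem hx hy
  | smul a x _ hx => rw [map_smul]; exact Submodule.smul_mem _ _ hx

/-- The suspension `sX`: the same vector space, with `(sX)_n = X_{n-1}`. -/
def Susp (X : Type*) : Type _ := X

instance : AddCommGroup (Susp X) := inferInstanceAs (AddCommGroup X)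
instance : Module ℚ (Susp X) := inferInstanceAs (Module ℚ X)

/-- The map `x ↦ sx`. -/
def susp (X : Type*) [AddCommGroup X] [Module ℚ X] : X ≃ₗ[ℚ] Susp X := LinearEquiv.refl ℚ X

instance : GradedSpace (Susp X) where
  deg n := (deg X (n - 1)).comap (susp X).symm.toLinearMap
  wt t := (t : ℚ) • ((susp X).toLinearMap ∘ₗ GradedSpace.wt t ∘ₗ (susp X).symm.toLinearMap)
  wt_of_mem t n x hx := by
    have h := GradedSpace.wt_of_mem t (n - 1) _ (Submodule.mem_comap.1 hx)
    simp only [LinearEquiv.coe_coe] at h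
    simp only [LinearMap.smul_apply, LinearMap.comp_apply, LinearEquiv.coe_coe, h, map_smul,
      LinearEquiv.apply_symm_apply, smul_smul]
    rw [← zpow_one_add₀ t.ne_zero]; congr 2; ring
  iSup_deg := by
    rw [eq_top_iff]
    rintro z -
    obtain ⟨x, rfl⟩ := (susp X).surjective z
    induction x using deg_induction with
    | h0 => simp
    | hadd a b ha hb => rw [map_add]; exact add_mem ha hb
    | h p x hx =>
      refine Submodule.mem_iSup_of_mem (p + 1) ?_
      simpa using hx

theorem susp_mem {n : ℤ} {x : X} (hx : x ∈ deg X n) : susp X x ∈ deg (Susp X) (n + 1) := by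
  refine Submodule.mem_comap.2 ?_
  simpa using hx

/-! ### Graded Hom -/

/-- Linear maps of degree `n`: they raise degrees by `n`. -/
def homDeg (X Y : Type*) [AddCommGroup X] [Module ℚ X] [AddCommGroup Y] [Module ℚ Y]
    [GradedSpace X] [GradedSpace Y] (n : ℤ) : Submodule ℚ (X →ₗ[ℚ] Y) where
  carrier := {f | ∀ k, ∀ x ∈ deg X k, f x ∈ deg Y (k + n)}
  zero_mem' := by intro k x _; simp
  add_mem' := by intro f g hf hg k x hx; exact add_mem (hf k x hx) (hg k x hx)
  smul_mem' := by intro a f hf k x hx; exact Submodule.smul_mem _ _ (hf k x hx)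

/-- The graded vector space `Hom(X, Y) = ⨁_n ∏_k Hom(X_k, Y_{k+n})`, inside all linear maps. -/
def gHom (X Y : Type*) [AddCommGroup X] [Module ℚ X] [AddCommGroup Y] [Module ℚ Y]
    [GradedSpace X] [GradedSpace Y] : Submodule ℚ (X →ₗ[ℚ] Y) := ⨆ n, homDeg X Y n

/-- The graded vector space `Hom(X, Y)` as a type; `GHom X ℚ` is the graded dual of `X`. -/
def GHom (X Y : Type*) [AddCommGroup X] [Module ℚ X] [AddCommGroup Y] [Module ℚ Y]
    [GradedSpace X] [GradedSpace Y] : Type _ := gHom X Y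

instance : AddCommGroup (GHom X Y) := inferInstanceAs (AddCommGroup (gHom X Y))
instance : Module ℚ (GHom X Y) := inferInstanceAs (Module ℚ (gHom X Y))

/-- The linear map underlying an element of `GHom X Y`. -/
def GHom.val : GHom X Y →ₗ[ℚ] (X →ₗ[ℚ] Y) := (gHom X Y).subtype

/-- The element of `GHom X Y` given by a linear map. -/
def GHom.mk (f : X →ₗ[ℚ] Y) (hf : f ∈ gHom X Y) : GHom X Y := ⟨f, hf⟩

@[simp] theorem GHom.val_mk (f : X →ₗ[ℚ] Y) (hf : f ∈ gHom X Y) : (GHom.mk f hf).val = f := rfl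

theorem GHom.val_injective : Function.Injective (GHom.val : GHom X Y →ₗ[ℚ] (X →ₗ[ℚ] Y)) :=
  (gHom X Y).injective_subtype

@[ext] theorem GHom.ext {f g : GHom X Y} (h : f.val = g.val) : f = g := GHom.val_injective h

theorem GHom.val_mem (f : GHom X Y) : f.val ∈ gHom X Y := f.2

/-- The restriction to graded Homs of an operation on linear maps. -/
def GHom.map {X' Y' : Type*} [AddCommGroup X'] [Module ℚ X'] [AddCommGroup Y']
    [Module ℚ Y'] [GradedSpace X'] [GradedSpace Y'] (T : (X →ₗ[ℚ] Y) →ₗ[ℚ] (X' →ₗ[ℚ] Y'))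
    (h : ∀ f ∈ gHom X Y, T f ∈ gHom X' Y') : GHom X Y →ₗ[ℚ] GHom X' Y' := T.restrict h

@[simp] theorem GHom.val_map {X' Y' : Type*} [AddCommGroup X'] [Module ℚ X'] [AddCommGroup Y']
    [Module ℚ Y'] [GradedSpace X'] [GradedSpace Y'] (T : (X →ₗ[ℚ] Y) →ₗ[ℚ] (X' →ₗ[ℚ] Y'))
    (h : ∀ f ∈ gHom X Y, T f ∈ gHom X' Y') (f : GHom X Y) : (GHom.map T h f).val = T f.val := rfl

theorem mem_gHom {n : ℤ} {f : X →ₗ[ℚ] Y} (hf : f ∈ homDeg X Y n) : f ∈ gHom X Y :=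
  Submodule.mem_iSup_of_mem n hf

/-- A linear operation on maps that shifts degrees restricts to the graded Hom. -/
theorem gHom_induction {X' Y' : Type*} [AddCommGroup X'] [Module ℚ X'] [AddCommGroup Y']
    [Module ℚ Y'] [GradedSpace X'] [GradedSpace Y'] (T : (X →ₗ[ℚ] Y) →ₗ[ℚ] (X' →ₗ[ℚ] Y')) (s : ℤ)
    (h : ∀ n, ∀ f ∈ homDeg X Y n, T f ∈ homDeg X' Y' (n + s)) {f : X →ₗ[ℚ] Y}
    (hf : f ∈ gHom X Y) : T f ∈ gHom X' Y' := by
  have : gHom X Y ≤ (gHom X' Y').comap T := iSup_le fun n f hf => mem_gHom (h n f hf)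
  exact this hf

theorem comp_mem {s t n : ℤ} {g : Y →ₗ[ℚ] Z} {f : X →ₗ[ℚ] Y} (hg : g ∈ homDeg Y Z t)
    (hf : f ∈ homDeg X Y s) (h : s + t = n) : g ∘ₗ f ∈ homDeg X Z n := by
  intro k x hx
  have := hg _ _ (hf k x hx)
  rwa [add_assoc, h] at this

theorem map_mem {X' Y' : Type*} [AddCommGroup X'] [Module ℚ X'] [AddCommGroup Y']
    [Module ℚ Y'] [GradedSpace X'] [GradedSpace Y'] {s t n : ℤ} {f : X →ₗ[ℚ] X'} {g : Y →ₗ[ℚ] Y'}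
    (hf : f ∈ homDeg X X' s) (hg : g ∈ homDeg Y Y' t) (h : s + t = n) :
    TensorProduct.map f g ∈ homDeg (X ⊗[ℚ] Y) (X' ⊗[ℚ] Y') n := by
  refine tensor_homDeg fun p q x hx y hy => ?_
  exact tmul_mem (by rw [← h]; ring) (hf p x hx) (hg q y hy)

theorem id_mem : (LinearMap.id : X →ₗ[ℚ] X) ∈ homDeg X X 0 := by
  intro k x hx; simpa using hx

theorem wt_mem (t : ℚˣ) : (GradedSpace.wt t : X →ₗ[ℚ] X) ∈ homDeg X X 0 := by
  intro k x hx
  rw [GradedSpace.wt_of_mem t k x hx, add_zero]; exact Submodule.smul_mem _ _ hx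

theorem sgn_mem_homDeg : sgn X ∈ homDeg X X 0 := wt_mem _

/-- Conjugation of a linear map by the weight operators. -/
def wtHom (X Y : Type*) [AddCommGroup X] [Module ℚ X] [AddCommGroup Y] [Module ℚ Y]
    [GradedSpace X] [GradedSpace Y] (t : ℚˣ) : (X →ₗ[ℚ] Y) →ₗ[ℚ] (X →ₗ[ℚ] Y) where
  toFun f := GradedSpace.wt t ∘ₗ f ∘ₗ GradedSpace.wt t⁻¹
  map_add' := by intros; ext; simp
  map_smul' := by intros; ext; simp

theorem wtHom_of_mem (t : ℚˣ) {n : ℤ} {f : X →ₗ[ℚ] Y} (hf : f ∈ homDeg X Y n) :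
    wtHom X Y t f = (t : ℚ) ^ n • f := by
  refine hom_ext_deg fun k x hx => ?_
  simp only [wtHom, LinearMap.coe_mk, AddHom.coe_mk, LinearMap.comp_apply, LinearMap.smul_apply,
    GradedSpace.wt_of_mem t⁻¹ k x hx, map_smul, GradedSpace.wt_of_mem t _ _ (hf k x hx), smul_smul]
  congr 1
  rw [zpow_add₀ t.ne_zero, ← mul_assoc, Units.val_inv_eq_inv_val, ← mul_zpow,
    inv_mul_cancel₀ t.ne_zero, one_zpow, one_mul]

theorem wtHom_mem_homDeg (t : ℚˣ) {n : ℤ} {f : X →ₗ[ℚ] Y} (hf : f ∈ homDeg X Y n) :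
    wtHom X Y t f ∈ homDeg X Y n := by
  rw [wtHom_of_mem t hf]; exact Submodule.smul_mem _ _ hf

/-- The sign operator `f ↦ (-1)^{|f|} f` on linear maps. -/
abbrev sgnHom (X Y : Type*) [AddCommGroup X] [Module ℚ X] [AddCommGroup Y] [Module ℚ Y]
    [GradedSpace X] [GradedSpace Y] : (X →ₗ[ℚ] Y) →ₗ[ℚ] (X →ₗ[ℚ] Y) := wtHom X Y (-1)

instance : GradedSpace (GHom X Y) where
  deg n := (homDeg X Y n).comap GHom.val
  wt t := GHom.map (wtHom X Y t) fun _ hf => gHom_induction (wtHom X Y t) 0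
    (fun _ _ h => by rw [add_zero]; exact wtHom_mem_homDeg t h) hf
  wt_of_mem t n f hf := GHom.ext (by
    rw [GHom.val_map, wtHom_of_mem t (Submodule.mem_comap.1 hf), map_smul])
  iSup_deg := by
    apply Submodule.map_injective_of_injective (f := GHom.val) GHom.val_injective
    rw [Submodule.map_iSup, Submodule.map_top]
    have h : LinearMap.range (GHom.val : GHom X Y →ₗ[ℚ] (X →ₗ[ℚ] Y)) = gHom X Y :=
      (gHom X Y).range_subtype
    rw [h]
    refine iSup_congr fun n => ?_
    rw [Submodule.map_comap_eq, h]
    exact inf_eq_right.2 (le_iSup _ n)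

/-! ### Signed permutations of tensor factors -/

theorem koszul_mem {s t : X →ₗ[ℚ] X} (hs : s ∈ homDeg X X 0) (ht : t ∈ homDeg X X 0) :
    koszul s t ∈ homDeg X X 0 :=
  Submodule.smul_mem _ _
    (Submodule.sub_mem _ (add_mem (add_mem id_mem hs) ht) (comp_mem hs ht (add_zero 0)))

/-- `x ⊗ y ↦ (-1)^{|x||y|} y ⊗ x`. -/
def braid (X Y : Type*) [AddCommGroup X] [Module ℚ X] [AddCommGroup Y] [Module ℚ Y]
    [GradedSpace X] [GradedSpace Y] : X ⊗[ℚ] Y →ₗ[ℚ] Y ⊗[ℚ] X :=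
  (TensorProduct.comm ℚ X Y).toLinearMap ∘ₗ
    koszul (TensorProduct.map (sgn X) LinearMap.id) (TensorProduct.map LinearMap.id (sgn Y))

theorem braid_mem : braid X Y ∈ homDeg (X ⊗[ℚ] Y) (Y ⊗[ℚ] X) 0 := by
  refine comp_mem (s := 0) (t := 0) ?_ (koszul_mem (map_mem sgn_mem_homDeg id_mem (add_zero 0))
    (map_mem id_mem sgn_mem_homDeg (add_zero 0))) (add_zero 0)
  refine tensor_homDeg fun p q x hx y hy => ?_
  exact tmul_mem (by ring) hy hx

/-- `(x ⊗ y) ⊗ (z ⊗ w) ↦ (-1)^{|y||z|} (x ⊗ z) ⊗ (y ⊗ w)`. -/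
def interchange (X Y Z W : Type*) [AddCommGroup X] [Module ℚ X] [AddCommGroup Y] [Module ℚ Y]
    [AddCommGroup Z] [Module ℚ Z] [AddCommGroup W] [Module ℚ W]
    [GradedSpace Y] [GradedSpace Z] :
    (X ⊗[ℚ] Y) ⊗[ℚ] (Z ⊗[ℚ] W) →ₗ[ℚ] (X ⊗[ℚ] Z) ⊗[ℚ] (Y ⊗[ℚ] W) :=
  (TensorProduct.tensorTensorTensorComm ℚ X Y Z W).toLinearMap ∘ₗ
    koszul (TensorProduct.map (TensorProduct.map LinearMap.id (sgn Y)) LinearMap.id)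
      (TensorProduct.map LinearMap.id (TensorProduct.map (sgn Z) LinearMap.id))

theorem interchange_tmul {A W : Type*} [AddCommGroup A] [Module ℚ A] [AddCommGroup W] [Module ℚ W]
    {p q : ℤ} (x : A) {y : Y} {z : Z} (w : W) (hy : y ∈ deg Y p) (hz : z ∈ deg Z q) :
    interchange A Y Z W ((x ⊗ₜ y) ⊗ₜ (z ⊗ₜ w)) =
      (-1 : ℚ) ^ (p * q) • ((x ⊗ₜ z) ⊗ₜ[ℚ] (y ⊗ₜ[ℚ] w)) := by
  have := koszul_apply
    (s := TensorProduct.map (TensorProduct.map (LinearMap.id (M := A)) (sgn Y))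
      (LinearMap.id (M := Z ⊗[ℚ] W)))
    (t := TensorProduct.map (LinearMap.id (M := A ⊗[ℚ] Y))
      (TensorProduct.map (sgn Z) (LinearMap.id (M := W))))
    (p := p) (q := q) (x := (x ⊗ₜ y) ⊗ₜ (z ⊗ₜ w))
    (by simp [sgn_of_mem hy, TensorProduct.tmul_smul, TensorProduct.smul_tmul'])
    (by
      simp only [TensorProduct.map_tmul, LinearMap.id_apply, sgn_of_mem hz, TensorProduct.tmul_smul,
        ← TensorProduct.smul_tmul'])
  simp [interchange, this]

theorem interchange_mem {W : Type*} [AddCommGroup W] [Module ℚ W] [GradedSpace W] :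
    interchange X Y Z W ∈
      homDeg ((X ⊗[ℚ] Y) ⊗[ℚ] (Z ⊗[ℚ] W)) ((X ⊗[ℚ] Z) ⊗[ℚ] (Y ⊗[ℚ] W)) 0 := by
  intro k v hv
  induction hv using Submodule.span_induction with
  | zero => simp
  | add x y _ _ hx hy => rw [map_add]; exact add_mem hx hy
  | smul a x _ hx => rw [map_smul]; exact Submodule.smul_mem _ _ hx
  | mem v hv =>
    obtain ⟨a, b, rfl, v, hv, w, hw, rfl⟩ := hv
    induction hv using Submodule.span_induction with
    | zero => simp
    | add x y _ _ hx hy => rw [TensorProduct.add_tmul, map_add]; exact add_mem hx hy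
    | smul a x _ hx =>
      rw [← TensorProduct.smul_tmul', map_smul]; exact Submodule.smul_mem _ _ hx
    | mem v hv =>
      induction hw using Submodule.span_induction with
      | zero => simp
      | add x y _ _ hx hy => rw [TensorProduct.tmul_add, map_add]; exact add_mem hx hy
      | smul a x _ hx =>
        rw [TensorProduct.tmul_smul, map_smul]; exact Submodule.smul_mem _ _ hx
      | mem w hw =>
        obtain ⟨p, q, rfl, x, hx, y, hy, rfl⟩ := hv
        obtain ⟨p', q', rfl, z, hz, w, hw, rfl⟩ := hw
        rw [interchange_tmul x w hy hz]
        exact Submodule.smul_mem _ _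
          (tmul_mem (by ring) (tmul_mem rfl hx hz) (tmul_mem rfl hy hw))

/-- `f ⊗ g` with the sign `(f ⊗ g)(x ⊗ y) = (-1)^{|g||x|} f x ⊗ g y`. -/
def homTensor (X Y X' Y' : Type*) [AddCommGroup X] [Module ℚ X] [AddCommGroup Y] [Module ℚ Y]
    [AddCommGroup X'] [Module ℚ X'] [AddCommGroup Y'] [Module ℚ Y']
    [GradedSpace X] [GradedSpace Y] [GradedSpace Y'] :
    (X →ₗ[ℚ] X') →ₗ[ℚ] (Y →ₗ[ℚ] Y') →ₗ[ℚ] (X ⊗[ℚ] Y →ₗ[ℚ] X' ⊗[ℚ] Y') :=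
  LinearMap.mk₂ ℚ
    (fun f g => (1 / 2 : ℚ) • (TensorProduct.map f g + TensorProduct.map (f ∘ₗ sgn X) g
      + TensorProduct.map f (sgnHom Y Y' g) - TensorProduct.map (f ∘ₗ sgn X) (sgnHom Y Y' g)))
    (fun f f' g => by
      simp only [LinearMap.add_comp, TensorProduct.map_add_left]; module)
    (fun a f g => by
      simp only [LinearMap.smul_comp, TensorProduct.map_smul_left]; module)
    (fun f g g' => by
      simp only [map_add, TensorProduct.map_add_right]; module)
    (fun a f g => by
      simp only [map_smul, TensorProduct.map_smul_right]; module)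

theorem homTensor_apply {X' Y' : Type*} [AddCommGroup X'] [Module ℚ X'] [AddCommGroup Y']
    [Module ℚ Y'] [GradedSpace Y'] {p q : ℤ} (f : X →ₗ[ℚ] X') {g : Y →ₗ[ℚ] Y'} {x : X} (y : Y)
    (hg : g ∈ homDeg Y Y' p) (hx : x ∈ deg X q) :
    homTensor X Y X' Y' f g (x ⊗ₜ y) = (-1 : ℚ) ^ (p * q) • (f x ⊗ₜ g y) := by
  have h := wtHom_of_mem (-1) hg
  simp only [Units.val_neg, Units.val_one] at h
  simp only [homTensor, LinearMap.mk₂_apply, LinearMap.smul_apply, LinearMap.sub_apply,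
    LinearMap.add_apply, TensorProduct.map_tmul, LinearMap.comp_apply, sgn_of_mem hx, h, map_smul,
    TensorProduct.tmul_smul, ← TensorProduct.smul_tmul']
  rw [zpow_mul]
  rcases Int.even_or_odd p with hp | hp <;> rcases Int.even_or_odd q with hq | hq <;>
    simp only [hp.neg_one_zpow, hq.neg_one_zpow, one_zpow] <;> module

theorem homTensor_mem {X' Y' : Type*} [AddCommGroup X'] [Module ℚ X'] [AddCommGroup Y']
    [Module ℚ Y'] [GradedSpace X'] [GradedSpace Y'] {s t n : ℤ} {f : X →ₗ[ℚ] X'} {g : Y →ₗ[ℚ] Y'}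
    (hf : f ∈ homDeg X X' s) (hg : g ∈ homDeg Y Y' t) (h : s + t = n) :
    homTensor X Y X' Y' f g ∈ homDeg (X ⊗[ℚ] Y) (X' ⊗[ℚ] Y') n := by
  refine tensor_homDeg fun p q x hx y hy => ?_
  rw [homTensor_apply f y hg hx]
  exact Submodule.smul_mem _ _ (tmul_mem (by rw [← h]; ring) (hf p x hx) (hg q y hy))

/-- The differential `d_X ⊗ 1 + 1 ⊗ d_Y`, that is `x ⊗ y ↦ d x ⊗ y + (-1)^{|x|} x ⊗ d y`. -/
def tensorD (dX : X →ₗ[ℚ] X) (dY : Y →ₗ[ℚ] Y) : X ⊗[ℚ] Y →ₗ[ℚ] X ⊗[ℚ] Y :=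
  TensorProduct.map dX LinearMap.id + TensorProduct.map (sgn X) dY

end Basic

/-! ### Algebras given by homogeneous generators -/

section Words
variable {V : Type*} [AddCommGroup V] [Module ℚ V] [GradedSpace V]
  {Q : Type*} [Ring Q] [Algebra ℚ Q]

/-- `IsWord j n w`: `w` is a product of images of homogeneous elements of total degree `n`. -/
inductive IsWord (j : V →ₗ[ℚ] Q) : ℤ → Q → Prop
  | one : IsWord j 0 1
  | cons {p n : ℤ} {x : V} {w : Q} : x ∈ deg V p → IsWord j n w → IsWord j (p + n) (j x * w)

theorem IsWord.mul {j : V →ₗ[ℚ] Q} {n k : ℤ} {v w : Q} (hv : IsWord j n v) (hw : IsWord j k w) :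
    IsWord j (n + k) (v * w) := by
  induction hv with
  | one => simpa using hw
  | cons hx _ ih => rw [mul_assoc, add_assoc]; exact .cons hx ih

/-- The grading of an algebra with generators in given degrees. -/
@[reducible]
def wordGrading (j : V →ₗ[ℚ] Q) (σ : ℚˣ → Q →ₐ[ℚ] Q)
    (hσ : ∀ t x, σ t (j x) = j (GradedSpace.wt t x))
    (hgen : Algebra.adjoin ℚ (Set.range j) = ⊤) : GradedSpace Q where
  deg n := Submodule.span ℚ {w | IsWord j n w}
  wt t := (σ t).toLinearMap
  wt_of_mem t n x hx := by
    induction hx using Submodule.span_induction with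
    | zero => simp
    | add x y _ _ hx hy => simp only [map_add, hx, hy, smul_add]
    | smul a x _ hx => simp only [map_smul, hx, smul_comm a]
    | mem w hw =>
      induction hw with
      | one => simp
      | cons hx _ ih =>
        simp only [AlgHom.toLinearMap_apply] at ih ⊢
        rw [map_mul, ih, hσ, GradedSpace.wt_of_mem t _ _ hx, map_smul, smul_mul_smul_comm,
          zpow_add₀ t.ne_zero]
  iSup_deg := by
    rw [eq_top_iff]
    set M : Submodule ℚ Q := ⨆ n, Submodule.span ℚ {w | IsWord j n w} with hM
    have hw : ∀ n w, IsWord j n w → w ∈ M := fun n w h =>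
      Submodule.mem_iSup_of_mem n (Submodule.subset_span h)
    have key : ∀ q ∈ Algebra.adjoin ℚ (Set.range j), ∀ w ∈ M, q * w ∈ M := by
      intro q hq
      induction hq using Algebra.adjoin_induction with
      | algebraMap r =>
        intro w hw; rw [← Algebra.smul_def]; exact M.smul_mem _ hw
      | add a b _ _ ha hb => intro w hw; rw [add_mul]; exact add_mem (ha w hw) (hb w hw)
      | mul a b _ _ ha hb => intro w hw; rw [mul_assoc]; exact ha _ (hb w hw)
      | mem q hq =>
        obtain ⟨x, rfl⟩ := hq
        intro w hwM
        have : M ≤ M.comap (LinearMap.mulLeft ℚ (j x)) := by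
          refine iSup_le fun n => Submodule.span_le.2 fun w hn => ?_
          show j x * w ∈ M
          induction x using deg_induction with
          | h p x hx => exact hw _ _ (.cons hx hn)
          | h0 => simp
          | hadd a b ha hb => rw [map_add, add_mul]; exact add_mem ha hb
        exact this hwM
    intro q _
    have := key q (by rw [hgen]; trivial) 1 (hw 0 1 .one)
    simpa using this

end Words


/-! ### The free graded commutative algebra -/

section GSym
variable (V : Type*) [AddCommGroup V] [Module ℚ V] [GradedSpace V]

/-- Graded commutativity of homogeneous generators. -/
inductive GSym.Rel : TensorAlgebra ℚ V → TensorAlgebra ℚ V → Prop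
  | comm {p q : ℤ} {x y : V} : x ∈ deg V p → y ∈ deg V q →
      GSym.Rel (TensorAlgebra.ι ℚ x * TensorAlgebra.ι ℚ y)
        ((-1 : ℚ) ^ (p * q) • (TensorAlgebra.ι ℚ y * TensorAlgebra.ι ℚ x))

/-- The free graded commutative algebra `∧V`. -/
def GSym : Type _ := RingQuot (GSym.Rel V)

instance : Ring (GSym V) := inferInstanceAs (Ring (RingQuot (GSym.Rel V)))
instance : Algebra ℚ (GSym V) := inferInstanceAs (Algebra ℚ (RingQuot (GSym.Rel V)))

/-- The inclusion of the generators. -/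
def GSym.ι : V →ₗ[ℚ] GSym V :=
  (RingQuot.mkAlgHom ℚ (GSym.Rel V)).toLinearMap ∘ₗ TensorAlgebra.ι ℚ

variable {V}

theorem GSym.ι_comm {p q : ℤ} {x y : V} (hx : x ∈ deg V p) (hy : y ∈ deg V q) :
    GSym.ι V x * GSym.ι V y = (-1 : ℚ) ^ (p * q) • (GSym.ι V y * GSym.ι V x) := by
  have := RingQuot.mkAlgHom_rel ℚ (GSym.Rel.comm hx hy)
  rw [map_mul, map_smul, map_mul] at this
  exact this

/-- The universal property of `∧V`. -/
def GSym.lift {A : Type*} [Ring A] [Algebra ℚ A] (f : V →ₗ[ℚ] A)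
    (hf : ∀ p q, ∀ x ∈ deg V p, ∀ y ∈ deg V q, f x * f y = (-1 : ℚ) ^ (p * q) • (f y * f x)) :
    GSym V →ₐ[ℚ] A :=
  RingQuot.liftAlgHom ℚ ⟨TensorAlgebra.lift ℚ f, fun _ _ h => by
    cases h with
    | comm hx hy => simpa using hf _ _ _ hx _ hy⟩

@[simp] theorem GSym.lift_ι {A : Type*} [Ring A] [Algebra ℚ A] (f : V →ₗ[ℚ] A) (hf) (x : V) :
    GSym.lift f hf (GSym.ι V x) = f x := by
  have := RingQuot.liftAlgHom_mkAlgHom_apply ℚ (TensorAlgebra.lift ℚ f) (s := GSym.Rel V)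
    (fun _ _ h => by
      cases h with
      | comm hx hy => simpa using hf _ _ _ hx _ hy) (TensorAlgebra.ι ℚ x)
  rw [TensorAlgebra.lift_ι_apply] at this
  exact this

theorem GSym.adjoin_ι : Algebra.adjoin ℚ (Set.range (GSym.ι V)) = ⊤ := by
  have h : Set.range (GSym.ι V) = (RingQuot.mkAlgHom ℚ (GSym.Rel V)) ''
      Set.range (TensorAlgebra.ι ℚ (M := V)) := by
    rw [← Set.range_comp]; rfl
  rw [h]
  refine (AlgHom.map_adjoin (RingQuot.mkAlgHom ℚ (GSym.Rel V)) _).symm.trans ?_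
  rw [TensorAlgebra.adjoin_range_ι, Algebra.map_top]
  exact (AlgHom.range_eq_top _).2 (RingQuot.mkAlgHom_surjective ℚ _)

instance : GradedSpace (GSym V) :=
  wordGrading (GSym.ι V)
    (fun t => GSym.lift (GSym.ι V ∘ₗ GradedSpace.wt t) (fun p q x hx y hy => by
      simp only [LinearMap.comp_apply, GradedSpace.wt_of_mem t p x hx,
        GradedSpace.wt_of_mem t q y hy, map_smul, smul_mul_smul_comm, GSym.ι_comm hx hy]
      rw [smul_comm, mul_comm ((t : ℚ) ^ p)]))
    (fun t x => by simp) GSym.adjoin_ι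

theorem GSym.ι_mem {p : ℤ} {x : V} (hx : x ∈ deg V p) : GSym.ι V x ∈ deg (GSym V) p := by
  have := IsWord.cons (j := GSym.ι V) hx .one
  rw [mul_one, add_zero] at this
  exact Submodule.subset_span this

theorem GSym.one_mem : (1 : GSym V) ∈ deg (GSym V) 0 := Submodule.subset_span .one

theorem GSym.mul_mem : LinearMap.mul' ℚ (GSym V) ∈ homDeg (GSym V ⊗[ℚ] GSym V) (GSym V) 0 := by
  refine tensor_homDeg fun p q x hx y hy => ?_
  rw [add_zero, LinearMap.mul'_apply]
  induction hx using Submodule.span_induction with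
  | zero => simp
  | add a b _ _ ha hb => rw [add_mul]; exact add_mem ha hb
  | smul a b _ hb => rw [smul_mul_assoc]; exact Submodule.smul_mem _ _ hb
  | mem x hx =>
    induction hy using Submodule.span_induction with
    | zero => simp
    | add a b _ _ ha hb => rw [mul_add]; exact add_mem ha hb
    | smul a b _ hb => rw [mul_smul_comm]; exact Submodule.smul_mem _ _ hb
    | mem y hy => exact Submodule.subset_span (hx.mul hy)

/-- A linear map on `∧V` that starts from `m` and sends `x ∧ w` to `ρ x` applied to its value on
`w` has degree `0` if `m` has degree `0` and `ρ` respects degrees. -/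
theorem GSym.rec_mem {M : Type*} [AddCommGroup M] [Module ℚ M] (D : ℤ → Submodule ℚ M)
    (ρ : V →ₗ[ℚ] Module.End ℚ M) (hρ) (m : M) (hm : m ∈ D 0)
    (h : ∀ p n, ∀ x ∈ deg V p, ∀ y ∈ D n, ρ x y ∈ D (p + n)) (n : ℤ) (w : GSym V)
    (hw : w ∈ deg (GSym V) n) : GSym.lift ρ hρ w m ∈ D n := by
  induction hw using Submodule.span_induction with
  | zero => simp
  | add a b _ _ ha hb => rw [map_add]; exact add_mem ha hb
  | smul a b _ hb => rw [map_smul]; exact Submodule.smul_mem _ _ hb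
  | mem w hw =>
    induction hw with
    | one => simpa using hm
    | cons hx _ ih =>
      rw [map_mul, GSym.lift_ι]
      exact h _ _ _ hx _ ih

/-- The product `(a ⊗ b)(a' ⊗ b') = (-1)^{|b||a'|} aa' ⊗ bb'` of the pairings `f` and `g`. -/
def pairTensor {A B A' B' P P' : Type*} [AddCommGroup A] [Module ℚ A] [AddCommGroup B] [Module ℚ B]
    [AddCommGroup A'] [Module ℚ A'] [AddCommGroup B'] [Module ℚ B']
    [AddCommGroup P] [Module ℚ P] [AddCommGroup P'] [Module ℚ P'] [GradedSpace B] [GradedSpace A']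
    (f : A ⊗[ℚ] A' →ₗ[ℚ] P) (g : B ⊗[ℚ] B' →ₗ[ℚ] P') :
    (A ⊗[ℚ] B) ⊗[ℚ] (A' ⊗[ℚ] B') →ₗ[ℚ] P ⊗[ℚ] P' :=
  TensorProduct.map f g ∘ₗ interchange A B A' B'

/-- Left multiplication by `x ⊗ 1 + 1 ⊗ x` on `∧V ⊗ ∧V`. -/
def GSym.primitive (V : Type*) [AddCommGroup V] [Module ℚ V] [GradedSpace V] :
    V →ₗ[ℚ] Module.End ℚ (GSym V ⊗[ℚ] GSym V) :=
  TensorProduct.curry (pairTensor (LinearMap.mul' ℚ (GSym V)) (LinearMap.mul' ℚ (GSym V))) ∘ₗ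
    ((TensorProduct.mk ℚ (GSym V) (GSym V)).flip 1 + TensorProduct.mk ℚ (GSym V) (GSym V) 1) ∘ₗ
    GSym.ι V

theorem GSym.primitive_apply {p r : ℤ} {x : V} (hx : x ∈ deg V p) {z : GSym V} (w : GSym V)
    (hz : z ∈ deg (GSym V) r) :
    GSym.primitive V x (z ⊗ₜ w) =
      (GSym.ι V x * z) ⊗ₜ w + (-1 : ℚ) ^ (p * r) • (z ⊗ₜ[ℚ] (GSym.ι V x * w)) := by
  simp only [GSym.primitive, pairTensor, LinearMap.comp_apply, LinearMap.add_apply,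
    LinearMap.flip_apply, TensorProduct.mk_apply, TensorProduct.curry_apply,
    map_add]
  rw [interchange_tmul _ w GSym.one_mem hz, interchange_tmul _ w (GSym.ι_mem hx) hz]
  simp

theorem GSym.primitive_mem {p n : ℤ} {x : V} (hx : x ∈ deg V p) {y : GSym V ⊗[ℚ] GSym V}
    (hy : y ∈ deg (GSym V ⊗[ℚ] GSym V) n) :
    GSym.primitive V x y ∈ deg (GSym V ⊗[ℚ] GSym V) (p + n) := by
  rw [add_comm]
  refine tensor_homDeg (fun a b y hy w hw => ?_) n y hy
  rw [GSym.primitive_apply hx w hy]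
  have hm : ∀ {k} {v : GSym V}, v ∈ deg (GSym V) k → GSym.ι V x * v ∈ deg (GSym V) (p + k) := by
    intro k v hv
    have := GSym.mul_mem _ _ (tmul_mem rfl (GSym.ι_mem hx) hv)
    rwa [add_zero] at this
  exact add_mem (tmul_mem (by ring) (hm hy) hw)
    (Submodule.smul_mem _ _ (tmul_mem (by ring) hy (hm hw)))

theorem GSym.primitive_comm (p q : ℤ) (x : V) (hx : x ∈ deg V p) (y : V) (hy : y ∈ deg V q) :
    GSym.primitive V x * GSym.primitive V y =
      (-1 : ℚ) ^ (p * q) • (GSym.primitive V y * GSym.primitive V x) := by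
  refine TensorProduct.ext' fun z w => ?_
  induction z using deg_induction with
  | h0 => simp
  | hadd a b ha hb => simp only [TensorProduct.add_tmul, map_add, ha, hb]
  | h r z hz =>
    have hm : ∀ {k} {v : V}, v ∈ deg V k → GSym.ι V v * z ∈ deg (GSym V) (k + r) := by
      intro k v hv
      have := GSym.mul_mem _ _ (tmul_mem rfl (GSym.ι_mem hv) hz)
      rwa [add_zero] at this
    simp only [Module.End.mul_apply, LinearMap.smul_apply, GSym.primitive_apply hx _ hz,
      GSym.primitive_apply hy _ hz, map_add, map_smul, GSym.primitive_apply hx _ (hm hy),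
      GSym.primitive_apply hy _ (hm hx)]
    have e1 : GSym.ι V x * (GSym.ι V y * z) =
        (-1 : ℚ) ^ (p * q) • (GSym.ι V y * (GSym.ι V x * z)) := by
      rw [← mul_assoc, GSym.ι_comm hx hy, smul_mul_assoc, mul_assoc]
    have e2 : GSym.ι V x * (GSym.ι V y * w) =
        (-1 : ℚ) ^ (p * q) • (GSym.ι V y * (GSym.ι V x * w)) := by
      rw [← mul_assoc, GSym.ι_comm hx hy, smul_mul_assoc, mul_assoc]
    rw [e1, e2]
    have hne : (-1 : ℚ) ≠ 0 := by norm_num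
    have hsq : ((-1 : ℚ) ^ (p * q)) * ((-1 : ℚ) ^ (p * q)) = 1 := by
      rw [← mul_zpow]; norm_num
    simp only [TensorProduct.tmul_smul, ← TensorProduct.smul_tmul', mul_add, zpow_add₀ hne,
      mul_comm q p]
    match_scalars <;> first | ring1 | linear_combination (-(-1 : ℚ) ^ (q * r)) * hsq

/-- The coproduct of `∧V`, the algebra map with `Δ x = x ⊗ 1 + 1 ⊗ x` for `x ∈ V`; on a product of
generators it is the signed sum over all shuffles. -/
def GSym.comul (V : Type*) [AddCommGroup V] [Module ℚ V] [GradedSpace V] :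
    GSym V →ₗ[ℚ] GSym V ⊗[ℚ] GSym V :=
  (LinearMap.applyₗ (1 ⊗ₜ 1)) ∘ₗ
    (GSym.lift (GSym.primitive V) GSym.primitive_comm).toLinearMap

theorem GSym.comul_mem : GSym.comul V ∈ homDeg (GSym V) (GSym V ⊗[ℚ] GSym V) 0 := by
  intro n w hw
  rw [add_zero]
  exact GSym.rec_mem (fun n => deg (GSym V ⊗[ℚ] GSym V) n) (GSym.primitive V)
    GSym.primitive_comm (1 ⊗ₜ 1) (tmul_mem (add_zero 0) GSym.one_mem GSym.one_mem)
    (fun p n x hx y hy => GSym.primitive_mem hx hy) n w hw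

end GSym


/-! ### Differential graded Lie algebras -/

/-- A differential graded Lie algebra over `ℚ`. -/
class DGLie (L : Type*) [AddCommGroup L] [Module ℚ L] extends GradedSpace L where
  br : L →ₗ[ℚ] L →ₗ[ℚ] L
  d : L →ₗ[ℚ] L
  br_mem : ∀ (p q : ℤ) (x y : L), x ∈ deg p → y ∈ deg q → br x y ∈ deg (p + q)
  d_mem : ∀ (p : ℤ) (x : L), x ∈ deg p → d x ∈ deg (p - 1)
  d_d : ∀ x : L, d (d x) = 0
  skew : ∀ (p q : ℤ) (x y : L), x ∈ deg p → y ∈ deg q →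
    br x y = -((-1 : ℚ) ^ (p * q) • br y x)
  jacobi : ∀ (p q : ℤ) (x y z : L), x ∈ deg p → y ∈ deg q →
    br x (br y z) = br (br x y) z + (-1 : ℚ) ^ (p * q) • br y (br x z)
  leibniz : ∀ (p : ℤ) (x y : L), x ∈ deg p →
    d (br x y) = br (d x) y + (-1 : ℚ) ^ p • br x (d y)

section Lie
variable (L : Type*) [AddCommGroup L] [Module ℚ L] [DGLie L]

/-- The vector space underlying the chain coalgebra `C_*(L) = ∧sL`. -/
abbrev Chains : Type _ := GSym (Susp L)

/-- The vectors `(ε(c), τ(c), q(c))` attached to `c ∈ ∧sL`, computed by recursion: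
`ε` is the augmentation, `τ` the projection onto `∧¹sL = sL` followed by `sx ↦ x`, and `q` is the
map with `q(sx) = -dx`, `q(sx ∧ sy) = (-1)^{|sx|} [x, y]` that vanishes on `∧ᵏsL` for `k ≠ 1, 2`.
This is the operator by which a generator `sx` acts. -/
def chainStep : Susp L →ₗ[ℚ] Module.End ℚ (ℚ × L × L) :=
  LinearMap.mk₂ ℚ
    (fun x v => (0, v.1 • (susp L).symm x,
      -(v.1 • DGLie.d ((susp L).symm x)) - DGLie.br (sgn L ((susp L).symm x)) v.2.1))
    (fun x x' v => by ext <;> simp <;> abel)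
    (fun a x v => by ext <;> simp [smul_sub, smul_comm a])
    (fun x v v' => by ext <;> simp [add_smul] <;> abel)
    (fun a x v => by ext <;> simp [smul_sub, mul_smul])

theorem chainStep_comm (p q : ℤ) (x : Susp L) (hx : x ∈ deg (Susp L) p) (y : Susp L)
    (hy : y ∈ deg (Susp L) q) :
    chainStep L x * chainStep L y = (-1 : ℚ) ^ (p * q) • (chainStep L y * chainStep L x) := by
  have hx' : (susp L).symm x ∈ deg L (p - 1) := hx
  have hy' : (susp L).symm y ∈ deg L (q - 1) := hy
  refine LinearMap.ext fun v => ?_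
  simp only [chainStep, Module.End.mul_apply, LinearMap.smul_apply, LinearMap.mk₂_apply,
    sgn_of_mem hx', sgn_of_mem hy', map_smul, LinearMap.smul_apply]
  rw [DGLie.skew _ _ _ _ hx' hy']
  ext <;> simp only [Prod.smul_mk, zero_smul, smul_zero, neg_zero, smul_neg, sub_neg_eq_add,
    zero_add, zero_sub, smul_smul]
  rw [← neg_smul]
  congr 1
  have hne : (-1 : ℚ) ≠ 0 := by norm_num
  have e : (-1 : ℚ) ^ ((p - 1) * (q - 1)) = -((-1 : ℚ) ^ (p * q) * (-1) ^ p * (-1) ^ q) := by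
    have : (p - 1) * (q - 1) = p * q - p - q + 1 := by ring
    rw [this, zpow_add₀ hne, zpow_sub₀ hne, zpow_sub₀ hne]
    rcases Int.even_or_odd p with hp | hp <;> rcases Int.even_or_odd q with hq | hq <;>
      simp [hp.neg_one_zpow, hq.neg_one_zpow, div_neg]
  rw [e, zpow_sub₀ hne, zpow_sub₀ hne]
  rcases Int.even_or_odd p with hp | hp <;> rcases Int.even_or_odd q with hq | hq <;>
      simp [hp.neg_one_zpow, hq.neg_one_zpow, mul_comm]

/-- `c ↦ (ε(c), τ(c), q(c))`. -/
def chainData : Chains L →ₗ[ℚ] ℚ × L × L :=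
  (LinearMap.applyₗ (1, 0, 0)) ∘ₗ (GSym.lift (chainStep L) (chainStep_comm L)).toLinearMap

/-- The augmentation of `C_*(L)`. -/
def chainCounit : Chains L →ₗ[ℚ] ℚ := LinearMap.fst ℚ ℚ (L × L) ∘ₗ chainData L

/-- The projection `C_*(L) → sL → L`. -/
def chainTau : Chains L →ₗ[ℚ] L := LinearMap.fst ℚ L L ∘ₗ LinearMap.snd ℚ ℚ (L × L) ∘ₗ chainData L

/-- The desuspended corestriction `C_*(L) → sL` of the differential. -/
def chainQ : Chains L →ₗ[ℚ] L := LinearMap.snd ℚ L L ∘ₗ LinearMap.snd ℚ ℚ (L × L) ∘ₗ chainData L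

theorem chainData_mem (n : ℤ) (w : Chains L) (hw : w ∈ deg (Chains L) n) :
    chainCounit L w ∈ deg ℚ n ∧ chainTau L w ∈ deg L (n - 1) ∧ chainQ L w ∈ deg L (n - 2) := by
  refine GSym.rec_mem
    (fun n => (deg ℚ n).prod ((deg L (n - 1)).prod (deg L (n - 2)))) (chainStep L)
    (chainStep_comm L) (1, 0, 0) ⟨by simp [deg, GradedSpace.deg], by simp, by simp⟩ ?_ n w hw
  rintro p n x hx ⟨a, y, z⟩ ⟨ha, hy, hz⟩
  have hx' : (susp L).symm x ∈ deg L (p - 1) := hx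
  simp only at ha hy hz
  refine ⟨by simp [chainStep], ?_, ?_⟩
  · show a • (susp L).symm x ∈ deg L (p + n - 1)
    by_cases hn : n = 0
    · subst hn; simpa using Submodule.smul_mem _ a hx'
    · have : a = 0 := by simpa [deg, GradedSpace.deg, hn] using ha
      simp [this]
  · show -(a • DGLie.d ((susp L).symm x)) - DGLie.br (sgn L ((susp L).symm x)) y
      ∈ deg L (p + n - 2)
    refine sub_mem (neg_mem ?_) ?_
    · by_cases hn : n = 0
      · subst hn
        have := DGLie.d_mem _ _ hx'
        rw [sub_sub] at this
        simpa using Submodule.smul_mem _ a this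
      · have : a = 0 := by simpa [deg, GradedSpace.deg, hn] using ha
        simp [this]
    · have := DGLie.br_mem _ _ _ _ (sgn_mem hx') hy
      convert this using 2
      ring

theorem chainCounit_mem : chainCounit L ∈ homDeg (Chains L) ℚ 0 := by
  intro n w hw; rw [add_zero]; exact (chainData_mem L n w hw).1

theorem chainTau_mem : chainTau L ∈ homDeg (Chains L) L (-1) :=
  fun n w hw => (chainData_mem L n w hw).2.1

theorem chainQ_mem : chainQ L ∈ homDeg (Chains L) L (-2) :=
  fun n w hw => (chainData_mem L n w hw).2.2

/-- The map `L → C_*(L)`, `x ↦ sx`. -/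
def chainS : L →ₗ[ℚ] Chains L := GSym.ι (Susp L) ∘ₗ (susp L).toLinearMap

theorem chainS_mem : chainS L ∈ homDeg L (Chains L) 1 :=
  fun _ _ hx => by have h := GSym.ι_mem (susp_mem hx); exact h

/-- The differential `d₀ + d₁` of `C_*(L)`: the coderivation with corestriction `q`, that is
`d(sx_1 ∧ ⋯ ∧ sx_k) = -∑ ± sx_1 ∧ ⋯ ∧ s(dx_i) ∧ ⋯ ∧ sx_k + ∑_{i<j} ± s[x_i, x_j] ∧ sx_1 ∧ ⋯`. -/
def chainD : Chains L →ₗ[ℚ] Chains L :=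
  LinearMap.mul' ℚ (Chains L) ∘ₗ
    TensorProduct.map (chainS L ∘ₗ chainQ L) LinearMap.id ∘ₗ
    GSym.comul (Susp L)

theorem chainD_mem : chainD L ∈ homDeg (Chains L) (Chains L) (-1) :=
  comp_mem GSym.mul_mem (comp_mem (map_mem (comp_mem (chainS_mem L) (chainQ_mem L) rfl) id_mem rfl)
    GSym.comul_mem rfl) rfl

/-! ### The enveloping algebra -/

/-- The relations `xy - (-1)^{|x||y|} yx = [x, y]`. -/
inductive UEnv.Rel : TensorAlgebra ℚ L → TensorAlgebra ℚ L → Prop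
  | comm {p q : ℤ} {x y : L} : x ∈ deg L p → y ∈ deg L q →
      UEnv.Rel (TensorAlgebra.ι ℚ x * TensorAlgebra.ι ℚ y)
        ((-1 : ℚ) ^ (p * q) • (TensorAlgebra.ι ℚ y * TensorAlgebra.ι ℚ x)
          + TensorAlgebra.ι ℚ (DGLie.br x y))

/-- The enveloping algebra `UL`. -/
def UEnv : Type _ := RingQuot (UEnv.Rel L)

instance : Ring (UEnv L) := inferInstanceAs (Ring (RingQuot (UEnv.Rel L)))
instance : Algebra ℚ (UEnv L) := inferInstanceAs (Algebra ℚ (RingQuot (UEnv.Rel L)))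

/-- The canonical map `L → UL`. -/
def UEnv.ι : L →ₗ[ℚ] UEnv L :=
  (RingQuot.mkAlgHom ℚ (UEnv.Rel L)).toLinearMap ∘ₗ TensorAlgebra.ι ℚ

variable {L}

theorem UEnv.ι_comm {p q : ℤ} {x y : L} (hx : x ∈ deg L p) (hy : y ∈ deg L q) :
    UEnv.ι L x * UEnv.ι L y =
      (-1 : ℚ) ^ (p * q) • (UEnv.ι L y * UEnv.ι L x) + UEnv.ι L (DGLie.br x y) := by
  have := RingQuot.mkAlgHom_rel ℚ (UEnv.Rel.comm hx hy)
  rw [map_mul, map_add, map_smul, map_mul] at this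
  exact this

/-- The universal property of `UL`. -/
def UEnv.lift {A : Type*} [Ring A] [Algebra ℚ A] (f : L →ₗ[ℚ] A)
    (hf : ∀ p q, ∀ x ∈ deg L p, ∀ y ∈ deg L q,
      f x * f y = (-1 : ℚ) ^ (p * q) • (f y * f x) + f (DGLie.br x y)) :
    UEnv L →ₐ[ℚ] A :=
  RingQuot.liftAlgHom ℚ ⟨TensorAlgebra.lift ℚ f, fun _ _ h => by
    cases h with
    | comm hx hy => simpa using hf _ _ _ hx _ hy⟩

@[simp] theorem UEnv.lift_ι {A : Type*} [Ring A] [Algebra ℚ A] (f : L →ₗ[ℚ] A) (hf) (x : L) :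
    UEnv.lift f hf (UEnv.ι L x) = f x := by
  have := RingQuot.liftAlgHom_mkAlgHom_apply ℚ (TensorAlgebra.lift ℚ f) (s := UEnv.Rel L)
    (fun _ _ h => by
      cases h with
      | comm hx hy => simpa using hf _ _ _ hx _ hy) (TensorAlgebra.ι ℚ x)
  rw [TensorAlgebra.lift_ι_apply] at this
  exact this

theorem UEnv.adjoin_ι : Algebra.adjoin ℚ (Set.range (UEnv.ι L)) = ⊤ := by
  have h : Set.range (UEnv.ι L) = (RingQuot.mkAlgHom ℚ (UEnv.Rel L)) ''
      Set.range (TensorAlgebra.ι ℚ (M := L)) := by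
    rw [← Set.range_comp]; rfl
  rw [h]
  refine (AlgHom.map_adjoin (RingQuot.mkAlgHom ℚ (UEnv.Rel L)) _).symm.trans ?_
  rw [TensorAlgebra.adjoin_range_ι, Algebra.map_top]
  exact (AlgHom.range_eq_top _).2 (RingQuot.mkAlgHom_surjective ℚ _)

instance : GradedSpace (UEnv L) :=
  wordGrading (UEnv.ι L)
    (fun t => UEnv.lift (UEnv.ι L ∘ₗ GradedSpace.wt t) (fun p q x hx y hy => by
      simp only [LinearMap.comp_apply, GradedSpace.wt_of_mem t p x hx,
        GradedSpace.wt_of_mem t q y hy, GradedSpace.wt_of_mem t _ _ (DGLie.br_mem p q x y hx hy),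
        map_smul, smul_mul_smul_comm, UEnv.ι_comm hx hy, smul_add, zpow_add₀ t.ne_zero]
      rw [smul_comm, mul_comm ((t : ℚ) ^ p)]))
    (fun t x => by simp) UEnv.adjoin_ι

theorem UEnv.ι_mem {p : ℤ} {x : L} (hx : x ∈ deg L p) : UEnv.ι L x ∈ deg (UEnv L) p := by
  have := IsWord.cons (j := UEnv.ι L) hx .one
  rw [mul_one, add_zero] at this
  exact Submodule.subset_span this

theorem UEnv.one_mem : (1 : UEnv L) ∈ deg (UEnv L) 0 := Submodule.subset_span .one

theorem UEnv.mul_mem : LinearMap.mul' ℚ (UEnv L) ∈ homDeg (UEnv L ⊗[ℚ] UEnv L) (UEnv L) 0 := by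
  refine tensor_homDeg fun p q x hx y hy => ?_
  rw [add_zero, LinearMap.mul'_apply]
  induction hx using Submodule.span_induction with
  | zero => simp
  | add a b _ _ ha hb => rw [add_mul]; exact add_mem ha hb
  | smul a b _ hb => rw [smul_mul_assoc]; exact Submodule.smul_mem _ _ hb
  | mem x hx =>
    induction hy using Submodule.span_induction with
    | zero => simp
    | add a b _ _ ha hb => rw [mul_add]; exact add_mem ha hb
    | smul a b _ hb => rw [mul_smul_comm]; exact Submodule.smul_mem _ _ hb
    | mem y hy => exact Submodule.subset_span (hx.mul hy)

theorem UEnv.mul_mem' {p q : ℤ} {a b : UEnv L} (ha : a ∈ deg (UEnv L) p) (hb : b ∈ deg (UEnv L) q) :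
    a * b ∈ deg (UEnv L) (p + q) := by
  simpa using UEnv.mul_mem _ _ (tmul_mem rfl ha hb)

variable (L)

/-- The step `(w, v) ↦ (x w, (dx) w + (-1)^{|x|} x v)`. -/
def UEnv.dStep : L →ₗ[ℚ] Module.End ℚ (UEnv L × UEnv L) :=
  LinearMap.mk₂ ℚ
    (fun x v => (UEnv.ι L x * v.1, UEnv.ι L (DGLie.d x) * v.1 + UEnv.ι L (sgn L x) * v.2))
    (fun x x' v => by ext <;> simp [add_mul] <;> abel)
    (fun a x v => by ext <;> simp)
    (fun x v v' => by ext <;> simp [mul_add] <;> abel)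
    (fun a x v => by ext <;> simp)

variable {L} in
theorem UEnv.dStep_apply (x : L) (v : UEnv L × UEnv L) : UEnv.dStep L x v =
    (UEnv.ι L x * v.1, UEnv.ι L (DGLie.d x) * v.1 + UEnv.ι L (sgn L x) * v.2) := rfl

theorem UEnv.dStep_comm (p q : ℤ) (x : L) (hx : x ∈ deg L p) (y : L) (hy : y ∈ deg L q) :
    UEnv.dStep L x * UEnv.dStep L y =
      (-1 : ℚ) ^ (p * q) • (UEnv.dStep L y * UEnv.dStep L x) + UEnv.dStep L (DGLie.br x y) := by
  have hne : (-1 : ℚ) ≠ 0 := by norm_num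
  have h1 := UEnv.ι_comm hx hy
  have h2 := UEnv.ι_comm (DGLie.d_mem p x hx) hy
  have h3 := UEnv.ι_comm hx (DGLie.d_mem q y hy)
  have e2 : (-1 : ℚ) ^ ((p - 1) * q) = (-1 : ℚ) ^ (p * q) * (-1) ^ q := by
    rw [sub_mul, one_mul, zpow_sub₀ hne]
    rcases Int.even_or_odd q with hq | hq <;> simp [hq.neg_one_zpow, div_neg]
  have e3 : (-1 : ℚ) ^ (p * (q - 1)) = (-1 : ℚ) ^ (p * q) * (-1) ^ p := by
    rw [mul_sub, mul_one, zpow_sub₀ hne]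
    rcases Int.even_or_odd p with hq | hq <;> simp [hq.neg_one_zpow, div_neg]
  have e4 : ((-1 : ℚ) ^ p) * (-1 : ℚ) ^ p = 1 := by rw [← mul_zpow]; norm_num
  rw [e2] at h2
  rw [e3] at h3
  refine LinearMap.ext fun v => ?_
  ext
  · simp only [UEnv.dStep, Module.End.mul_apply, LinearMap.smul_apply, LinearMap.mk₂_apply,
      LinearMap.add_apply, Prod.smul_fst, Prod.fst_add, ← mul_assoc, h1, add_mul, smul_mul_assoc]
  · simp only [UEnv.dStep, Module.End.mul_apply, LinearMap.smul_apply, LinearMap.mk₂_apply,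
      LinearMap.add_apply, Prod.smul_snd, Prod.snd_add, mul_add, ← mul_assoc, sgn_of_mem hx,
      sgn_of_mem hy, sgn_of_mem (DGLie.br_mem p q x y hx hy), map_smul, smul_mul_assoc,
      mul_smul_comm, h1, h2, h3, add_mul, smul_add, smul_smul, zpow_add₀ hne, map_add,
      DGLie.leibniz p x y hx]
    match_scalars <;> first | ring1 | linear_combination ((-1 : ℚ) ^ (p * q)) * e4

/-- The differential of `UL`: the derivation that extends the differential of `L`. -/
def UEnv.d : UEnv L →ₗ[ℚ] UEnv L :=
  LinearMap.snd ℚ (UEnv L) (UEnv L) ∘ₗ (LinearMap.applyₗ (1, 0)) ∘ₗ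
    (UEnv.lift (UEnv.dStep L) (UEnv.dStep_comm L)).toLinearMap

theorem UEnv.lift_dStep_fst (w : UEnv L) (v : UEnv L × UEnv L) :
    (UEnv.lift (UEnv.dStep L) (UEnv.dStep_comm L) w v).1 = w * v.1 := by
  have hw : w ∈ Algebra.adjoin ℚ (Set.range (UEnv.ι L)) := by rw [UEnv.adjoin_ι]; trivial
  induction hw using Algebra.adjoin_induction generalizing v with
  | mem x hx =>
    obtain ⟨x, rfl⟩ := hx
    simp [UEnv.dStep]
  | algebraMap r => simp [Algebra.algebraMap_eq_smul_one]
  | add a b _ _ ha hb => simp [ha, hb, add_mul]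
  | mul a b _ _ ha hb => simp [ha, hb, mul_assoc]

theorem UEnv.d_ι_mul (x : L) (w : UEnv L) :
    UEnv.d L (UEnv.ι L x * w) =
      UEnv.ι L (DGLie.d x) * w + UEnv.ι L (sgn L x) * UEnv.d L w := by
  have := UEnv.lift_dStep_fst L w (1, 0)
  rw [mul_one] at this
  simp only [UEnv.d, LinearMap.comp_apply, AlgHom.toLinearMap_apply, map_mul, UEnv.lift_ι,
    LinearMap.applyₗ_apply_apply, Module.End.mul_apply, LinearMap.snd_apply, UEnv.dStep_apply,
    this]

@[simp] theorem UEnv.d_one : UEnv.d L 1 = 0 := by simp [UEnv.d]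

theorem UEnv.d_mem : UEnv.d L ∈ homDeg (UEnv L) (UEnv L) (-1) := by
  intro n w hw
  induction hw using Submodule.span_induction with
  | zero => simp
  | add a b _ _ ha hb => rw [map_add]; exact add_mem ha hb
  | smul a b _ hb => rw [map_smul]; exact Submodule.smul_mem _ _ hb
  | mem w hw =>
    induction hw with
    | one => simp
    | @cons p n x w hx hw ih =>
      rw [UEnv.d_ι_mul]
      refine add_mem ?_ ?_
      · have := UEnv.mul_mem' (UEnv.ι_mem (DGLie.d_mem _ _ hx)) (Submodule.subset_span hw)
        convert this using 2; ring
      · have := UEnv.mul_mem' (UEnv.ι_mem (sgn_mem hx)) ih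
        convert this using 2; ring

/-- The adjoint action `x ⊗ w ↦ [x, w] = xw - (-1)^{|x||w|} wx` of `L` on `UL`. -/
def UEnv.ad : L ⊗[ℚ] UEnv L →ₗ[ℚ] UEnv L :=
  LinearMap.mul' ℚ (UEnv L) ∘ₗ TensorProduct.map (UEnv.ι L) LinearMap.id -
    LinearMap.mul' ℚ (UEnv L) ∘ₗ TensorProduct.map LinearMap.id (UEnv.ι L) ∘ₗ braid L (UEnv L)

theorem UEnv.ad_mem : UEnv.ad L ∈ homDeg (L ⊗[ℚ] UEnv L) (UEnv L) 0 := by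
  have hι : UEnv.ι L ∈ homDeg L (UEnv L) 0 := by
    intro n x hx; rw [add_zero]; exact UEnv.ι_mem hx
  exact Submodule.sub_mem _ (comp_mem UEnv.mul_mem (map_mem hι id_mem rfl) rfl)
    (comp_mem UEnv.mul_mem (comp_mem (map_mem id_mem hι rfl) braid_mem rfl) rfl)

end Lie


/-! ### Modules over a differential graded Lie algebra -/

section Rep

theorem braid_tmul {X Y : Type*} [AddCommGroup X] [Module ℚ X] [AddCommGroup Y] [Module ℚ Y]
    [GradedSpace X] [GradedSpace Y] {p q : ℤ} {x : X} {y : Y} (hx : x ∈ deg X p)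
    (hy : y ∈ deg Y q) : braid X Y (x ⊗ₜ y) = (-1 : ℚ) ^ (p * q) • (y ⊗ₜ[ℚ] x) := by
  have := koszul_apply (s := TensorProduct.map (sgn X) (LinearMap.id (M := Y)))
    (t := TensorProduct.map (LinearMap.id (M := X)) (sgn Y)) (p := p) (q := q) (x := x ⊗ₜ y)
    (by simp only [TensorProduct.map_tmul, LinearMap.id_apply, sgn_of_mem hx,
      ← TensorProduct.smul_tmul'])
    (by simp only [TensorProduct.map_tmul, LinearMap.id_apply, sgn_of_mem hy,
      TensorProduct.tmul_smul])
  simp [braid, this]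

theorem neg_one_zpow_mul_self (n : ℤ) : (-1 : ℚ) ^ n * (-1 : ℚ) ^ n = 1 := by
  rw [← mul_zpow]; norm_num

theorem neg_one_zpow_sub_one (n : ℤ) : (-1 : ℚ) ^ (n - 1) = -(-1 : ℚ) ^ n := by
  rw [zpow_sub₀ (by norm_num)]; simp [div_neg]

/-- A differential graded left module over the differential graded Lie algebra `L`. -/
class DGRep (L N : Type*) [AddCommGroup L] [Module ℚ L] [DGLie L] [AddCommGroup N] [Module ℚ N]
    [GradedSpace N] where
  d : N →ₗ[ℚ] N
  act : L ⊗[ℚ] N →ₗ[ℚ] N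
  d_mem : d ∈ homDeg N N (-1)
  act_mem : act ∈ homDeg (L ⊗[ℚ] N) N 0
  d_d : ∀ n, d (d n) = 0
  d_act : ∀ (p : ℤ) (x : L) (n : N), x ∈ deg L p →
    d (act (x ⊗ₜ n)) = act (DGLie.d x ⊗ₜ n) + (-1 : ℚ) ^ p • act (x ⊗ₜ d n)
  br_act : ∀ (p q : ℤ) (x y : L) (n : N), x ∈ deg L p → y ∈ deg L q →
    act (DGLie.br x y ⊗ₜ n) =
      act (x ⊗ₜ act (y ⊗ₜ n)) - (-1 : ℚ) ^ (p * q) • act (y ⊗ₜ act (x ⊗ₜ n))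

variable (L : Type*) [AddCommGroup L] [Module ℚ L] [DGLie L]

/-- The trivial module `ℚ`. -/
instance : DGRep L ℚ where
  d := 0
  act := 0
  d_mem := Submodule.zero_mem _
  act_mem := Submodule.zero_mem _
  d_d := by simp
  d_act := by simp
  br_act := by simp

variable {L}

theorem UEnv.sgn_mul (a b : UEnv L) : sgn (UEnv L) (a * b) = sgn (UEnv L) a * sgn (UEnv L) b :=
  map_mul (UEnv.lift _ _) a b

theorem UEnv.sgn_ι (x : L) : sgn (UEnv L) (UEnv.ι L x) = UEnv.ι L (sgn L x) :=
  UEnv.lift_ι _ _ x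

theorem UEnv.d_mul (a b : UEnv L) :
    UEnv.d L (a * b) = UEnv.d L a * b + sgn (UEnv L) a * UEnv.d L b := by
  have hw : a ∈ Algebra.adjoin ℚ (Set.range (UEnv.ι L)) := by rw [UEnv.adjoin_ι]; trivial
  have h1 : sgn (UEnv L) 1 = 1 := map_one (UEnv.lift _ _)
  induction hw using Algebra.adjoin_induction generalizing b with
  | mem x hx =>
    obtain ⟨x, rfl⟩ := hx
    have := UEnv.d_ι_mul L x 1
    rw [mul_one, mul_one, UEnv.d_one, mul_zero, add_zero] at this
    rw [UEnv.d_ι_mul, this, UEnv.sgn_ι]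
  | algebraMap r => simp [Algebra.algebraMap_eq_smul_one, h1]
  | add a b _ _ ha hb => simp only [add_mul, map_add, ha, hb]; abel
  | mul a b _ _ ha hb => simp only [mul_assoc, ha, hb, UEnv.sgn_mul, mul_add]; rw [add_mul, add_assoc, mul_assoc, mul_assoc]

theorem UEnv.d_ι (x : L) : UEnv.d L (UEnv.ι L x) = UEnv.ι L (DGLie.d x) := by
  have := UEnv.d_ι_mul L x 1
  rwa [mul_one, mul_one, UEnv.d_one, mul_zero, add_zero] at this

theorem UEnv.d_sgn (a : UEnv L) : UEnv.d L (sgn (UEnv L) a) = -sgn (UEnv L) (UEnv.d L a) := by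
  induction a using deg_induction with
  | h0 => simp
  | hadd a b ha hb => simp only [map_add, ha, hb]; abel
  | h p a ha =>
    have h := UEnv.d_mem L p a ha
    rw [← sub_eq_add_neg] at h
    rw [sgn_of_mem ha, sgn_of_mem h, map_smul, neg_one_zpow_sub_one]
    module

theorem UEnv.d_d (a : UEnv L) : UEnv.d L (UEnv.d L a) = 0 := by
  have hw : a ∈ Algebra.adjoin ℚ (Set.range (UEnv.ι L)) := by rw [UEnv.adjoin_ι]; trivial
  induction hw using Algebra.adjoin_induction with
  | mem x hx =>
    obtain ⟨x, rfl⟩ := hx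
    rw [UEnv.d_ι, UEnv.d_ι, DGLie.d_d, map_zero]
  | algebraMap r => simp [Algebra.algebraMap_eq_smul_one]
  | add a b _ _ ha hb => simp only [map_add, ha, hb, add_zero]
  | mul a b _ _ ha hb =>
    simp only [UEnv.d_mul, map_add, ha, hb, UEnv.d_sgn, mul_zero, zero_mul]
    simp

theorem UEnv.ad_apply {p r : ℤ} {x : L} {w : UEnv L} (hx : x ∈ deg L p) (hw : w ∈ deg (UEnv L) r) :
    UEnv.ad L (x ⊗ₜ w) = UEnv.ι L x * w - (-1 : ℚ) ^ (p * r) • (w * UEnv.ι L x) := by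
  simp [UEnv.ad, braid_tmul hx hw]

/-- The module `(UL)_a`: the enveloping algebra with the adjoint representation. -/
instance : DGRep L (UEnv L) where
  d := UEnv.d L
  act := UEnv.ad L
  d_mem := UEnv.d_mem L
  act_mem := UEnv.ad_mem L
  d_d := UEnv.d_d
  d_act p x n hx := by
    have hne : (-1 : ℚ) ≠ 0 := by norm_num
    induction n using deg_induction with
    | h0 => simp
    | hadd a b ha hb => simp only [TensorProduct.tmul_add, map_add, ha, hb]; module
    | h r w hw =>
      have hdx := DGLie.d_mem p x hx
      have hdw := UEnv.d_mem L r w hw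
      rw [UEnv.ad_apply hx hw, UEnv.ad_apply hdx hw, UEnv.ad_apply hx hdw]
      simp only [map_sub, map_smul, UEnv.d_mul, UEnv.d_ι, UEnv.sgn_ι, sgn_of_mem hx, sgn_of_mem hw]
      have e2 : (-1 : ℚ) ^ ((p - 1) * r) = (-1 : ℚ) ^ (p * r) * (-1) ^ r := by
        rw [sub_mul, one_mul, zpow_sub₀ hne]
        rcases Int.even_or_odd r with hq | hq <;> simp [hq.neg_one_zpow, div_neg]
      have e3 : (-1 : ℚ) ^ (p * (r + -1)) = (-1 : ℚ) ^ (p * r) * (-1) ^ p := by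
        rw [← sub_eq_add_neg, mul_sub, mul_one, zpow_sub₀ hne]
        rcases Int.even_or_odd p with hq | hq <;> simp [hq.neg_one_zpow, div_neg]
      have e4 := neg_one_zpow_mul_self p
      rw [e2, e3]
      simp only [smul_mul_assoc, smul_sub, smul_add, smul_smul]
      match_scalars <;> first | ring1 | linear_combination (((-1 : ℚ) ^ (p * r))) * e4
  br_act p q x y n hx hy := by
    have hne : (-1 : ℚ) ≠ 0 := by norm_num
    induction n using deg_induction with
    | h0 => simp
    | hadd a b ha hb => simp only [TensorProduct.tmul_add, map_add, ha, hb]; module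
    | h r w hw =>
      have hyw := UEnv.ad_mem L _ _ (tmul_mem rfl hy hw)
      have hxw := UEnv.ad_mem L _ _ (tmul_mem rfl hx hw)
      rw [UEnv.ad_apply hx hyw, UEnv.ad_apply hy hxw,
        UEnv.ad_apply (DGLie.br_mem p q x y hx hy) hw, UEnv.ad_apply hx hw, UEnv.ad_apply hy hw]
      have h1 : UEnv.ι L (DGLie.br x y) = UEnv.ι L x * UEnv.ι L y -
          (-1 : ℚ) ^ (p * q) • (UEnv.ι L y * UEnv.ι L x) := by
        rw [UEnv.ι_comm hx hy]; abel
      have e4 := neg_one_zpow_mul_self (p * q)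
      simp only [h1, mul_sub, sub_mul, smul_mul_assoc, mul_smul_comm, smul_sub, smul_smul, mul_assoc,
        add_zero, mul_add, add_mul, zpow_add₀ hne, mul_comm q p]
      match_scalars <;> first
        | ring1
        | linear_combination ((-1 : ℚ) ^ (p * r) * (-1 : ℚ) ^ (q * r)) * e4
        | linear_combination (-(-1 : ℚ) ^ (p * r) * (-1 : ℚ) ^ (q * r)) * e4
        | linear_combination (-(-1 : ℚ) ^ (q * r)) * e4

section Dual
variable (L)
variable (N : Type*) [AddCommGroup N] [Module ℚ N] [GradedSpace N] [DGRep L N]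

/-- The action of a fixed element of `L`. -/
def actBy (x : L) : N →ₗ[ℚ] N := TensorProduct.curry (DGRep.act (L := L) (N := N)) x

variable {L} in
theorem actBy_mem {p : ℤ} {x : L} (hx : x ∈ deg L p) : actBy L N x ∈ homDeg N N p := by
  intro k n hn
  have := DGRep.act_mem (L := L) (N := N) _ _ (tmul_mem rfl hx hn)
  rwa [add_zero, add_comm] at this

/-- `(x, f) ↦ f(x · -)`. -/
def coact : L →ₗ[ℚ] GHom N ℚ →ₗ[ℚ] GHom N ℚ :=
  LinearMap.mk₂ ℚ (fun x f => GHom.mk (f.val ∘ₗ actBy L N x) (by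
      induction x using deg_induction with
      | h0 => simp [actBy]
      | hadd a b ha hb =>
        have : f.val ∘ₗ actBy L N (a + b) = f.val ∘ₗ actBy L N a + f.val ∘ₗ actBy L N b := by
          ext; simp [actBy]
        rw [this]; exact add_mem ha hb
      | h p x hx =>
        exact gHom_induction (LinearMap.lcomp ℚ ℚ (actBy L N x)) p
          (fun n f hf => comp_mem hf (actBy_mem N hx) (add_comm p n)) f.val_mem))
    (fun x x' f => by ext; simp [actBy])
    (fun a x f => by ext; simp [actBy])
    (fun x f f' => by ext; simp)
    (fun a x f => by ext; simp)

theorem coact_apply (x : L) (f : GHom N ℚ) (n : N) :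
    (coact L N x f).val n = f.val (DGRep.act (x ⊗ₜ[ℚ] n)) := rfl

variable {L N} in
theorem coact_mem {p q : ℤ} {x : L} {f : GHom N ℚ} (hx : x ∈ deg L p) (hf : f ∈ deg (GHom N ℚ) q) :
    coact L N x f ∈ deg (GHom N ℚ) (p + q) :=
  Submodule.mem_comap.2 (comp_mem (Submodule.mem_comap.1 hf) (actBy_mem N hx) rfl)

/-- The action `(x · f)(n) = -(-1)^{|x||f|} f(x · n)` on the dual. -/
def dualAct : L ⊗[ℚ] GHom N ℚ →ₗ[ℚ] GHom N ℚ :=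
  -(TensorProduct.lift (coact L N) ∘ₗ koszul (TensorProduct.map (sgn L) LinearMap.id)
    (TensorProduct.map LinearMap.id (sgn (GHom N ℚ))))

variable {L N} in
theorem dualAct_apply {p q : ℤ} {x : L} {f : GHom N ℚ} (hx : x ∈ deg L p)
    (hf : f ∈ deg (GHom N ℚ) q) :
    dualAct L N (x ⊗ₜ f) = -((-1 : ℚ) ^ (p * q) • coact L N x f) := by
  have := koszul_apply (s := TensorProduct.map (sgn L) (LinearMap.id (M := GHom N ℚ)))
    (t := TensorProduct.map (LinearMap.id (M := L)) (sgn (GHom N ℚ))) (p := p) (q := q)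
    (x := x ⊗ₜ f)
    (by simp only [TensorProduct.map_tmul, LinearMap.id_apply, sgn_of_mem hx,
      ← TensorProduct.smul_tmul'])
    (by simp only [TensorProduct.map_tmul, LinearMap.id_apply, sgn_of_mem hf,
      TensorProduct.tmul_smul])
  simp only [dualAct, LinearMap.neg_apply, LinearMap.comp_apply, this, map_smul,
    TensorProduct.lift.tmul]

/-- The differential `f ↦ -(-1)^{|f|} f ∘ d` of the dual. -/
def dualD : GHom N ℚ →ₗ[ℚ] GHom N ℚ :=
  GHom.map (-(LinearMap.lcomp ℚ ℚ (DGRep.d L (N := N)) ∘ₗ sgnHom N ℚ)) fun _ hf =>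
    gHom_induction (-(LinearMap.lcomp ℚ ℚ (DGRep.d L (N := N)) ∘ₗ sgnHom N ℚ)) (-1)
      (fun _ _ hf => Submodule.neg_mem _
        (comp_mem (wtHom_mem_homDeg _ hf) (DGRep.d_mem (L := L)) (add_comm _ _))) hf

variable {N} in
theorem dualD_apply {q : ℤ} {f : GHom N ℚ} (hf : f ∈ deg (GHom N ℚ) q) (n : N) :
    (dualD L N f).val n = -((-1 : ℚ) ^ q * f.val (DGRep.d L n)) := by
  have := wtHom_of_mem (-1) (Submodule.mem_comap.1 hf)
  show -(sgnHom N ℚ f.val (DGRep.d L n)) = _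
  rw [this]; simp

theorem dualD_mem : dualD L N ∈ homDeg (GHom N ℚ) (GHom N ℚ) (-1) := by
  intro q f hf
  exact Submodule.mem_comap.2 (Submodule.neg_mem _
    (comp_mem (wtHom_mem_homDeg _ (Submodule.mem_comap.1 hf)) (DGRep.d_mem (L := L))
      (add_comm _ _)))

theorem dualAct_mem : dualAct L N ∈ homDeg (L ⊗[ℚ] GHom N ℚ) (GHom N ℚ) 0 := by
  refine tensor_homDeg fun p q x hx f hf => ?_
  rw [dualAct_apply hx hf, add_zero]
  exact neg_mem (Submodule.smul_mem _ _ (coact_mem hx hf))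

/-- The dual of a module. -/
instance : DGRep L (GHom N ℚ) where
  d := dualD L N
  act := dualAct L N
  d_mem := dualD_mem L N
  act_mem := dualAct_mem L N
  d_d f := by
    induction f using deg_induction with
    | h0 => simp
    | hadd a b ha hb => simp only [map_add, ha, hb, add_zero]
    | h q f hf =>
      ext n
      rw [dualD_apply L (dualD_mem L N q f hf), dualD_apply L hf, DGRep.d_d]
      simp
  d_act p x f hx := by
    have hne : (-1 : ℚ) ≠ 0 := by norm_num
    induction f using deg_induction with
    | h0 => simp
    | hadd a b ha hb => simp only [TensorProduct.tmul_add, map_add, ha, hb]; module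
    | h q f hf =>
      have hdx := DGLie.d_mem p x hx
      have hdf := dualD_mem L N q f hf
      rw [dualAct_apply hx hf, dualAct_apply hdx hf, dualAct_apply hx hdf]
      ext n
      simp only [map_neg, map_smul, map_add,
        LinearMap.neg_apply, LinearMap.smul_apply, LinearMap.add_apply, coact_apply,
        dualD_apply L (coact_mem hx hf), dualD_apply L hf, DGRep.d_act p x n hx, map_add, map_smul,
        smul_eq_mul]
      have e2 : (-1 : ℚ) ^ ((p - 1) * q) = (-1 : ℚ) ^ (p * q) * (-1) ^ q := by
        rw [sub_mul, one_mul, zpow_sub₀ hne]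
        rcases Int.even_or_odd q with hq | hq <;> simp [hq.neg_one_zpow, div_neg]
      have e3 : (-1 : ℚ) ^ (p * (q + -1)) = (-1 : ℚ) ^ (p * q) * (-1) ^ p := by
        rw [← sub_eq_add_neg, mul_sub, mul_one, zpow_sub₀ hne]
        rcases Int.even_or_odd p with hq | hq <;> simp [hq.neg_one_zpow, div_neg]
      rw [e2, e3, zpow_add₀ hne]
      have e4 := neg_one_zpow_mul_self p
      linear_combination (-(-1 : ℚ) ^ (p * q) * (-1 : ℚ) ^ q * (f.val (DGRep.act (DGLie.d x ⊗ₜ[ℚ] n))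
        + (-1) ^ p * f.val (DGRep.act (x ⊗ₜ[ℚ] DGRep.d L n)))) * e4
  br_act p q x y f hx hy := by
    have hne : (-1 : ℚ) ≠ 0 := by norm_num
    induction f using deg_induction with
    | h0 => simp
    | hadd a b ha hb => simp only [TensorProduct.tmul_add, map_add, ha, hb]; module
    | h r f hf =>
      have hyf := dualAct_mem L N _ _ (tmul_mem rfl hy hf)
      have hxf := dualAct_mem L N _ _ (tmul_mem rfl hx hf)
      rw [dualAct_apply hx hyf, dualAct_apply hy hxf,
        dualAct_apply (DGLie.br_mem p q x y hx hy) hf, dualAct_apply hx hf, dualAct_apply hy hf]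
      ext n
      simp only [map_neg, map_smul, map_sub,
        LinearMap.neg_apply, LinearMap.smul_apply, LinearMap.sub_apply, coact_apply,
        DGRep.br_act p q x y n hx hy, map_sub, map_smul, smul_eq_mul, add_zero]
      have e4 := neg_one_zpow_mul_self (p * q)
      simp only [mul_add, add_mul, zpow_add₀ hne, mul_comm q p]
      linear_combination ((-1 : ℚ) ^ (p * r) * (-1 : ℚ) ^ (q * r) *
        f.val (DGRep.act (x ⊗ₜ[ℚ] DGRep.act (y ⊗ₜ[ℚ] n)))) * e4

end Dual

section Tensor
variable (L)
variable (M N : Type*) [AddCommGroup M] [Module ℚ M] [GradedSpace M] [DGRep L M]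
  [AddCommGroup N] [Module ℚ N] [GradedSpace N] [DGRep L N]

/-- The diagonal action `x · (m ⊗ n) = (x · m) ⊗ n + (-1)^{|x||m|} m ⊗ (x · n)`. -/
def tensorAct : L ⊗[ℚ] (M ⊗[ℚ] N) →ₗ[ℚ] M ⊗[ℚ] N :=
  (TensorProduct.map DGRep.act LinearMap.id +
    TensorProduct.map LinearMap.id DGRep.act ∘ₗ (TensorProduct.assoc ℚ M L N).toLinearMap ∘ₗ
      TensorProduct.map (braid L M) LinearMap.id) ∘ₗ
    (TensorProduct.assoc ℚ L M N).symm.toLinearMap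

variable {L M N} in
theorem tensorAct_apply {p q : ℤ} {x : L} {m : M} (n : N) (hx : x ∈ deg L p) (hm : m ∈ deg M q) :
    tensorAct L M N (x ⊗ₜ (m ⊗ₜ n)) = DGRep.act (x ⊗ₜ[ℚ] m) ⊗ₜ n +
      (-1 : ℚ) ^ (p * q) • (m ⊗ₜ[ℚ] DGRep.act (x ⊗ₜ[ℚ] n)) := by
  simp only [tensorAct, LinearMap.comp_apply, LinearEquiv.coe_coe, TensorProduct.assoc_symm_tmul,
    LinearMap.add_apply, TensorProduct.map_tmul, LinearMap.id_apply, braid_tmul hx hm,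
    ← TensorProduct.smul_tmul', map_smul, TensorProduct.assoc_tmul]

theorem tensorD_mem {X Y : Type*} [AddCommGroup X] [Module ℚ X] [AddCommGroup Y] [Module ℚ Y]
    [GradedSpace X] [GradedSpace Y] {dX : X →ₗ[ℚ] X} {dY : Y →ₗ[ℚ] Y}
    (hX : dX ∈ homDeg X X (-1)) (hY : dY ∈ homDeg Y Y (-1)) :
    tensorD dX dY ∈ homDeg (X ⊗[ℚ] Y) (X ⊗[ℚ] Y) (-1) :=
  add_mem (map_mem hX id_mem rfl) (map_mem sgn_mem_homDeg hY rfl)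

theorem tensorAct_mem : tensorAct L M N ∈ homDeg (L ⊗[ℚ] (M ⊗[ℚ] N)) (M ⊗[ℚ] N) 0 := by
  intro k v hv
  induction hv using Submodule.span_induction with
  | zero => simp
  | add x y _ _ hx hy => rw [map_add]; exact add_mem hx hy
  | smul a x _ hx => rw [map_smul]; exact Submodule.smul_mem _ _ hx
  | mem v hv =>
    obtain ⟨p, b, rfl, x, hx, w, hw, rfl⟩ := hv
    induction hw using Submodule.span_induction with
    | zero => simp
    | add x y _ _ hx hy => rw [TensorProduct.tmul_add, map_add]; exact add_mem hx hy
    | smul a x _ hx => rw [TensorProduct.tmul_smul, map_smul]; exact Submodule.smul_mem _ _ hx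
    | mem w hw =>
      obtain ⟨q, r, rfl, m, hm, n, hn, rfl⟩ := hw
      rw [tensorAct_apply n hx hm]
      exact add_mem (tmul_mem (by ring) (DGRep.act_mem _ _ (tmul_mem rfl hx hm)) hn)
        (Submodule.smul_mem _ _ (tmul_mem (by ring) hm (DGRep.act_mem _ _ (tmul_mem rfl hx hn))))

theorem tensorD_apply {X Y : Type*} [AddCommGroup X] [Module ℚ X] [AddCommGroup Y] [Module ℚ Y]
    [GradedSpace X] {dX : X →ₗ[ℚ] X} {dY : Y →ₗ[ℚ] Y} {p : ℤ} {x : X} (hx : x ∈ deg X p) (y : Y) :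
    tensorD dX dY (x ⊗ₜ y) = dX x ⊗ₜ y + (-1 : ℚ) ^ p • (x ⊗ₜ[ℚ] dY y) := by
  simp only [tensorD, LinearMap.add_apply, TensorProduct.map_tmul, LinearMap.id_apply,
    sgn_of_mem hx, ← TensorProduct.smul_tmul']

/-- The tensor product of two modules. -/
instance : DGRep L (M ⊗[ℚ] N) where
  d := tensorD (DGRep.d L) (DGRep.d L)
  act := tensorAct L M N
  d_mem := tensorD_mem DGRep.d_mem DGRep.d_mem
  act_mem := tensorAct_mem L M N
  d_d v := by
    induction v using TensorProduct.induction_on with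
    | zero => simp
    | add a b ha hb => simp only [map_add, ha, hb, add_zero]
    | tmul m n =>
      induction m using deg_induction with
      | h0 => simp
      | hadd a b ha hb => simp only [TensorProduct.add_tmul, map_add, ha, hb, add_zero]
      | h p m hm =>
        have hdm := DGRep.d_mem (L := L) p m hm
        rw [← sub_eq_add_neg] at hdm
        simp only [tensorD_apply hm, tensorD_apply hdm, map_add, map_smul, DGRep.d_d,
          neg_one_zpow_sub_one, TensorProduct.zero_tmul, TensorProduct.tmul_zero]
        module
  d_act p x v hx := by
    have hne : (-1 : ℚ) ≠ 0 := by norm_num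
    induction v using TensorProduct.induction_on with
    | zero => simp
    | add a b ha hb => simp only [TensorProduct.tmul_add, map_add, ha, hb]; module
    | tmul m n =>
      induction m using deg_induction with
      | h0 => simp
      | hadd a b ha hb =>
        simp only [TensorProduct.add_tmul, TensorProduct.tmul_add, map_add, ha, hb]; module
      | h q m hm =>
        have hdx := DGLie.d_mem p x hx
        have hdm := DGRep.d_mem (L := L) q m hm
        have hxm := DGRep.act_mem (L := L) (N := M) _ _ (tmul_mem rfl hx hm)
        simp only [tensorAct_apply n hx hm, tensorAct_apply n hdx hm, tensorD_apply hm, map_add,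
          map_smul, tensorD_apply hxm, TensorProduct.tmul_add, TensorProduct.tmul_smul,
          tensorAct_apply n hx hdm, tensorAct_apply _ hx hm, DGRep.d_act p x _ hx,
          TensorProduct.add_tmul, ← TensorProduct.smul_tmul', add_zero]
        have e2 : (-1 : ℚ) ^ ((p - 1) * q) = (-1 : ℚ) ^ (p * q) * (-1) ^ q := by
          rw [sub_mul, one_mul, zpow_sub₀ hne]
          rcases Int.even_or_odd q with hq | hq <;> simp [hq.neg_one_zpow, div_neg]
        have e3 : (-1 : ℚ) ^ (p * (q + -1)) = (-1 : ℚ) ^ (p * q) * (-1) ^ p := by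
          rw [← sub_eq_add_neg, mul_sub, mul_one, zpow_sub₀ hne]
          rcases Int.even_or_odd p with hq | hq <;> simp [hq.neg_one_zpow, div_neg]
        have e4 := neg_one_zpow_mul_self p
        rw [e2, e3, zpow_add₀ hne]
        match_scalars <;> first | ring1 | linear_combination (-(-1 : ℚ) ^ (p * q)) * e4
  br_act p q x y v hx hy := by
    have hne : (-1 : ℚ) ≠ 0 := by norm_num
    induction v using TensorProduct.induction_on with
    | zero => simp
    | add a b ha hb => simp only [TensorProduct.tmul_add, map_add, ha, hb]; module
    | tmul m n =>
      induction m using deg_induction with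
      | h0 => simp
      | hadd a b ha hb =>
        simp only [TensorProduct.add_tmul, TensorProduct.tmul_add, map_add, ha, hb]; module
      | h r m hm =>
        have hbr := DGLie.br_mem p q x y hx hy
        have hxm := DGRep.act_mem (L := L) (N := M) _ _ (tmul_mem rfl hx hm)
        have hym := DGRep.act_mem (L := L) (N := M) _ _ (tmul_mem rfl hy hm)
        have e4 := neg_one_zpow_mul_self (p * q)
        simp only [tensorAct_apply n hx hm, tensorAct_apply n hy hm, tensorAct_apply n hbr hm,
          TensorProduct.tmul_add, TensorProduct.tmul_smul, map_add, map_smul,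
          tensorAct_apply _ hx hym, tensorAct_apply _ hy hxm, tensorAct_apply _ hx hm,
          tensorAct_apply _ hy hm, DGRep.br_act p q x y _ hx hy, TensorProduct.sub_tmul,
          TensorProduct.tmul_sub, ← TensorProduct.smul_tmul', add_zero, mul_add, add_mul,
          zpow_add₀ hne, mul_comm q p]
        match_scalars <;> first
          | ring1
          | linear_combination ((-1 : ℚ) ^ (p * r)) * e4
          | linear_combination (-(-1 : ℚ) ^ (p * r)) * e4
          | linear_combination ((-1 : ℚ) ^ (q * r)) * e4

end Tensor

end Rep


/-! ### Homology -/

section Homology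
variable {X Y : Type*} [AddCommGroup X] [Module ℚ X] [AddCommGroup Y] [Module ℚ Y]

/-- The homology `ker d / im d` of a differential (total, over all degrees). -/
abbrev Homology (d : X →ₗ[ℚ] X) : Type _ :=
  LinearMap.ker d ⧸ (LinearMap.range d).submoduleOf (LinearMap.ker d)

/-- Commutation with the differentials. -/
def IsChainMap (dX : X →ₗ[ℚ] X) (dY : Y →ₗ[ℚ] Y) (f : X →ₗ[ℚ] Y) : Prop := f ∘ₗ dX = dY ∘ₗ f

theorem IsChainMap.apply {dX : X →ₗ[ℚ] X} {dY : Y →ₗ[ℚ] Y} {f : X →ₗ[ℚ] Y}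
    (hf : IsChainMap dX dY f) (x : X) : f (dX x) = dY (f x) := LinearMap.congr_fun hf x

/-- The map induced in homology. -/
def homologyMap {dX : X →ₗ[ℚ] X} {dY : Y →ₗ[ℚ] Y} {f : X →ₗ[ℚ] Y} (hf : IsChainMap dX dY f) :
    Homology dX →ₗ[ℚ] Homology dY :=
  Submodule.mapQ _ _
    (f.restrict (p := LinearMap.ker dX) (q := LinearMap.ker dY) fun x hx => by
      rw [LinearMap.mem_ker] at hx ⊢
      rw [← hf.apply, hx, map_zero])
    (by
      rintro ⟨x, hx⟩ ⟨y, hy⟩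
      exact ⟨f y, by rw [← hf.apply, hy]; rfl⟩)

end Homology

/-! ### Chains and cochains with coefficients -/

section Complexes
variable (L : Type*) [AddCommGroup L] [Module ℚ L] [DGLie L]
variable (N : Type*) [AddCommGroup N] [Module ℚ N] [GradedSpace N] [DGRep L N]
variable (M : Type*) [AddCommGroup M] [Module ℚ M] [GradedSpace M] [DGRep L M]

/-- `c ↦ ∑ (-1)^{|c'|} c' ⊗ τ(c'')`, where `Δ c = ∑ c' ⊗ c''`; on `sx_1 ∧ ⋯ ∧ sx_k` this is
`∑ ± (sx_1 ∧ ⋯ (without sx_i) ⋯ ∧ sx_k) ⊗ x_i`. -/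
def chainSplit : Chains L →ₗ[ℚ] Chains L ⊗[ℚ] L :=
  TensorProduct.map (sgn (Chains L)) (chainTau L) ∘ₗ GSym.comul (Susp L)

theorem chainSplit_mem : chainSplit L ∈ homDeg (Chains L) (Chains L ⊗[ℚ] L) (-1) :=
  comp_mem (map_mem sgn_mem_homDeg (chainTau_mem L) rfl) GSym.comul_mem rfl

/-- The differential of the chain complex `C_*(L; N) = C_*(L) ⊗ N`:
`d(c ⊗ n) = dc ⊗ n + (-1)^{|c|} c ⊗ dn - ∑ (-1)^{|c'|} c' ⊗ τ(c'') · n`. -/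
def chainsD : Chains L ⊗[ℚ] N →ₗ[ℚ] Chains L ⊗[ℚ] N :=
  tensorD (chainD L) (DGRep.d L) -
    TensorProduct.map LinearMap.id DGRep.act ∘ₗ
      (TensorProduct.assoc ℚ (Chains L) L N).toLinearMap ∘ₗ
      TensorProduct.map (chainSplit L) LinearMap.id

/-- The graded vector space underlying the cochain complex
`C^*(L; N) = Hom_{UL}(C_*(L; UL), N) = Hom(C_*(L), N)`: since `C_*(L; UL) = C_*(L) ⊗ UL` is free as
a right `UL`-module, a `UL`-linear map `f` is given by `c ↦ f(c ⊗ 1)`. -/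
abbrev Cochains : Type _ := GHom (Chains L) N

/-- The right action `n · x = -(-1)^{|n||x|} x · n`. -/
def rightAct : N ⊗[ℚ] L →ₗ[ℚ] N := -(DGRep.act ∘ₗ braid N L)

theorem rightAct_mem : rightAct L N ∈ homDeg (N ⊗[ℚ] L) N 0 :=
  Submodule.neg_mem _ (comp_mem DGRep.act_mem braid_mem rfl)

/-- The formula for the differential of `C^*(L; N)` on all linear maps. -/
def cochainsDAux : (Chains L →ₗ[ℚ] N) →ₗ[ℚ] (Chains L →ₗ[ℚ] N) where
  toFun f := DGRep.d L ∘ₗ f - sgnHom (Chains L) N f ∘ₗ chainD L +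
    rightAct L N ∘ₗ TensorProduct.map (sgnHom (Chains L) N f) LinearMap.id ∘ₗ chainSplit L
  map_add' f g := by
    simp only [map_add, LinearMap.comp_add, LinearMap.add_comp, TensorProduct.map_add_left]
    abel
  map_smul' a f := by
    simp only [map_smul, LinearMap.comp_smul, LinearMap.smul_comp, TensorProduct.map_smul_left,
      RingHom.id_apply, smul_add, smul_sub]

variable {N} in
theorem cochainsDAux_mem {n : ℤ} {f : Chains L →ₗ[ℚ] N} (hf : f ∈ homDeg (Chains L) N n) :
    cochainsDAux L N f ∈ homDeg (Chains L) N (n + -1) :=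
  add_mem (Submodule.sub_mem _ (comp_mem DGRep.d_mem hf rfl)
      (comp_mem (wtHom_mem_homDeg _ hf) (chainD_mem L) (add_comm _ _)))
    (comp_mem (rightAct_mem L N)
      (comp_mem (map_mem (wtHom_mem_homDeg _ hf) id_mem rfl) (chainSplit_mem L) rfl) (by ring))

/-- The differential of `C^*(L; N)`: `(Df)(c) = d(f(c)) - (-1)^{|f|} f(d(c ⊗ 1))`, where
`d(c ⊗ 1) = dc ⊗ 1 - ∑ (-1)^{|c'|} c' ⊗ τ(c'')` in `C_*(L; UL)` and `f(c ⊗ x) = f(c) · x`. -/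
def cochainsD : Cochains L N →ₗ[ℚ] Cochains L N :=
  GHom.map (cochainsDAux L N) fun _ hf =>
    gHom_induction (cochainsDAux L N) (-1) (fun _ _ hf => cochainsDAux_mem L hf) hf

/-- The map of cochains induced by a map of coefficients of degree `0`. -/
def postcomp {X Y Z : Type*} [AddCommGroup X] [Module ℚ X] [AddCommGroup Y] [Module ℚ Y]
    [AddCommGroup Z] [Module ℚ Z] [GradedSpace X] [GradedSpace Y] [GradedSpace Z]
    (h : Y →ₗ[ℚ] Z) (hh : h ∈ homDeg Y Z 0) : GHom X Y →ₗ[ℚ] GHom X Z :=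
  GHom.map (LinearMap.llcomp ℚ X Y Z h) fun _ hf =>
    gHom_induction (LinearMap.llcomp ℚ X Y Z h) 0 (fun _ _ hf => comp_mem hh hf rfl) hf

variable {L} in
theorem cupAux_mem {P R : Type*} [AddCommGroup P] [Module ℚ P] [GradedSpace P]
    [AddCommGroup R] [Module ℚ R] [GradedSpace R] (f : Cochains L P) (g : Cochains L R) :
    homTensor (Chains L) (Chains L) P R f.val g.val ∘ₗ GSym.comul (Susp L) ∈
      gHom (Chains L) (P ⊗[ℚ] R) := by
  induction f using deg_induction with
  | h0 => simp
  | hadd a b ha hb =>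
    simp only [map_add, LinearMap.add_apply, LinearMap.add_comp]
    exact add_mem ha hb
  | h p f hf =>
    induction g using deg_induction with
    | h0 => simp
    | hadd a b ha hb =>
      simp only [map_add, LinearMap.add_comp]
      exact add_mem ha hb
    | h q g hg =>
      exact mem_gHom (comp_mem (homTensor_mem (Submodule.mem_comap.1 hf) (Submodule.mem_comap.1 hg)
        rfl) GSym.comul_mem rfl)

/-- The cup product `f ∪ g = (f ⊗ g) ∘ Δ` with values in `M ⊗ N`. -/
def cup : Cochains L M ⊗[ℚ] Cochains L N →ₗ[ℚ] Cochains L (M ⊗[ℚ] N) :=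
  TensorProduct.lift (LinearMap.mk₂ ℚ
    (fun f g => GHom.mk (homTensor (Chains L) (Chains L) M N f.val g.val ∘ₗ GSym.comul (Susp L))
      (cupAux_mem f g))
    (fun f f' g => by ext; simp)
    (fun a f g => by ext; simp)
    (fun f g g' => by ext; simp)
    (fun a f g => by ext; simp))

theorem rid_mem : (TensorProduct.rid ℚ N).toLinearMap ∈ homDeg (N ⊗[ℚ] ℚ) N 0 := by
  refine tensor_homDeg fun p q x hx y hy => ?_
  by_cases hq : q = 0
  · subst hq; simpa using Submodule.smul_mem _ y hx
  · have : y = 0 := by simpa [deg, GradedSpace.deg, hq] using hy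
    simp [this]

/-- The right action of the cochain algebra `C^*(L)` on `C^*(L; N)`.  For `N = ℚ` this is the
product `f ∪ g = μ ∘ (f ⊗ g) ∘ Δ` of `C^*(L)`. -/
def cupRight : Cochains L N ⊗[ℚ] Cochains L ℚ →ₗ[ℚ] Cochains L N :=
  postcomp (TensorProduct.rid ℚ N).toLinearMap (rid_mem N) ∘ₗ cup L ℚ N

/-- The unit of `C^*(L)`. -/
def cochainOne : Cochains L ℚ := GHom.mk (chainCounit L) (mem_gHom (chainCounit_mem L))

/-- The cap product `cap_u : C^*(L; N) → C_*(L; N)` with a chain `u` of degree `m`: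
`cap_u(f) = (-1)^m ∑ (-1)^{|f||u'|} u' ⊗ f(u'')`, where `Δ u = ∑ u' ⊗ u''`. -/
def cap (m : ℕ) (u : Chains L) : Cochains L N →ₗ[ℚ] Chains L ⊗[ℚ] N :=
  (-1 : ℚ) ^ m • (LinearMap.applyₗ (GSym.comul (Susp L) u) ∘ₗ
    homTensor (Chains L) (Chains L) (Chains L) N LinearMap.id ∘ₗ GHom.val)

/-- `cap_u ⊗ cap_u`, with the sign rule for which it commutes with the differentials:
`x ⊗ y ↦ (-1)^{m|y|} cap_u(x) ⊗ cap_u(y)`. -/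
def capTensorCap (m : ℕ) (u : Chains L) :
    Cochains L M ⊗[ℚ] Cochains L N →ₗ[ℚ] (Chains L ⊗[ℚ] M) ⊗[ℚ] (Chains L ⊗[ℚ] N) :=
  TensorProduct.map (cap L M m u)
    (cap L N m u ∘ₗ ((sgn (Cochains L N) : Module.End ℚ (Cochains L N)) ^ m))

/-- `C_*(Δ; id) : C_*(L; M ⊗ N) → C_*(L; M) ⊗ C_*(L; N)`,
`c ⊗ (m ⊗ n) ↦ ∑ (-1)^{|c''||m|} (c' ⊗ m) ⊗ (c'' ⊗ n)`. -/
def chainsDiag :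
    Chains L ⊗[ℚ] (M ⊗[ℚ] N) →ₗ[ℚ] (Chains L ⊗[ℚ] M) ⊗[ℚ] (Chains L ⊗[ℚ] N) :=
  interchange (Chains L) (Chains L) M N ∘ₗ TensorProduct.map (GSym.comul (Susp L)) LinearMap.id

/-! ### The model of the diagonal and the diagonal class -/

/-- The module `(UL)^∨_a`: the graded dual of `UL`, with the representation dual to the adjoint
one. -/
abbrev UDual : Type _ := GHom (UEnv L) ℚ

/-- The algebra `∧V = C^*(L)`. -/
abbrev Alg : Type _ := Cochains L ℚ

/-- The algebra `∧V ⊗ ∧V' = C^*(L) ⊗ C^*(L)`. -/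
abbrev Alg2 : Type _ := Alg L ⊗[ℚ] Alg L

/-- The differential of `∧V ⊗ ∧V'`. -/
abbrev alg2D : Alg2 L →ₗ[ℚ] Alg2 L := tensorD (cochainsD L ℚ) (cochainsD L ℚ)

/-- The product of `∧V`. -/
abbrev algMul : Alg L ⊗[ℚ] Alg L →ₗ[ℚ] Alg L := cupRight L ℚ

/-- The product of `∧V ⊗ ∧V'`. -/
abbrev alg2Mul : Alg2 L ⊗[ℚ] Alg2 L →ₗ[ℚ] Alg2 L := pairTensor (algMul L) (algMul L)

/-- The algebra `∧V̄`.  Here `V = (sL)^∨`, so that `V̄`, with `V̄^n = V^{n+1}`, is `L^∨`. -/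
abbrev AlgBar : Type _ := GSym (GHom L ℚ)

/-- The algebra `∧V ⊗ ∧V' ⊗ ∧V̄`. -/
abbrev Alg3 : Type _ := Alg2 L ⊗[ℚ] AlgBar L

/-- The product of `∧V ⊗ ∧V' ⊗ ∧V̄`. -/
abbrev alg3Mul : Alg3 L ⊗[ℚ] Alg3 L →ₗ[ℚ] Alg3 L :=
  pairTensor (alg2Mul L) (LinearMap.mul' ℚ (AlgBar L))

/-- The inclusion of `∧V ⊗ ∧V'`. -/
abbrev inclBase : Alg2 L →ₗ[ℚ] Alg3 L := (TensorProduct.mk ℚ (Alg2 L) (AlgBar L)).flip 1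

/-- The inclusion of `∧V̄`. -/
abbrev inclBar : AlgBar L →ₗ[ℚ] Alg3 L :=
  TensorProduct.mk ℚ (Alg2 L) (AlgBar L) (cochainOne L ⊗ₜ cochainOne L)

/-- A relative model of the multiplication `μ : ∧V ⊗ ∧V' → ∧V` of `∧V = C^*(L)`: a differential `D`
that makes `∧V ⊗ ∧V' ⊗ ∧V̄` a differential graded algebra extending `∧V ⊗ ∧V'`, together with a
quasi-isomorphism of differential graded algebras `φ : (∧V ⊗ ∧V' ⊗ ∧V̄, D) → ∧V` that
extends `μ`. -/
structure DiagonalModel where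
  D : Alg3 L →ₗ[ℚ] Alg3 L
  D_mem : D ∈ homDeg (Alg3 L) (Alg3 L) (-1)
  D_D : ∀ x, D (D x) = 0
  D_mul : ∀ x y, D (alg3Mul L (x ⊗ₜ y)) =
    alg3Mul L (D x ⊗ₜ y) + alg3Mul L (sgn (Alg3 L) x ⊗ₜ D y)
  D_base : ∀ r, D (inclBase L r) = inclBase L (alg2D L r)
  φ : Alg3 L →ₗ[ℚ] Alg L
  φ_mem : φ ∈ homDeg (Alg3 L) (Alg L) 0
  φ_mul : ∀ x y, φ (alg3Mul L (x ⊗ₜ y)) = algMul L (φ x ⊗ₜ φ y)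
  φ_base : ∀ r, φ (inclBase L r) = algMul L r
  φ_chain : IsChainMap D (cochainsD L ℚ) φ
  φ_quasiIso : Function.Bijective (homologyMap φ_chain)

variable {L} in
/-- `μ_T` is a morphism of differential `∧V ⊗ ∧V'`-modules `∧V ⊗ ∧V' ⊗ ∧V̄ → ∧V ⊗ ∧V'` (of upper
degree `m`) whose restriction to `∧V ⊗ ∧V'` induces in homology the multiplication by `T`. -/
structure ExtendsMulBy (K : DiagonalModel L) (m : ℕ) (T : Alg2 L) (μT : Alg3 L →ₗ[ℚ] Alg2 L) :
    Prop where
  mem : μT ∈ homDeg (Alg3 L) (Alg2 L) (-m)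
  chain : IsChainMap K.D (alg2D L) μT
  linear : ∀ r k, μT (alg3Mul L (inclBase L r ⊗ₜ k)) = alg2Mul L (r ⊗ₜ μT k)
  restrict : ∀ r, alg2D L r = 0 →
    μT (inclBase L r) - alg2Mul L (r ⊗ₜ T) ∈ LinearMap.range (alg2D L)

/-- `C^*(L; (UL)^∨_a)`, the model of the free loop space. -/
abbrev LoopAlg : Type _ := Cochains L (UDual L)

/-- `C^*(L; (UL)^∨_a) ⊗ C^*(L; (UL)^∨_a)`. -/
abbrev LoopAlg2 : Type _ := LoopAlg L ⊗[ℚ] LoopAlg L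

/-- The differential of `C^*(L; (UL)^∨_a) ⊗ C^*(L; (UL)^∨_a)`. -/
abbrev loopAlg2D : LoopAlg2 L →ₗ[ℚ] LoopAlg2 L :=
  tensorD (cochainsD L (UDual L)) (cochainsD L (UDual L))

/-- The right action of `∧V ⊗ ∧V'` on `C^*(L; (UL)^∨_a) ⊗ C^*(L; (UL)^∨_a)`. -/
abbrev loopAlg2Mul : LoopAlg2 L ⊗[ℚ] Alg2 L →ₗ[ℚ] LoopAlg2 L :=
  pairTensor (cupRight L (UDual L)) (cupRight L (UDual L))

/-- `C^*(L; (UL)^∨_a) ⊗ C^*(L; (UL)^∨_a) ⊗ ∧V̄`, which is the tensor product of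
`C^*(L; (UL)^∨_a) ⊗ C^*(L; (UL)^∨_a)` and `∧V ⊗ ∧V' ⊗ ∧V̄` over `∧V ⊗ ∧V'`. -/
abbrev LoopAlg3 : Type _ := LoopAlg2 L ⊗[ℚ] AlgBar L

variable {L}

/-- The differential `D'` of that tensor product: `D'(ξ ⊗ w) = dξ ⊗ w + (-1)^{|ξ|} ξ · D(w)`, where
`ξ · (r ⊗ w') = (ξ · r) ⊗ w'`. -/
def DiagonalModel.loopD (K : DiagonalModel L) : LoopAlg3 L →ₗ[ℚ] LoopAlg3 L :=
  TensorProduct.map (loopAlg2D L) LinearMap.id +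
    TensorProduct.map (loopAlg2Mul L) LinearMap.id ∘ₗ
      (TensorProduct.assoc ℚ (LoopAlg2 L) (Alg2 L) (AlgBar L)).symm.toLinearMap ∘ₗ
      TensorProduct.map (sgn (LoopAlg2 L)) (K.D ∘ₗ inclBar L)

/-- The map `Φ = φ ⊗ 1` to `C^*(L; (UL)^∨_a ⊗ (UL)^∨_a)`, which is the tensor product of
`C^*(L; (UL)^∨_a) ⊗ C^*(L; (UL)^∨_a)` and `∧V` over `∧V ⊗ ∧V'`:
`Φ((f ⊗ g) ⊗ w) = (f ∪ g) · φ(w)`. -/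
def DiagonalModel.loopPhi (K : DiagonalModel L) :
    LoopAlg3 L →ₗ[ℚ] Cochains L (UDual L ⊗[ℚ] UDual L) :=
  cupRight L (UDual L ⊗[ℚ] UDual L) ∘ₗ
    TensorProduct.map (cup L (UDual L) (UDual L)) (K.φ ∘ₗ inclBar L)

/-- The map `μ_T ⊗ 1`, `ξ ⊗ w ↦ ξ · μ_T(w)`. -/
def loopMuT (μT : Alg3 L →ₗ[ℚ] Alg2 L) : LoopAlg3 L →ₗ[ℚ] LoopAlg2 L :=
  loopAlg2Mul L ∘ₗ TensorProduct.map LinearMap.id (μT ∘ₗ inclBar L)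

end Complexes

end

end LieLoop

open LieLoop

namespace LieLoop
noncomputable section

/-! ### Operator calculus -/

section Calculus
variable {X Y Z X' Y' Z' X'' Y'' A : Type*}
  [AddCommGroup X] [Module ℚ X] [GradedSpace X] [AddCommGroup Y] [Module ℚ Y] [GradedSpace Y]
  [AddCommGroup Z] [Module ℚ Z] [GradedSpace Z]
  [AddCommGroup X'] [Module ℚ X'] [GradedSpace X'] [AddCommGroup Y'] [Module ℚ Y'] [GradedSpace Y']
  [AddCommGroup Z'] [Module ℚ Z'] [GradedSpace Z']
  [AddCommGroup X''] [Module ℚ X''] [GradedSpace X''] [AddCommGroup Y''] [Module ℚ Y'']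
  [GradedSpace Y''] [AddCommGroup A] [Module ℚ A]

/-! Cochains are handled as operators. A cochain `f` with values in `N` gives the comodule map
`coext f : C_*L → C_*(L;N)`, `c ↦ ∑ ± c' ⊗ f(c'')`, and `f` is recovered from it by the
augmentation. Under this dictionary the right action of `C^*L` is composition (`coext_cupRight`),
the differential is the graded commutator with the differentials (`coext_cochainsD`), and the cap
product is evaluation at `u` up to the sign `(-1)^m`. Since `Δ` is coassociative and cocommutative,
the diagonal map carries the operator of `f ∪ g` to `(coext f ⊗ coext g) ∘ Δ`
(`chainsDiag_coext_cup`). The claims about chain maps become manipulations of operators; for the two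
cap maps they use `du = 0`.

`Φ` is a quasi-isomorphism for the following reason. Put `N = (UL)^∨`. As `L` is positively graded
of finite type and `N` lives in lower degrees `≤ 0`, every cochain is a finite combination of
constant cochains times elements of `C^*L`, so `C^*(L;N) ≅ N ⊗ C^*L`. Hence `E ⊗ E ⊗ ∧V̄ ≅ (N ⊗ N) ⊗
(∧V ⊗ ∧V' ⊗ ∧V̄)` (`constLoopAct_bijective`), and `Φ` becomes `1 ⊗ φ` as a linear map. It is not `1
⊗ φ` as a map of complexes: the differential of the constant cochain of `n` is the constant cochain
of `dn` plus terms with coefficients `n · x`, `x ∈ L_{≥1}`, whose degree is larger. Over a field the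
acyclic complex `ker φ` has a contraction `h`, and `1 ⊗ h` contracts `ker Φ` up to terms that raise
the degree of the constant part. Since that degree is at most `0`, finitely many corrections turn
any cycle of `ker Φ` into a boundary (`ker_loopPhi_acyclic`).

For commutativity the coefficients are removed. Both composites send `ξ · b` to the operator of `ξ`
applied to an element of `C_*L ⊗ C_*L` that depends on `b` alone: `(-1)^m Δ(φ(b) · u)` for one and
`μ_T(b) · (u ⊗ u)` for the other (`chainsDiag_cap_loopPhi`, `capTensorCap_loopMuT`). Both are chain
maps linear over `∧V ⊗ ∧V'`. By finite type `C_*L ⊗ C_*L` is the degreewise dual of `∧V ⊗ ∧V'`, so a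
linear map into it is determined by its composite with `ε ⊗ ε`, and it is null-homotopic through
linear maps once that composite vanishes on cycles (`exists_homotopy`). Because `φ` is a
quasi-isomorphism, every cycle is homologous to some `a ⊗ 1` with `a` a cocycle. There the first map
has augmentation `(-1)^m a(u)`. In the second, `μ_T` is multiplication by `T` up to a boundary, and
only the summand of `T` whose `a_i` has degree `0`, that is, is a multiple of the unit, survives
evaluation; it gives `(-1)^m a(u)` as well (`counit_mul_diagonal`). -/

theorem sign_congr {a b : ℤ} (k : ℤ) (h : a = b + 2 * k) : (-1 : ℚ) ^ a = (-1) ^ b := by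
  rw [h, zpow_add₀ (by norm_num), zpow_mul]; norm_num

theorem sign_add (a b : ℤ) : (-1 : ℚ) ^ (a + b) = (-1) ^ a * (-1) ^ b :=
  zpow_add₀ (by norm_num) a b

theorem tensor_ext_deg {f g : X ⊗[ℚ] Y →ₗ[ℚ] A}
    (h : ∀ p q, ∀ x ∈ deg X p, ∀ y ∈ deg Y q, f (x ⊗ₜ y) = g (x ⊗ₜ y)) : f = g := by
  refine TensorProduct.ext (hom_ext_deg fun p x hx => hom_ext_deg fun q y hy => ?_)
  exact h p q x hx y hy

theorem tensor_ext_deg_left {X Y : Type*} [AddCommGroup X] [Module ℚ X] [GradedSpace X]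
    [AddCommGroup Y] [Module ℚ Y] {f g : X ⊗[ℚ] Y →ₗ[ℚ] A}
    (h : ∀ p, ∀ x ∈ deg X p, ∀ y, f (x ⊗ₜ y) = g (x ⊗ₜ y)) : f = g := by
  refine TensorProduct.ext (hom_ext_deg fun p x hx => LinearMap.ext fun y => ?_)
  exact h p x hx y

theorem tensor3_ext_deg {f g : (X ⊗[ℚ] Y) ⊗[ℚ] Z →ₗ[ℚ] A}
    (h : ∀ p q r, ∀ x ∈ deg X p, ∀ y ∈ deg Y q, ∀ z ∈ deg Z r,
      f ((x ⊗ₜ y) ⊗ₜ z) = g ((x ⊗ₜ y) ⊗ₜ z)) : f = g := by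
  refine TensorProduct.ext (tensor_ext_deg fun p q x hx y hy => hom_ext_deg fun r z hz => ?_)
  exact h p q r x hx y hy z hz

theorem tensor_ext_deg' {f g : X ⊗[ℚ] (Y ⊗[ℚ] Z) →ₗ[ℚ] A}
    (h : ∀ p q r, ∀ x ∈ deg X p, ∀ y ∈ deg Y q, ∀ z ∈ deg Z r,
      f (x ⊗ₜ (y ⊗ₜ z)) = g (x ⊗ₜ (y ⊗ₜ z))) : f = g := by
  refine TensorProduct.ext (hom_ext_deg fun p x hx => ?_)
  refine tensor_ext_deg fun q r y hy z hz => ?_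
  exact h p q r x hx y hy z hz

theorem tensor4_ext_deg {f g : (X ⊗[ℚ] Y) ⊗[ℚ] (Z ⊗[ℚ] X') →ₗ[ℚ] A}
    (h : ∀ p q r s, ∀ x ∈ deg X p, ∀ y ∈ deg Y q, ∀ z ∈ deg Z r, ∀ w ∈ deg X' s,
      f ((x ⊗ₜ y) ⊗ₜ (z ⊗ₜ w)) = g ((x ⊗ₜ y) ⊗ₜ (z ⊗ₜ w))) : f = g := by
  refine TensorProduct.ext' fun v w => ?_
  have : f ∘ₗ (TensorProduct.mk ℚ (X ⊗[ℚ] Y) (Z ⊗[ℚ] X')).flip w =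
      g ∘ₗ (TensorProduct.mk ℚ (X ⊗[ℚ] Y) (Z ⊗[ℚ] X')).flip w := by
    refine tensor_ext_deg fun p q x hx y hy => ?_
    have : f ∘ₗ TensorProduct.mk ℚ (X ⊗[ℚ] Y) (Z ⊗[ℚ] X') (x ⊗ₜ y) =
        g ∘ₗ TensorProduct.mk ℚ (X ⊗[ℚ] Y) (Z ⊗[ℚ] X') (x ⊗ₜ y) :=
      tensor_ext_deg fun r s z hz w hw => h p q r s x hx y hy z hz w hw
    exact LinearMap.congr_fun this w
  exact LinearMap.congr_fun this v

theorem homDeg_apply {n k l : ℤ} {f : X →ₗ[ℚ] Y} (hf : f ∈ homDeg X Y n) {x : X}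
    (hx : x ∈ deg X k) (h : k + n = l) : f x ∈ deg Y l := h ▸ hf k x hx

/-- The sign comes from moving `g₂` past `f₁`. No sign involves the degree of `f₂`, so its target
needs no grading. Many later sign identities are obtained from this rule instead of by evaluation on
elements. -/
theorem homTensor_comp {s₁ t₁ t₂ : ℤ} {f₁ : X →ₗ[ℚ] X'} {g₁ : Y →ₗ[ℚ] Y'} {g₂ : Y' →ₗ[ℚ] Y''}
    (f₂ : X' →ₗ[ℚ] A) (hf₁ : f₁ ∈ homDeg X X' s₁) (hg₁ : g₁ ∈ homDeg Y Y' t₁)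
    (hg₂ : g₂ ∈ homDeg Y' Y'' t₂) :
    homTensor X' Y' A Y'' f₂ g₂ ∘ₗ homTensor X Y X' Y' f₁ g₁ =
      (-1 : ℚ) ^ (t₂ * s₁) • homTensor X Y A Y'' (f₂ ∘ₗ f₁) (g₂ ∘ₗ g₁) := by
  refine tensor_ext_deg fun p q x hx y hy => ?_
  simp only [LinearMap.comp_apply, LinearMap.smul_apply, homTensor_apply _ _ hg₁ hx,
    homTensor_apply _ _ (comp_mem hg₂ hg₁ rfl) hx, map_smul,
    homTensor_apply _ _ hg₂ (hf₁ p x hx), smul_smul, ← sign_add]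
  congr 2; ring

theorem homTensor_eq_map {f : X →ₗ[ℚ] A} {g : Y →ₗ[ℚ] Y'} (hg : g ∈ homDeg Y Y' 0) :
    homTensor X Y A Y' f g = TensorProduct.map f g := by
  refine tensor_ext_deg fun p q x hx y hy => ?_
  simp [homTensor_apply _ _ hg hx]

theorem homTensor_id_id : homTensor X Y X Y LinearMap.id LinearMap.id = LinearMap.id := by
  rw [homTensor_eq_map id_mem, TensorProduct.map_id]

/-- This brings the differential of a tensor product into the operator calculus, where
`homTensor_comp` produces its signs. -/
theorem tensorD_eq {dX : X →ₗ[ℚ] X} {dY : Y →ₗ[ℚ] Y} (hY : dY ∈ homDeg Y Y (-1)) :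
    tensorD dX dY = homTensor X Y X Y dX LinearMap.id + homTensor X Y X Y LinearMap.id dY := by
  refine tensor_ext_deg fun p q x hx y hy => ?_
  rw [tensorD_apply hx, LinearMap.add_apply, homTensor_apply _ _ id_mem hx,
    homTensor_apply _ _ hY hx, sign_congr (a := -1 * p) (b := p) (-p) (by ring)]
  simp

theorem braid_homTensor {s t : ℤ} {f : X →ₗ[ℚ] X'} {g : Y →ₗ[ℚ] Y'} (hf : f ∈ homDeg X X' s)
    (hg : g ∈ homDeg Y Y' t) :
    braid X' Y' ∘ₗ homTensor X Y X' Y' f g =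
      (-1 : ℚ) ^ (s * t) • (homTensor Y X Y' X' g f ∘ₗ braid X Y) := by
  refine tensor_ext_deg fun p q x hx y hy => ?_
  simp only [LinearMap.comp_apply, LinearMap.smul_apply, homTensor_apply _ _ hg hx, map_smul,
    braid_tmul hx hy, braid_tmul (hf p x hx) (hg q y hy), homTensor_apply _ _ hf hy, smul_smul,
    ← sign_add]
  congr 1
  exact sign_congr (p * t) (by ring)

theorem assoc_homTensor {t r : ℤ} (f : X →ₗ[ℚ] A) {g : Y →ₗ[ℚ] Y'} {h : Z →ₗ[ℚ] Z'}
    (hg : g ∈ homDeg Y Y' t) (hh : h ∈ homDeg Z Z' r) :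
    (TensorProduct.assoc ℚ A Y' Z').toLinearMap ∘ₗ
        homTensor (X ⊗[ℚ] Y) Z (A ⊗[ℚ] Y') Z' (homTensor X Y A Y' f g) h =
      homTensor X (Y ⊗[ℚ] Z) A (Y' ⊗[ℚ] Z') f (homTensor Y Z Y' Z' g h) ∘ₗ
        (TensorProduct.assoc ℚ X Y Z).toLinearMap := by
  refine tensor3_ext_deg fun p q k x hx y hy z hz => ?_
  simp only [LinearMap.comp_apply, homTensor_apply _ _ hh (tmul_mem rfl hx hy),
    homTensor_apply _ _ hg hx, LinearEquiv.coe_coe, TensorProduct.assoc_tmul,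
    homTensor_apply _ _ (homTensor_mem hg hh rfl) hx, homTensor_apply _ _ hh hy, map_smul,
    ← TensorProduct.smul_tmul', TensorProduct.tmul_smul, smul_smul, ← sign_add]
  congr 2; ring

theorem apply_sgn {n : ℤ} {f : X →ₗ[ℚ] Y} (hf : f ∈ homDeg X Y n) (x : X) :
    f (sgn X x) = (-1 : ℚ) ^ n • sgn Y (f x) := by
  induction x using deg_induction with
  | h0 => simp
  | hadd a b ha hb => simp only [map_add, ha, hb, smul_add]
  | h p x hx =>
    rw [sgn_of_mem hx, sgn_of_mem (hf p x hx), map_smul, smul_smul, ← sign_add]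
    congr 1; exact sign_congr (-n) (by ring)

theorem sgn_sgn (x : X) : sgn X (sgn X x) = x := by
  induction x using deg_induction with
  | h0 => simp
  | hadd a b ha hb => simp only [map_add, ha, hb]
  | h p x hx => rw [sgn_of_mem hx, map_smul, sgn_of_mem hx, smul_smul, neg_one_zpow_mul_self, one_smul]

theorem sgn_tmul (x : X) (y : Y) : sgn (X ⊗[ℚ] Y) (x ⊗ₜ y) = sgn X x ⊗ₜ sgn Y y := rfl

theorem sgnHom_of_mem {n : ℤ} {f : X →ₗ[ℚ] Y} (hf : f ∈ homDeg X Y n) :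
    sgnHom X Y f = (-1 : ℚ) ^ n • f := by
  simpa using wtHom_of_mem (-1) hf

end Calculus

/-! ### The coalgebra `∧V` -/

section Coalgebra
variable {V : Type*} [AddCommGroup V] [Module ℚ V] [GradedSpace V]
variable {A : Type*} [AddCommGroup A] [Module ℚ A]

/-- Induction on the length of words in the generators. The degrees of the letter and of the
remaining word are handed over so that Koszul signs can be evaluated in the step. -/
theorem GSym.hom_ext_word {f g : GSym V →ₗ[ℚ] A} (h1 : f 1 = g 1)
    (h : ∀ p n, ∀ x ∈ deg V p, ∀ w ∈ deg (GSym V) n, f w = g w →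
      f (GSym.ι V x * w) = g (GSym.ι V x * w)) : f = g := by
  refine hom_ext_deg fun n w hw => ?_
  induction hw using Submodule.span_induction with
  | zero => simp
  | add a b _ _ ha hb => simp only [map_add, ha, hb]
  | smul a b _ hb => simp only [map_smul, hb]
  | mem w hw =>
    induction hw with
    | one => exact h1
    | cons hx hw ih => exact h _ _ _ hx _ (Submodule.subset_span hw) ih

theorem GSym.comul_one : GSym.comul V 1 = 1 ⊗ₜ 1 := by
  simp [GSym.comul]

theorem GSym.comul_ι_mul (x : V) (w : GSym V) :
    GSym.comul V (GSym.ι V x * w) = GSym.primitive V x (GSym.comul V w) := by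
  simp [GSym.comul]

/-- Left multiplication by a generator. -/
def GSym.mulι (x : V) : GSym V →ₗ[ℚ] GSym V := LinearMap.mulLeft ℚ (GSym.ι V x)

theorem GSym.mulι_mem {p : ℤ} {x : V} (hx : x ∈ deg V p) :
    GSym.mulι x ∈ homDeg (GSym V) (GSym V) p := by
  intro k v hv
  have := GSym.mul_mem _ _ (tmul_mem rfl (GSym.ι_mem hx) hv)
  rwa [add_zero, add_comm] at this

theorem GSym.primitive_eq {p : ℤ} {x : V} (hx : x ∈ deg V p) :
    GSym.primitive V x = homTensor (GSym V) (GSym V) (GSym V) (GSym V) (GSym.mulι x) LinearMap.id +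
      homTensor (GSym V) (GSym V) (GSym V) (GSym V) LinearMap.id (GSym.mulι x) := by
  refine tensor_ext_deg fun r k z hz w hw => ?_
  rw [GSym.primitive_apply hx w hz, LinearMap.add_apply, homTensor_apply _ _ id_mem hz,
    homTensor_apply _ _ (GSym.mulι_mem hx) hz]
  simp [GSym.mulι]

/-- The braiding exchanges the two summands of multiplication by `x ⊗ 1 + 1 ⊗ x`, hence commutes
with it, and `Δ` is generated from `1 ⊗ 1` by these multiplications. -/
theorem GSym.comul_cocomm : braid (GSym V) (GSym V) ∘ₗ GSym.comul V = GSym.comul V := by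
  refine GSym.hom_ext_word ?_ fun p n x hx w hw ih => ?_
  · simp [GSym.comul_one, braid_tmul GSym.one_mem GSym.one_mem]
  · simp only [LinearMap.comp_apply] at ih ⊢
    rw [GSym.comul_ι_mul, GSym.primitive_eq hx]
    have e1 := LinearMap.congr_fun (braid_homTensor (GSym.mulι_mem hx) (id_mem (X := GSym V)))
      (GSym.comul V w)
    have e2 := LinearMap.congr_fun (braid_homTensor (id_mem (X := GSym V)) (GSym.mulι_mem hx))
      (GSym.comul V w)
    simp only [LinearMap.comp_apply, mul_zero, zero_mul, zpow_zero,
      one_smul, ih] at e1 e2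
    simp only [LinearMap.add_apply, map_add, e1, e2]
    rw [add_comm]

/-- Coassociativity. -/
theorem GSym.comul_coassoc :
    (TensorProduct.assoc ℚ (GSym V) (GSym V) (GSym V)).toLinearMap ∘ₗ
      TensorProduct.map (GSym.comul V) LinearMap.id ∘ₗ GSym.comul V =
      TensorProduct.map LinearMap.id (GSym.comul V) ∘ₗ GSym.comul V := by
  refine GSym.hom_ext_word ?_ fun p n x hx w hw ih => ?_
  · simp [GSym.comul_one]
  · simp only [LinearMap.comp_apply] at ih ⊢
    have hm := GSym.mulι_mem hx
    have hi : (LinearMap.id : GSym V →ₗ[ℚ] GSym V) ∈ _ := id_mem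
    have hc := GSym.comul_mem (V := V)
    have l1 := homTensor_comp (GSym.comul V) hm hi hi
    have l2 := homTensor_comp (GSym.comul V) hi hm hi
    have r1 := homTensor_comp (LinearMap.id : GSym V →ₗ[ℚ] GSym V) hm hi hc
    have r2 := homTensor_comp (LinearMap.id : GSym V →ₗ[ℚ] GSym V) hi hm hc
    have l3 := homTensor_comp (GSym.primitive V x) hc hi hi
    have l4 := homTensor_comp (LinearMap.id : GSym V ⊗[ℚ] GSym V →ₗ[ℚ] _) hc hi hm
    have r3 := homTensor_comp (GSym.mulι x) hi hc (id_mem (X := GSym V ⊗[ℚ] GSym V))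
    have hprim : GSym.primitive V x ∈ homDeg (GSym V ⊗[ℚ] GSym V) (GSym V ⊗[ℚ] GSym V) p := by
      intro k y hy; rw [add_comm]; exact GSym.primitive_mem hx hy
    have r4 := homTensor_comp (LinearMap.id : GSym V →ₗ[ℚ] GSym V) hi hc hprim
    have hcomp : GSym.comul V ∘ₗ GSym.mulι x = GSym.primitive V x ∘ₗ GSym.comul V :=
      LinearMap.ext fun w => GSym.comul_ι_mul x w
    rw [← homTensor_eq_map id_mem, ← homTensor_eq_map hc]
    rw [← homTensor_eq_map id_mem, ← homTensor_eq_map hc] at ih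
    have a1 := assoc_homTensor (GSym.mulι x) hi hi
    have a2 := assoc_homTensor (LinearMap.id : GSym V →ₗ[ℚ] GSym V) hm hi
    have a3 := assoc_homTensor (LinearMap.id : GSym V →ₗ[ℚ] GSym V) hi hm
    -- Each iterated coproduct turns multiplication by `x` into multiplication by `x ⊗ 1 ⊗ 1 + 1 ⊗ x
    -- ⊗ 1 + 1 ⊗ 1 ⊗ x`, bracketed in its own way (`L` and `R`); reassociation identifies the two
    -- sums, so the inductive hypothesis for `w` carries over to `x w`.
    have L : ∀ z : GSym V ⊗[ℚ] GSym V, homTensor (GSym V) (GSym V) (GSym V ⊗[ℚ] GSym V) (GSym V)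
            (GSym.comul V) LinearMap.id
        (GSym.primitive V x z) =
        homTensor (GSym V ⊗[ℚ] GSym V) (GSym V) (GSym V ⊗[ℚ] GSym V) (GSym V)
            (GSym.primitive V x) LinearMap.id
            (homTensor (GSym V) (GSym V) (GSym V ⊗[ℚ] GSym V) (GSym V)
            (GSym.comul V) LinearMap.id z) +
          homTensor (GSym V ⊗[ℚ] GSym V) (GSym V) (GSym V ⊗[ℚ] GSym V) (GSym V)
            LinearMap.id (GSym.mulι x)
            (homTensor (GSym V) (GSym V) (GSym V ⊗[ℚ] GSym V) (GSym V)
            (GSym.comul V) LinearMap.id z) := by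
      intro z
      have l1 := LinearMap.congr_fun l1 z
      have l2 := LinearMap.congr_fun l2 z
      have l3 := LinearMap.congr_fun l3 z
      have l4 := LinearMap.congr_fun l4 z
      simp only [LinearMap.comp_apply, mul_zero, zero_mul, zpow_zero,
        one_smul, hcomp, LinearMap.id_comp, LinearMap.comp_id] at l1 l2 l3 l4
      nth_rw 1 [GSym.primitive_eq hx]
      rw [LinearMap.add_apply, map_add, l1, l2, l3, l4]
    have R : ∀ z : GSym V ⊗[ℚ] GSym V, homTensor (GSym V) (GSym V) (GSym V) (GSym V ⊗[ℚ] GSym V)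
            LinearMap.id (GSym.comul V)
        (GSym.primitive V x z) =
        homTensor (GSym V) (GSym V ⊗[ℚ] GSym V) (GSym V) (GSym V ⊗[ℚ] GSym V)
            (GSym.mulι x) LinearMap.id
            (homTensor (GSym V) (GSym V) (GSym V) (GSym V ⊗[ℚ] GSym V)
            LinearMap.id (GSym.comul V) z) +
          homTensor (GSym V) (GSym V ⊗[ℚ] GSym V) (GSym V) (GSym V ⊗[ℚ] GSym V)
            LinearMap.id (GSym.primitive V x)
            (homTensor (GSym V) (GSym V) (GSym V) (GSym V ⊗[ℚ] GSym V)
            LinearMap.id (GSym.comul V) z) := by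
      intro z
      have r1 := LinearMap.congr_fun r1 z
      have r2 := LinearMap.congr_fun r2 z
      have r3 := LinearMap.congr_fun r3 z
      have r4 := LinearMap.congr_fun r4 z
      simp only [LinearMap.comp_apply, mul_zero, zero_mul, zpow_zero,
        one_smul, hcomp, LinearMap.id_comp, LinearMap.comp_id] at r1 r2 r3 r4
      nth_rw 1 [GSym.primitive_eq hx]
      rw [LinearMap.add_apply, map_add, r1, r2, r3, r4]
    rw [GSym.comul_ι_mul, L, R, ← ih]
    generalize homTensor (GSym V) (GSym V) (GSym V ⊗[ℚ] GSym V) (GSym V)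
            (GSym.comul V) LinearMap.id (GSym.comul V w) = z
    have a1 := LinearMap.congr_fun a1 z
    have a2 := LinearMap.congr_fun a2 z
    have a3 := LinearMap.congr_fun a3 z
    simp only [LinearMap.comp_apply, homTensor_id_id] at a1 a2 a3
    simp only [GSym.primitive_eq hx, LinearMap.add_apply, map_add, a1, a2, a3, add_assoc]

end Coalgebra


/-! ### The chain coalgebra -/

section ChainCoalgebra
variable {L : Type*} [AddCommGroup L] [Module ℚ L] [DGLie L]

theorem chainData_ι_mul (x : Susp L) (w : Chains L) :
    chainData L (GSym.ι (Susp L) x * w) = chainStep L x (chainData L w) := by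
  simp [chainData]

theorem chainData_one : chainData L 1 = (1, 0, 0) := by simp [chainData]

theorem chainCounit_one : chainCounit L 1 = 1 := by simp [chainCounit, chainData_one]
theorem chainTau_one : chainTau L 1 = 0 := by simp [chainTau, chainData_one]
theorem chainQ_one : chainQ L 1 = 0 := by simp [chainQ, chainData_one]

theorem chainCounit_ι_mul (x : Susp L) (w : Chains L) :
    chainCounit L (GSym.ι (Susp L) x * w) = 0 := by
  simp [chainCounit, chainData_ι_mul, chainStep]

theorem chainTau_ι_mul (x : Susp L) (w : Chains L) :
    chainTau L (GSym.ι (Susp L) x * w) = chainCounit L w • (susp L).symm x := by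
  simp [chainTau, chainData_ι_mul, chainStep, chainCounit]

theorem chainQ_ι_mul (x : Susp L) (w : Chains L) :
    chainQ L (GSym.ι (Susp L) x * w) = -(chainCounit L w • DGLie.d ((susp L).symm x)) -
      DGLie.br (sgn L ((susp L).symm x)) (chainTau L w) := by
  simp [chainQ, chainData_ι_mul, chainStep, chainCounit, chainTau]

theorem chainCounit_of_mem {n : ℤ} (hn : n ≠ 0) {c : Chains L} (hc : c ∈ deg (Chains L) n) :
    chainCounit L c = 0 := by
  have := chainCounit_mem L n c hc
  simpa [deg, GradedSpace.deg, hn] using this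

/-- The augmentation lives in degree `0`, so it does not see a sign governed by the degree of its
argument. This is how Koszul signs disappear in the counit arguments. -/
theorem chainCounit_smul_zpow (n k : ℤ) {c : Chains L} (hc : c ∈ deg (Chains L) n) :
    (-1 : ℚ) ^ (k * n) * chainCounit L c = chainCounit L c := by
  by_cases hn : n = 0
  · simp [hn]
  · simp [chainCounit_of_mem hn hc]

/-- The left counit law. -/
theorem comul_counit_left :
    (TensorProduct.lid ℚ (Chains L)).toLinearMap ∘ₗ
      TensorProduct.map (chainCounit L) LinearMap.id ∘ₗ GSym.comul (Susp L) = LinearMap.id := by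
  refine GSym.hom_ext_word ?_ fun p n x hx w hw ih => ?_
  · simp [GSym.comul_one, chainCounit_one]
  · simp only [LinearMap.comp_apply, LinearMap.id_apply] at ih ⊢
    rw [GSym.comul_ι_mul]
    have : (TensorProduct.lid ℚ (Chains L)).toLinearMap ∘ₗ
        TensorProduct.map (chainCounit L) LinearMap.id ∘ₗ GSym.primitive (Susp L) x =
        GSym.mulι x ∘ₗ (TensorProduct.lid ℚ (Chains L)).toLinearMap ∘ₗ
        TensorProduct.map (chainCounit L) LinearMap.id := by
      refine tensor_ext_deg_left fun k z hz w => ?_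
      simp [GSym.primitive_apply hx w hz, chainCounit_ι_mul, GSym.mulι, smul_smul,
        chainCounit_smul_zpow k p hz]
    have := LinearMap.congr_fun this (GSym.comul (Susp L) w)
    simp only [LinearMap.comp_apply] at this
    rw [this, ih]
    rfl

/-- The right counit law. -/
theorem comul_counit_right :
    (TensorProduct.rid ℚ (Chains L)).toLinearMap ∘ₗ
      TensorProduct.map LinearMap.id (chainCounit L) ∘ₗ GSym.comul (Susp L) = LinearMap.id := by
  -- By cocommutativity the right law is the left law precomposed with the braiding, whose sign is
  -- invisible to the augmentation.
  have h1 : (TensorProduct.rid ℚ (Chains L)).toLinearMap ∘ₗ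
      TensorProduct.map LinearMap.id (chainCounit L) ∘ₗ braid (Chains L) (Chains L) =
      (TensorProduct.lid ℚ (Chains L)).toLinearMap ∘ₗ
      TensorProduct.map (chainCounit L) LinearMap.id := by
    refine tensor_ext_deg fun p q x hx y hy => ?_
    simp only [LinearMap.comp_apply, braid_tmul hx hy, map_smul, TensorProduct.map_tmul,
      LinearMap.id_apply, LinearEquiv.coe_coe, TensorProduct.rid_tmul, TensorProduct.lid_tmul,
      smul_smul]
    rw [mul_comm p q, chainCounit_smul_zpow p q hx]
  have h2 := comul_counit_left (L := L)
  rw [← LinearMap.comp_assoc, ← h1, LinearMap.comp_assoc, LinearMap.comp_assoc,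
    GSym.comul_cocomm] at h2
  exact h2

/-- The differential as a map `z ⊗ w ↦ s q(z) ∧ w` evaluated on the coproduct. -/
def chainDPre (L : Type*) [AddCommGroup L] [Module ℚ L] [DGLie L] :
    Chains L ⊗[ℚ] Chains L →ₗ[ℚ] Chains L :=
  LinearMap.mul' ℚ (Chains L) ∘ₗ TensorProduct.map (chainS L ∘ₗ chainQ L) LinearMap.id

theorem chainDPre_mem : chainDPre L ∈ homDeg (Chains L ⊗[ℚ] Chains L) (Chains L) (-1) :=
  comp_mem GSym.mul_mem (map_mem (comp_mem (chainS_mem L) (chainQ_mem L) rfl) id_mem rfl) rfl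

theorem chainD_eq : chainD L = chainDPre L ∘ₗ GSym.comul (Susp L) := rfl

theorem chainDPre_tmul (z w : Chains L) :
    chainDPre L (z ⊗ₜ w) = GSym.ι (Susp L) (susp L (chainQ L z)) * w := rfl

/-- The element `s q(z)` is a generator, so the coproduct of `s q(z) ∧ w` is `Δ w` multiplied by `s
q(z) ⊗ 1 + 1 ⊗ s q(z)`. In the second summand `z` has to pass the first factor of `Δ w`, which is
the braiding on the right-hand side. -/
theorem comul_chainDPre : GSym.comul (Susp L) ∘ₗ chainDPre L =
    (TensorProduct.map (chainDPre L) LinearMap.id +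
      homTensor _ _ _ _ LinearMap.id (chainDPre L) ∘ₗ
        (TensorProduct.assoc ℚ (Chains L) (Chains L) (Chains L)).toLinearMap ∘ₗ
        TensorProduct.map (braid (Chains L) (Chains L)) LinearMap.id) ∘ₗ
      (TensorProduct.assoc ℚ (Chains L) (Chains L) (Chains L)).symm.toLinearMap ∘ₗ
      TensorProduct.map LinearMap.id (GSym.comul (Susp L)) := by
  refine tensor_ext_deg fun p q z hz w hw => ?_
  have hq : susp L (chainQ L z) ∈ deg (Susp L) (p - 1) :=
    homDeg_apply (n := 1) (fun _ _ h => susp_mem h) (chainQ_mem L _ _ hz) (by ring)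
  simp only [LinearMap.comp_apply, chainDPre_tmul, GSym.comul_ι_mul, TensorProduct.map_tmul,
    LinearMap.id_apply, LinearEquiv.coe_coe]
  generalize GSym.comul (Susp L) w = t
  have key : GSym.primitive (Susp L) (susp L (chainQ L z)) =
      (TensorProduct.map (chainDPre L) LinearMap.id +
      homTensor _ _ _ _ LinearMap.id (chainDPre L) ∘ₗ
        (TensorProduct.assoc ℚ (Chains L) (Chains L) (Chains L)).toLinearMap ∘ₗ
        TensorProduct.map (braid (Chains L) (Chains L)) LinearMap.id) ∘ₗ
      (TensorProduct.assoc ℚ (Chains L) (Chains L) (Chains L)).symm.toLinearMap ∘ₗ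
      TensorProduct.mk ℚ (Chains L) (Chains L ⊗[ℚ] Chains L) z := by
    refine tensor_ext_deg_left fun r x hx y => ?_
    rw [GSym.primitive_apply hq y hx]
    simp only [LinearMap.comp_apply, LinearMap.add_apply, TensorProduct.mk_apply,
      LinearEquiv.coe_coe, TensorProduct.assoc_symm_tmul, TensorProduct.map_tmul,
      braid_tmul hz hx, ← TensorProduct.smul_tmul', map_smul, TensorProduct.assoc_tmul,
      homTensor_apply _ _ chainDPre_mem hx, LinearMap.id_apply, chainDPre_tmul, smul_smul,
      ← sign_add]
    congr 2
    exact sign_congr 0 (by ring)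
  exact LinearMap.congr_fun key t

/-- The differential of the chain coalgebra is a coderivation. -/
theorem comul_chainD :
    GSym.comul (Susp L) ∘ₗ chainD L = tensorD (chainD L) (chainD L) ∘ₗ GSym.comul (Susp L) := by
  have hco := GSym.comul_coassoc (V := Susp L)
  have hco' : (TensorProduct.assoc ℚ (Chains L) (Chains L) (Chains L)).symm.toLinearMap ∘ₗ
      TensorProduct.map LinearMap.id (GSym.comul (Susp L)) ∘ₗ GSym.comul (Susp L) =
      TensorProduct.map (GSym.comul (Susp L)) LinearMap.id ∘ₗ GSym.comul (Susp L) := by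
    rw [← hco]; ext; simp
  -- Cocommutativity removes the braiding: the two factors it exchanges are themselves the coproduct
  -- of one element. What remains is coassociativity.
  have hbr : TensorProduct.map (braid (Chains L) (Chains L)) (LinearMap.id (M := Chains L)) ∘ₗ
      TensorProduct.map (GSym.comul (Susp L)) LinearMap.id =
      TensorProduct.map (GSym.comul (Susp L)) LinearMap.id := by
    rw [← TensorProduct.map_comp, GSym.comul_cocomm, LinearMap.id_comp]
  rw [tensorD_eq (chainD_mem L), homTensor_eq_map id_mem]
  refine LinearMap.ext fun c => ?_
  have h1 := LinearMap.congr_fun comul_chainDPre (GSym.comul (Susp L) c)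
  have hco := LinearMap.congr_fun hco c
  have hco' := LinearMap.congr_fun hco' c
  have hbr := LinearMap.congr_fun hbr (GSym.comul (Susp L) c)
  simp only [LinearMap.comp_apply, LinearMap.add_apply] at h1 hco hco' hbr
  rw [hco', hbr, hco, ← homTensor_eq_map GSym.comul_mem] at h1
  have h2 := LinearMap.congr_fun (homTensor_comp (LinearMap.id (M := Chains L)) (id_mem)
    (GSym.comul_mem (V := Susp L)) (chainDPre_mem (L := L))) (GSym.comul (Susp L) c)
  have h3 := LinearMap.congr_fun (TensorProduct.map_comp (chainDPre L) (LinearMap.id (M := Chains L))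
    (GSym.comul (Susp L)) LinearMap.id) (GSym.comul (Susp L) c)
  simp only [LinearMap.comp_apply, mul_zero, zpow_zero, one_smul, LinearMap.id_comp] at h2 h3
  simp only [LinearMap.comp_apply, LinearMap.add_apply, chainD_eq, h1, h2, h3]

theorem chainCounit_chainD : chainCounit L ∘ₗ chainD L = 0 := by
  have : chainCounit L ∘ₗ chainDPre L = 0 :=
    TensorProduct.ext' fun z w => by simp [chainDPre_tmul, chainCounit_ι_mul]
  rw [chainD_eq, ← LinearMap.comp_assoc, this, LinearMap.zero_comp]

/-- The projection `τ` sees only words of length one, so of the summands `s q(c') ∧ c''` only those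
with scalar `c''` count, and the right counit law sums them to `q(c)`. -/
theorem chainTau_chainD : chainTau L ∘ₗ chainD L = chainQ L := by
  have : chainTau L ∘ₗ chainDPre L = chainQ L ∘ₗ (TensorProduct.rid ℚ (Chains L)).toLinearMap ∘ₗ
      TensorProduct.map LinearMap.id (chainCounit L) :=
    TensorProduct.ext' fun z w => by simp [chainDPre_tmul, chainTau_ι_mul]
  rw [chainD_eq, ← LinearMap.comp_assoc, this, LinearMap.comp_assoc, LinearMap.comp_assoc,
    comul_counit_right, LinearMap.comp_id]

variable {N : Type*} [AddCommGroup N] [Module ℚ N] [GradedSpace N] [DGRep L N]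

/-- `z ⊗ w ↦ (-1)^{|z|} τ(z) · (τ(w) · n)`. -/
def tauTauAct (L : Type*) [AddCommGroup L] [Module ℚ L] [DGLie L]
    {N : Type*} [AddCommGroup N] [Module ℚ N] [GradedSpace N] [DGRep L N] (n : N) :
    Chains L ⊗[ℚ] Chains L →ₗ[ℚ] N :=
  DGRep.act ∘ₗ TensorProduct.map (chainTau L ∘ₗ sgn (Chains L))
    (DGRep.act ∘ₗ (TensorProduct.mk ℚ L N).flip n ∘ₗ chainTau L)

theorem tauTauAct_tmul {p : ℤ} {z : Chains L} (hz : z ∈ deg (Chains L) p) (w : Chains L) (n : N) :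
    tauTauAct L n (z ⊗ₜ w) = (-1 : ℚ) ^ p •
      DGRep.act (L := L) (chainTau L z ⊗ₜ DGRep.act (L := L) (chainTau L w ⊗ₜ[ℚ] n)) := by
  simp [tauTauAct, sgn_of_mem hz, ← TensorProduct.smul_tmul']

/-- The Maurer–Cartan equation of `τ`, applied to an element of a module. -/
theorem maurer_cartan (c : Chains L) (n : N) :
    DGRep.act (L := L) (chainQ L c ⊗ₜ[ℚ] n) + DGRep.act (L := L) (DGLie.d (chainTau L c) ⊗ₜ[ℚ] n) =
      tauTauAct L n (GSym.comul (Susp L) c) := by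
  have key : DGRep.act (L := L) (N := N) ∘ₗ (TensorProduct.mk ℚ L N).flip n ∘ₗ
      (chainQ L + DGLie.d ∘ₗ chainTau L) = tauTauAct L n ∘ₗ GSym.comul (Susp L) := by
    refine GSym.hom_ext_word ?_ fun p k x hx w hw _ => ?_
    · simp [GSym.comul_one, chainQ_one, chainTau_one, tauTauAct]
    · have hx' : (susp L).symm x ∈ deg L (p - 1) := hx
      have hw' : chainTau L w ∈ deg L (k - 1) := chainTau_mem L k w hw
      simp only [LinearMap.comp_apply, LinearMap.add_apply, GSym.comul_ι_mul, chainQ_ι_mul,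
        chainTau_ι_mul, map_smul, LinearMap.flip_apply, TensorProduct.mk_apply, sgn_of_mem hx',
        LinearMap.smul_apply]
      -- As `τ` vanishes off words of length one, a new letter `x` in one tensor factor forces the
      -- rest of that factor to be scalar; this gives one term for each factor. The weight operator
      -- with parameter `(-1)^(p+1)` encodes the sign `(-1)^((p+1)r)` on degree `r`, so that each
      -- term is a linear operator to which a counit law applies.
      have e : tauTauAct L n ∘ₗ GSym.primitive (Susp L) x =
          (-1 : ℚ) ^ p • (DGRep.act (L := L) ∘ₗ TensorProduct.mk ℚ L N ((susp L).symm x) ∘ₗ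
            DGRep.act (L := L) ∘ₗ (TensorProduct.mk ℚ L N).flip n ∘ₗ chainTau L ∘ₗ
            (TensorProduct.lid ℚ (Chains L)).toLinearMap ∘ₗ
              TensorProduct.map (chainCounit L) LinearMap.id) +
          (DGRep.act (L := L) ∘ₗ
            (TensorProduct.mk ℚ L N).flip (DGRep.act (L := L) ((susp L).symm x ⊗ₜ n)) ∘ₗ chainTau L ∘ₗ
              (GradedSpace.wt (((-1) ^ (p + 1) : ℚˣ))) ∘ₗ
            (TensorProduct.rid ℚ (Chains L)).toLinearMap ∘ₗ
              TensorProduct.map LinearMap.id (chainCounit L)) := by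
        refine tensor_ext_deg_left fun r z hz v => ?_
        have hxz := homDeg_apply (GSym.mulι_mem hx) hz rfl
        have hxz : GSym.ι (Susp L) x * z ∈ deg (Chains L) (r + p) := hxz
        have e0 : ((((-1) ^ (p + 1) : ℚˣ) : ℚ)) ^ r = (-1) ^ (p * r) * (-1) ^ r := by
          rw [← sign_add]; push_cast; rw [← zpow_mul]; congr 1; ring
        simp only [LinearMap.comp_apply, GSym.primitive_apply hx v hz, map_add, map_smul,
          tauTauAct_tmul hz, tauTauAct_tmul hxz, LinearMap.add_apply, LinearMap.smul_apply,
          TensorProduct.map_tmul, LinearEquiv.coe_coe, TensorProduct.lid_tmul, LinearMap.id_apply,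
          TensorProduct.rid_tmul, chainTau_ι_mul, TensorProduct.mk_apply, LinearMap.flip_apply,
          GradedSpace.wt_of_mem _ r z hz, e0, TensorProduct.tmul_smul, ← TensorProduct.smul_tmul',
          smul_smul]
        have := chainCounit_smul_zpow r 1 hz
        rw [one_mul] at this
        congr 2
        · rw [sign_add, mul_comm ((-1 : ℚ) ^ r), mul_assoc, this]
        · ring
      have e := LinearMap.congr_fun e (GSym.comul (Susp L) w)
      have c1 := LinearMap.congr_fun (comul_counit_left (L := L)) w
      have c2 := LinearMap.congr_fun (comul_counit_right (L := L)) w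
      simp only [LinearMap.comp_apply, LinearMap.add_apply, LinearMap.smul_apply,
        LinearMap.id_apply] at e c1 c2
      have e0 : ((((-1) ^ (p + 1) : ℚˣ) : ℚ)) ^ k = (-1) ^ (p * k) * (-1) ^ k := by
        rw [← sign_add]; push_cast; rw [← zpow_mul]; congr 1; ring
      rw [e, c1, c2, GradedSpace.wt_of_mem _ k w hw, e0]
      simp only [TensorProduct.add_tmul, TensorProduct.sub_tmul, TensorProduct.neg_tmul,
        ← TensorProduct.smul_tmul', map_add, map_sub, map_neg, map_smul, LinearMap.flip_apply,
        TensorProduct.mk_apply, DGRep.br_act _ _ _ _ n hx' hw', smul_sub, smul_smul, ← sign_add]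
      rw [sign_congr (a := p - 1) (b := p + 1) (-1) (by ring),
        sign_congr (a := p - 1 + (p - 1) * (k - 1)) (b := p * k + k) (-k) (by ring), sign_add p 1]
      module
  have := LinearMap.congr_fun key c
  simpa [TensorProduct.add_tmul] using this

end ChainCoalgebra


/-! ### Cochains as operators on chains -/

section Coextension
variable (L : Type*) [AddCommGroup L] [Module ℚ L] [DGLie L]
variable (N : Type*) [AddCommGroup N] [Module ℚ N] [GradedSpace N]
variable (M : Type*) [AddCommGroup M] [Module ℚ M] [GradedSpace M]

/-- The comodule map `c ↦ ∑ (-1)^{|f||c'|} c' ⊗ f(c'')` with corestriction `f`. -/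
def coextLin : (Chains L →ₗ[ℚ] N) →ₗ[ℚ] (Chains L →ₗ[ℚ] Chains L ⊗[ℚ] N) :=
  LinearMap.lcomp ℚ (Chains L ⊗[ℚ] N) (GSym.comul (Susp L)) ∘ₗ
    homTensor (Chains L) (Chains L) (Chains L) N LinearMap.id

variable {L N} in
theorem coextLin_eq (f : Chains L →ₗ[ℚ] N) : coextLin L N f =
    homTensor (Chains L) (Chains L) (Chains L) N LinearMap.id f ∘ₗ GSym.comul (Susp L) := rfl

/-- The operator `C_*(L) → C_*(L; N)` of a cochain. -/
def coext : Cochains L N →ₗ[ℚ] (Chains L →ₗ[ℚ] Chains L ⊗[ℚ] N) := coextLin L N ∘ₗ GHom.val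

/-- The operator `C_*(L) → C_*(L)` of a cochain with rational values. -/
def algOp : Alg L →ₗ[ℚ] (Chains L →ₗ[ℚ] Chains L) :=
  LinearMap.llcomp ℚ (Chains L) (Chains L ⊗[ℚ] ℚ) (Chains L)
    (TensorProduct.rid ℚ (Chains L)).toLinearMap ∘ₗ coext L ℚ

variable {L N M}

theorem algOp_eq (a : Alg L) :
    algOp L a = (TensorProduct.rid ℚ (Chains L)).toLinearMap ∘ₗ coext L ℚ a := rfl

theorem coext_eq (f : Cochains L N) : coext L N f = coextLin L N f.val := rfl

theorem coextLin_mem {n : ℤ} {f : Chains L →ₗ[ℚ] N} (hf : f ∈ homDeg (Chains L) N n) :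
    coextLin L N f ∈ homDeg (Chains L) (Chains L ⊗[ℚ] N) n :=
  comp_mem (homTensor_mem id_mem hf (zero_add n)) GSym.comul_mem (zero_add n)

theorem coext_mem {n : ℤ} {f : Cochains L N} (hf : f ∈ deg (Cochains L N) n) :
    coext L N f ∈ homDeg (Chains L) (Chains L ⊗[ℚ] N) n := coextLin_mem hf

theorem algOp_mem {n : ℤ} {a : Alg L} (ha : a ∈ deg (Alg L) n) :
    algOp L a ∈ homDeg (Chains L) (Chains L) n :=
  comp_mem (rid_mem _) (coext_mem ha) (add_zero n)

theorem cap_eq (m : ℕ) (u : Chains L) (f : Cochains L N) :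
    cap L N m u f = (-1 : ℚ) ^ m • coext L N f u := rfl

/-- A cochain is the corestriction of its operator. -/
theorem counit_coext (f : Cochains L N) :
    (TensorProduct.lid ℚ N).toLinearMap ∘ₗ TensorProduct.map (chainCounit L) LinearMap.id ∘ₗ
      coext L N f = f.val := by
  induction f using deg_induction with
  | h0 => simp
  | hadd a b ha hb => simp only [map_add, LinearMap.comp_add, ha, hb]
  | h n f hf =>
    have hf' : f.val ∈ homDeg _ _ n := hf
    have : (TensorProduct.lid ℚ N).toLinearMap ∘ₗ TensorProduct.map (chainCounit L) LinearMap.id ∘ₗ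
        homTensor (Chains L) (Chains L) (Chains L) N LinearMap.id f.val =
        f.val ∘ₗ (TensorProduct.lid ℚ (Chains L)).toLinearMap ∘ₗ
          TensorProduct.map (chainCounit L) LinearMap.id := by
      refine tensor_ext_deg_left fun p x hx y => ?_
      simp [homTensor_apply _ _ hf' hx, smul_smul, chainCounit_smul_zpow p n hx]
    rw [coext_eq, coextLin_eq, ← LinearMap.comp_assoc, ← LinearMap.comp_assoc,
      LinearMap.comp_assoc _ _ (TensorProduct.lid ℚ N).toLinearMap, this, LinearMap.comp_assoc,
      LinearMap.comp_assoc, comul_counit_left, LinearMap.comp_id]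

theorem counit_algOp (a : Alg L) : chainCounit L ∘ₗ algOp L a = a.val := by
  rw [← counit_coext a, algOp_eq, ← LinearMap.comp_assoc, ← LinearMap.comp_assoc]
  congr 1
  ext x
  simp

/-- Identities between cochains are proved by comparing their operators. -/
theorem coext_injective : Function.Injective (coext L N) := fun f g h =>
  GHom.ext (by rw [← counit_coext f, ← counit_coext g, h])

theorem algOp_injective : Function.Injective (algOp L) := fun f g h =>
  GHom.ext (by rw [← counit_algOp f, ← counit_algOp g, h])

theorem cup_val (f : Cochains L M) (g : Cochains L N) : (cup L N M (f ⊗ₜ g)).val =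
    homTensor (Chains L) (Chains L) M N f.val g.val ∘ₗ GSym.comul (Susp L) := rfl

/-- Coassociativity: the left side applies `1 ⊗ f ⊗ a` to `(1 ⊗ Δ)Δ`, the right side applies it to
`(Δ ⊗ 1)Δ`. -/
theorem coextLin_cupRight {n k : ℤ} {f : Chains L →ₗ[ℚ] N} {a : Chains L →ₗ[ℚ] ℚ}
    (hf : f ∈ homDeg (Chains L) N n) (ha : a ∈ homDeg (Chains L) ℚ k) :
    coextLin L N ((TensorProduct.rid ℚ N).toLinearMap ∘ₗ
      homTensor (Chains L) (Chains L) N ℚ f a ∘ₗ GSym.comul (Susp L)) =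
    coextLin L N f ∘ₗ (TensorProduct.rid ℚ (Chains L)).toLinearMap ∘ₗ coextLin L ℚ a := by
  have h1 : coextLin L N f ∘ₗ (TensorProduct.rid ℚ (Chains L)).toLinearMap ∘ₗ
      homTensor (Chains L) (Chains L) (Chains L) ℚ LinearMap.id a =
      (TensorProduct.rid ℚ (Chains L ⊗[ℚ] N)).toLinearMap ∘ₗ
        homTensor (Chains L ⊗[ℚ] Chains L) (Chains L) (Chains L ⊗[ℚ] N) ℚ
          (homTensor (Chains L) (Chains L) (Chains L) N LinearMap.id f) a ∘ₗ
        TensorProduct.map (GSym.comul (Susp L)) LinearMap.id := by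
    refine tensor_ext_deg_left fun p z hz w => ?_
    have hz' : GSym.comul (Susp L) z ∈ deg (Chains L ⊗[ℚ] Chains L) p :=
      homDeg_apply GSym.comul_mem hz (add_zero p)
    simp [homTensor_apply _ _ ha hz, homTensor_apply _ _ ha hz', coextLin_eq]
  have h2 : homTensor (Chains L) (Chains L) (Chains L) N LinearMap.id
      ((TensorProduct.rid ℚ N).toLinearMap ∘ₗ
        homTensor (Chains L) (Chains L) N ℚ f a ∘ₗ GSym.comul (Susp L)) =
      homTensor (Chains L) (Chains L ⊗[ℚ] Chains L) (Chains L) N LinearMap.id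
        ((TensorProduct.rid ℚ N).toLinearMap ∘ₗ homTensor (Chains L) (Chains L) N ℚ f a) ∘ₗ
      TensorProduct.map LinearMap.id (GSym.comul (Susp L)) := by
    have hfa : (TensorProduct.rid ℚ N).toLinearMap ∘ₗ homTensor (Chains L) (Chains L) N ℚ f a ∈
        homDeg (Chains L ⊗[ℚ] Chains L) N (n + k) :=
      comp_mem (rid_mem N) (homTensor_mem hf ha rfl) (add_zero _)
    rw [← homTensor_eq_map GSym.comul_mem, homTensor_comp _ id_mem GSym.comul_mem hfa]
    simp [LinearMap.comp_assoc]
  have h3 : homTensor (Chains L) (Chains L ⊗[ℚ] Chains L) (Chains L) N LinearMap.id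
        ((TensorProduct.rid ℚ N).toLinearMap ∘ₗ homTensor (Chains L) (Chains L) N ℚ f a) ∘ₗ
        (TensorProduct.assoc ℚ (Chains L) (Chains L) (Chains L)).toLinearMap =
      (TensorProduct.rid ℚ (Chains L ⊗[ℚ] N)).toLinearMap ∘ₗ
        homTensor (Chains L ⊗[ℚ] Chains L) (Chains L) (Chains L ⊗[ℚ] N) ℚ
          (homTensor (Chains L) (Chains L) (Chains L) N LinearMap.id f) a := by
    have hfa : (TensorProduct.rid ℚ N).toLinearMap ∘ₗ homTensor (Chains L) (Chains L) N ℚ f a ∈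
        homDeg (Chains L ⊗[ℚ] Chains L) N (n + k) :=
      comp_mem (rid_mem N) (homTensor_mem hf ha rfl) (add_zero _)
    refine tensor3_ext_deg fun p q r x hx y hy z hz => ?_
    simp only [LinearMap.comp_apply, LinearEquiv.coe_coe, TensorProduct.assoc_tmul,
      homTensor_apply _ _ hfa hx, homTensor_apply _ _ ha hy, homTensor_apply _ _ hf hx,
      homTensor_apply _ _ ha (tmul_mem rfl hx hy), map_smul, TensorProduct.rid_tmul,
      LinearMap.id_apply, TensorProduct.tmul_smul, smul_smul]
    rw [mul_comm (a z), ← mul_assoc, ← mul_assoc, ← sign_add, ← sign_add]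
    congr 3; ring
  rw [coextLin_eq, h2, LinearMap.comp_assoc, ← GSym.comul_coassoc, ← LinearMap.comp_assoc, h3,
    LinearMap.comp_assoc, ← LinearMap.comp_assoc (GSym.comul (Susp L)), ← LinearMap.comp_assoc,
    ← h1]
  rfl

/-- Operators turn the right action of the cochain algebra into composition. -/
theorem coext_cupRight (f : Cochains L N) (a : Alg L) :
    coext L N (cupRight L N (f ⊗ₜ a)) = coext L N f ∘ₗ algOp L a := by
  induction f using deg_induction with
  | h0 => simp
  | hadd f g ha hb => simp only [TensorProduct.add_tmul, map_add, LinearMap.add_comp, ha, hb]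
  | h n f hf =>
    induction a using deg_induction with
    | h0 => simp
    | hadd a b ha hb => simp only [TensorProduct.tmul_add, map_add, LinearMap.comp_add, ha, hb]
    | h k a ha => exact coextLin_cupRight hf ha

theorem algOp_algMul (a b : Alg L) : algOp L (algMul L (a ⊗ₜ b)) = algOp L a ∘ₗ algOp L b := by
  rw [algOp_eq, coext_cupRight, algOp_eq]
  rfl

/-! ### Symmetry of the fourfold coproduct -/

section Diag

variable {V : Type*} [AddCommGroup V] [Module ℚ V] [GradedSpace V]

/-- The reassociation `x ⊗ ((y ⊗ z) ⊗ w) ↦ (x ⊗ y) ⊗ (z ⊗ w)`. -/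
def middleAssoc (X Y Z W : Type*) [AddCommGroup X] [Module ℚ X] [AddCommGroup Y] [Module ℚ Y]
    [AddCommGroup Z] [Module ℚ Z] [AddCommGroup W] [Module ℚ W] :
    X ⊗[ℚ] ((Y ⊗[ℚ] Z) ⊗[ℚ] W) →ₗ[ℚ] (X ⊗[ℚ] Y) ⊗[ℚ] (Z ⊗[ℚ] W) :=
  (TensorProduct.assoc ℚ X Y (Z ⊗[ℚ] W)).symm.toLinearMap ∘ₗ
    TensorProduct.map LinearMap.id (TensorProduct.assoc ℚ Y Z W).toLinearMap

theorem interchange_middleAssoc {X Y Z W : Type*} [AddCommGroup X] [Module ℚ X] [AddCommGroup Y]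
    [Module ℚ Y] [AddCommGroup Z] [Module ℚ Z] [AddCommGroup W] [Module ℚ W] [GradedSpace Y]
    [GradedSpace Z] :
    interchange X Y Z W ∘ₗ middleAssoc X Y Z W = middleAssoc X Z Y W ∘ₗ
      TensorProduct.map LinearMap.id (TensorProduct.map (braid Y Z) LinearMap.id) := by
  refine TensorProduct.ext' fun x v => ?_
  have key : ∀ w, interchange X Y Z W ∘ₗ middleAssoc X Y Z W ∘ₗ
      TensorProduct.mk ℚ X ((Y ⊗[ℚ] Z) ⊗[ℚ] W) x ∘ₗ (TensorProduct.mk ℚ (Y ⊗[ℚ] Z) W).flip w =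
      middleAssoc X Z Y W ∘ₗ
      TensorProduct.map LinearMap.id (TensorProduct.map (braid Y Z) LinearMap.id) ∘ₗ
      TensorProduct.mk ℚ X ((Y ⊗[ℚ] Z) ⊗[ℚ] W) x ∘ₗ
        (TensorProduct.mk ℚ (Y ⊗[ℚ] Z) W).flip w := fun w => by
    refine tensor_ext_deg fun p q y hy z hz => ?_
    simp [middleAssoc, interchange_tmul _ _ hy hz, braid_tmul hy hz,
      ← TensorProduct.smul_tmul', TensorProduct.tmul_smul]
  induction v using TensorProduct.induction_on with
  | zero => simp
  | add a b ha hb => simp only [TensorProduct.tmul_add, map_add, ha, hb]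
  | tmul t w => exact LinearMap.congr_fun (key w) t

/-- The fourfold coproduct is symmetric in the two middle factors. -/
theorem interchange_comul :
    interchange (GSym V) (GSym V) (GSym V) (GSym V) ∘ₗ
      TensorProduct.map (GSym.comul V) (GSym.comul V) ∘ₗ GSym.comul V =
    TensorProduct.map (GSym.comul V) (GSym.comul V) ∘ₗ GSym.comul V := by
  -- Bracketed in this way, the two middle factors of the fourfold coproduct are the coproduct of a
  -- single element, so cocommutativity applies to them.
  have h1 : TensorProduct.map (GSym.comul V) (GSym.comul V) ∘ₗ GSym.comul V =
      middleAssoc (GSym V) (GSym V) (GSym V) (GSym V) ∘ₗ TensorProduct.map LinearMap.id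
        (TensorProduct.map (GSym.comul V) LinearMap.id ∘ₗ GSym.comul V) ∘ₗ GSym.comul V := by
    have e1 : TensorProduct.map (GSym.comul V) (GSym.comul V) =
        TensorProduct.map LinearMap.id (GSym.comul V) ∘ₗ
          TensorProduct.map (GSym.comul V) LinearMap.id := by
      rw [← TensorProduct.map_comp]; simp
    have e2 : TensorProduct.map (GSym.comul V) LinearMap.id ∘ₗ GSym.comul V =
        (TensorProduct.assoc ℚ (GSym V) (GSym V) (GSym V)).symm.toLinearMap ∘ₗ
          TensorProduct.map LinearMap.id (GSym.comul V) ∘ₗ GSym.comul V := by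
      rw [← GSym.comul_coassoc]; ext; simp
    have e3 : TensorProduct.map LinearMap.id (GSym.comul V) ∘ₗ
        (TensorProduct.assoc ℚ (GSym V) (GSym V) (GSym V)).symm.toLinearMap =
        (TensorProduct.assoc ℚ (GSym V) (GSym V) (GSym V ⊗[ℚ] GSym V)).symm.toLinearMap ∘ₗ
          TensorProduct.map LinearMap.id (TensorProduct.map LinearMap.id (GSym.comul V)) := by
      refine TensorProduct.ext (LinearMap.ext fun x => TensorProduct.ext' fun y z => ?_)
      simp only [TensorProduct.mk_apply, LinearMap.comp_apply,
        LinearEquiv.coe_coe, TensorProduct.assoc_symm_tmul, TensorProduct.map_tmul,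
        LinearMap.id_apply, LinearMap.compr₂ₛₗ_apply]
    have e4 : TensorProduct.map (LinearMap.id (M := GSym V)) (TensorProduct.map LinearMap.id (GSym.comul V))
        ∘ₗ TensorProduct.map LinearMap.id (GSym.comul V) =
        TensorProduct.map LinearMap.id (TensorProduct.assoc ℚ (GSym V) (GSym V) (GSym V)).toLinearMap ∘ₗ
        TensorProduct.map LinearMap.id
          (TensorProduct.map (GSym.comul V) LinearMap.id ∘ₗ GSym.comul V) := by
      rw [← TensorProduct.map_comp, ← TensorProduct.map_comp, ← GSym.comul_coassoc]
    rw [e1, LinearMap.comp_assoc, e2, ← LinearMap.comp_assoc, e3, LinearMap.comp_assoc,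
      ← LinearMap.comp_assoc (GSym.comul V) _ (TensorProduct.map _ (TensorProduct.map _ _)), e4, ← e2]
    rfl
  have h3 : TensorProduct.map (LinearMap.id (M := GSym V))
      (TensorProduct.map (braid (GSym V) (GSym V)) LinearMap.id) ∘ₗ
      TensorProduct.map LinearMap.id
        (TensorProduct.map (GSym.comul V) LinearMap.id ∘ₗ GSym.comul V) =
      TensorProduct.map LinearMap.id
        (TensorProduct.map (GSym.comul V) LinearMap.id ∘ₗ GSym.comul V) := by
    rw [← TensorProduct.map_comp, ← LinearMap.comp_assoc, ← TensorProduct.map_comp,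
      GSym.comul_cocomm]
    rfl
  rw [h1, ← LinearMap.comp_assoc, interchange_middleAssoc, LinearMap.comp_assoc,
    ← LinearMap.comp_assoc _ _ (TensorProduct.map _ (TensorProduct.map _ _)), h3]

end Diag

variable (L M N) in
/-- The operator `C_*(L) ⊗ C_*(L) → C_*(L; M) ⊗ C_*(L; N)` of a tensor product of cochains. -/
def coext2 : Cochains L M ⊗[ℚ] Cochains L N →ₗ[ℚ]
    (Chains L ⊗[ℚ] Chains L →ₗ[ℚ] (Chains L ⊗[ℚ] M) ⊗[ℚ] (Chains L ⊗[ℚ] N)) :=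
  TensorProduct.lift ((homTensor (Chains L) (Chains L) (Chains L ⊗[ℚ] M)
    (Chains L ⊗[ℚ] N)).compl₁₂ (coext L M) (coext L N))

variable (L) in
/-- The operator `C_*(L) ⊗ C_*(L) → C_*(L) ⊗ C_*(L)` of an element of `C^*(L) ⊗ C^*(L)`. -/
def algOp2 : Alg2 L →ₗ[ℚ] (Chains L ⊗[ℚ] Chains L →ₗ[ℚ] Chains L ⊗[ℚ] Chains L) :=
  TensorProduct.lift ((homTensor (Chains L) (Chains L) (Chains L) (Chains L)).compl₁₂
    (algOp L) (algOp L))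

theorem coext2_tmul (f : Cochains L M) (g : Cochains L N) : coext2 L N M (f ⊗ₜ g) =
    homTensor (Chains L) (Chains L) (Chains L ⊗[ℚ] M) (Chains L ⊗[ℚ] N)
      (coext L M f) (coext L N g) := rfl

theorem algOp2_tmul (a b : Alg L) : algOp2 L (a ⊗ₜ b) =
    homTensor (Chains L) (Chains L) (Chains L) (Chains L) (algOp L a) (algOp L b) := rfl

/-- Both sides evaluate `f` and `g` on the fourfold coproduct, and they differ by an exchange of its
two middle factors. By `interchange_comul` this exchange has no effect. -/
theorem coextLin_cup {n k : ℤ} {f : Chains L →ₗ[ℚ] M} {g : Chains L →ₗ[ℚ] N}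
    (hf : f ∈ homDeg (Chains L) M n) (hg : g ∈ homDeg (Chains L) N k) :
    chainsDiag L N M ∘ₗ coextLin L (M ⊗[ℚ] N)
      (homTensor (Chains L) (Chains L) M N f g ∘ₗ GSym.comul (Susp L)) =
    homTensor (Chains L) (Chains L) (Chains L ⊗[ℚ] M) (Chains L ⊗[ℚ] N)
      (coextLin L M f) (coextLin L N g) ∘ₗ GSym.comul (Susp L) := by
  have hfg := homTensor_mem hf hg rfl
  have hc := GSym.comul_mem (V := Susp L)
  have h1 : TensorProduct.map (GSym.comul (Susp L)) LinearMap.id ∘ₗ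
      homTensor (Chains L) (Chains L) (Chains L) (M ⊗[ℚ] N) LinearMap.id
        (homTensor (Chains L) (Chains L) M N f g ∘ₗ GSym.comul (Susp L)) =
      homTensor (Chains L ⊗[ℚ] Chains L) (Chains L ⊗[ℚ] Chains L) (Chains L ⊗[ℚ] Chains L)
        (M ⊗[ℚ] N) LinearMap.id (homTensor (Chains L) (Chains L) M N f g) ∘ₗ
      TensorProduct.map (GSym.comul (Susp L)) (GSym.comul (Susp L)) := by
    rw [← homTensor_eq_map hc, ← homTensor_eq_map id_mem,
      homTensor_comp _ id_mem (comp_mem hfg hc (zero_add _)) id_mem, homTensor_comp _ hc hc hfg]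
    simp
  have h2 : interchange (Chains L) (Chains L) M N ∘ₗ
      homTensor (Chains L ⊗[ℚ] Chains L) (Chains L ⊗[ℚ] Chains L) (Chains L ⊗[ℚ] Chains L)
        (M ⊗[ℚ] N) LinearMap.id (homTensor (Chains L) (Chains L) M N f g) =
      homTensor (Chains L ⊗[ℚ] Chains L) (Chains L ⊗[ℚ] Chains L) (Chains L ⊗[ℚ] M)
        (Chains L ⊗[ℚ] N) (homTensor (Chains L) (Chains L) (Chains L) M LinearMap.id f)
          (homTensor (Chains L) (Chains L) (Chains L) N LinearMap.id g) ∘ₗ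
      interchange (Chains L) (Chains L) (Chains L) (Chains L) := by
    refine tensor4_ext_deg (X := Chains L) (Y := Chains L) (Z := Chains L) (X' := Chains L)
      (A := (Chains L ⊗[ℚ] M) ⊗[ℚ] (Chains L ⊗[ℚ] N)) ?_
    intro p q r s x hx y hy z hz w hw
    simp only [LinearMap.comp_apply,
      homTensor_apply _ _ hfg (tmul_mem rfl hx hy), homTensor_apply _ _ hg hz, map_smul,
      interchange_tmul _ _ hy hz, TensorProduct.tmul_smul, LinearMap.id_apply,
      interchange_tmul _ _ hy (hf r z hz),
      homTensor_apply _ _ (homTensor_mem (id_mem (X := Chains L)) hg rfl) (tmul_mem rfl hx hz),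
      homTensor_apply _ _ hf hx, homTensor_apply _ _ hg hy, ← TensorProduct.smul_tmul', smul_smul,
      ← sign_add]
    congr 1
    exact sign_congr (n * q) (by ring)
  rw [chainsDiag, coextLin_eq, LinearMap.comp_assoc,
    ← LinearMap.comp_assoc _ _ (TensorProduct.map _ _), h1, LinearMap.comp_assoc,
    ← LinearMap.comp_assoc, h2, LinearMap.comp_assoc, interchange_comul, ← LinearMap.comp_assoc,
    ← homTensor_eq_map hc]
  have h3 := homTensor_comp (homTensor (Chains L) (Chains L) (Chains L) M LinearMap.id f) hc hc
    (homTensor_mem (id_mem (X := Chains L)) hg (zero_add _))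
  rw [h3]
  simp [coextLin_eq]

/-- The diagonal map carries the operator of a cup product to the tensor product of operators. -/
theorem chainsDiag_coext_cup (ξ : Cochains L M ⊗[ℚ] Cochains L N) :
    chainsDiag L N M ∘ₗ coext L (M ⊗[ℚ] N) (cup L N M ξ) =
      coext2 L N M ξ ∘ₗ GSym.comul (Susp L) := by
  induction ξ using TensorProduct.induction_on with
  | zero => simp
  | add a b ha hb => simp only [map_add, LinearMap.comp_add, LinearMap.add_comp, ha, hb]
  | tmul f g =>
    induction f using deg_induction with
    | h0 => simp
    | hadd a b ha hb =>
      simp only [TensorProduct.add_tmul, map_add, LinearMap.comp_add, LinearMap.add_comp, ha, hb]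
    | h n f hf =>
      induction g using deg_induction with
      | h0 => simp
      | hadd a b ha hb =>
        simp only [TensorProduct.tmul_add, map_add, LinearMap.comp_add, LinearMap.add_comp, ha, hb]
      | h k g hg => exact coextLin_cup hf hg

end Coextension


/-! ### Constant cochains -/

section Constant
variable {L : Type*} [AddCommGroup L] [Module ℚ L] [DGLie L]
variable {N : Type*} [AddCommGroup N] [Module ℚ N] [GradedSpace N]

theorem toSpanSingleton_counit_mem (n : N) :
    LinearMap.toSpanSingleton ℚ N n ∘ₗ chainCounit L ∈ gHom (Chains L) N := by
  induction n using deg_induction with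
  | h0 => simp
  | hadd a b ha hb =>
    rw [LinearMap.toSpanSingleton_add, LinearMap.add_comp]; exact add_mem ha hb
  | h p n hn =>
    refine mem_gHom (n := p) fun k c hc => ?_
    by_cases hk : k = 0
    · subst hk
      simpa using Submodule.smul_mem _ _ hn
    · simp [chainCounit_of_mem hk hc]

variable (L N) in
/-- The cochain `c ↦ ε(c) n`. -/
def constCochain : N →ₗ[ℚ] Cochains L N where
  toFun n := GHom.mk (LinearMap.toSpanSingleton ℚ N n ∘ₗ chainCounit L)
    (toSpanSingleton_counit_mem n)
  map_add' a b := by ext; simp [LinearMap.toSpanSingleton_add]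
  map_smul' t a := by ext; simp [smul_comm t]

theorem constCochain_val (n : N) (c : Chains L) :
    (constCochain L N n).val c = chainCounit L c • n := rfl

theorem constCochain_mem {p : ℤ} {n : N} (hn : n ∈ deg N p) :
    constCochain L N n ∈ deg (Cochains L N) p := by
  refine Submodule.mem_comap.2 fun k c hc => ?_
  rw [constCochain_val]
  by_cases hk : k = 0
  · subst hk
    simpa using Submodule.smul_mem _ _ hn
  · simp [chainCounit_of_mem hk hc]

/-- The right counit law leaves `c ⊗ n`, and the sign comes from moving `n` past `c`. So operators
of constant cochains reach every element of `C_*(L;N)`, which makes constant cochains sufficient for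
testing maps out of that complex. -/
theorem coext_constCochain {p q : ℤ} {n : N} {c : Chains L} (hn : n ∈ deg N p)
    (hc : c ∈ deg (Chains L) q) :
    coext L N (constCochain L N n) c = (-1 : ℚ) ^ (p * q) • (c ⊗ₜ n) := by
  have h : homTensor (Chains L) (Chains L) (Chains L) N LinearMap.id (constCochain L N n).val =
      (TensorProduct.mk ℚ (Chains L) N).flip n ∘ₗ (GradedSpace.wt ((-1) ^ p)) ∘ₗ
        (TensorProduct.rid ℚ (Chains L)).toLinearMap ∘ₗ
        TensorProduct.map LinearMap.id (chainCounit L) := by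
    refine tensor_ext_deg_left fun k x hx y => ?_
    rw [homTensor_apply _ _ (constCochain_mem hn) hx, constCochain_val]
    simp only [LinearMap.comp_apply, TensorProduct.map_tmul, LinearMap.id_apply,
      LinearEquiv.coe_coe, TensorProduct.rid_tmul, map_smul, LinearMap.flip_apply,
      TensorProduct.mk_apply, GradedSpace.wt_of_mem _ k x hx, TensorProduct.tmul_smul, zpow_mul]
    rw [smul_comm]
    simp
  have h2 := LinearMap.congr_fun (comul_counit_right (L := L)) c
  simp only [LinearMap.comp_apply, LinearMap.id_apply] at h2
  rw [coext_eq, coextLin_eq, h]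
  simp only [LinearMap.comp_apply, h2]
  simp [GradedSpace.wt_of_mem _ q c hc, zpow_mul]

end Constant

/-! ### Differentials -/

section Differential
variable {L : Type*} [AddCommGroup L] [Module ℚ L] [DGLie L]
variable {N : Type*} [AddCommGroup N] [Module ℚ N] [GradedSpace N] [DGRep L N]
variable {M : Type*} [AddCommGroup M] [Module ℚ M] [GradedSpace M] [DGRep L M]

variable (L N) in
/-- The twisting term `c ⊗ n ↦ ∑ (-1)^{|c'|} c' ⊗ τ(c'') · n`. -/
def chainsTwist : Chains L ⊗[ℚ] N →ₗ[ℚ] Chains L ⊗[ℚ] N :=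
  TensorProduct.map LinearMap.id DGRep.act ∘ₗ
    (TensorProduct.assoc ℚ (Chains L) L N).toLinearMap ∘ₗ
    TensorProduct.map (chainSplit L) LinearMap.id

theorem chainsD_eq : chainsD L N = tensorD (chainD L) (DGRep.d L) - chainsTwist L N := rfl

theorem rightAct_tmul {p q : ℤ} {n : N} {x : L} (hn : n ∈ deg N p) (hx : x ∈ deg L q) :
    rightAct L N (n ⊗ₜ x) = -((-1 : ℚ) ^ (p * q) • DGRep.act (x ⊗ₜ[ℚ] n)) := by
  simp [rightAct, braid_tmul hn hx]

/-- The differential of the chain coalgebra is a coderivation: in the commutator the terms where it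
acts on the first factor of the coproduct cancel, and those where it acts inside `f` remain. -/
theorem coextLin_untwisted {n : ℤ} {f : Chains L →ₗ[ℚ] N} (hf : f ∈ homDeg (Chains L) N n) :
    coextLin L N (DGRep.d L ∘ₗ f - sgnHom (Chains L) N f ∘ₗ chainD L) =
      tensorD (chainD L) (DGRep.d L) ∘ₗ coextLin L N f -
        coextLin L N (sgnHom (Chains L) N f) ∘ₗ chainD L := by
  have h1 : DGRep.d L ∘ₗ f ∈ homDeg (Chains L) N (n - 1) := comp_mem DGRep.d_mem hf (by ring)
  have h2 : f ∘ₗ chainD L ∈ homDeg (Chains L) N (n - 1) := comp_mem hf (chainD_mem L) (by ring)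
  have key : homTensor (Chains L) (Chains L) (Chains L) N LinearMap.id
        (DGRep.d L ∘ₗ f - sgnHom (Chains L) N f ∘ₗ chainD L) =
      tensorD (chainD L) (DGRep.d L) ∘ₗ
        homTensor (Chains L) (Chains L) (Chains L) N LinearMap.id f -
      homTensor (Chains L) (Chains L) (Chains L) N LinearMap.id (sgnHom (Chains L) N f) ∘ₗ
        tensorD (chainD L) (chainD L) := by
    refine tensor_ext_deg fun p q x hx y hy => ?_
    have hdx : chainD L x ∈ deg (Chains L) (p - 1) := chainD_mem L p x hx
    simp only [sgnHom_of_mem hf, LinearMap.smul_comp, map_sub, map_smul, LinearMap.sub_apply,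
      LinearMap.smul_apply, LinearMap.comp_apply, homTensor_apply _ _ h1 hx,
      homTensor_apply _ _ h2 hx, homTensor_apply _ _ hf hx, tensorD_apply hx, map_add,
      homTensor_apply _ _ hf hdx, LinearMap.id_apply, smul_add, smul_smul, ← sign_add]
    rw [sign_congr (a := n + n * (p - 1)) (b := n * p) 0 (by ring),
      sign_congr (a := (n - 1) * p) (b := n * p + p) (-p) (by ring),
      sign_congr (a := n + (n - 1) * p) (b := n + p + n * p) (-p) (by ring)]
    simp only [sign_add]
    module
  rw [coextLin_eq, key, LinearMap.sub_comp, LinearMap.comp_assoc, LinearMap.comp_assoc,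
    ← comul_chainD]
  rfl

/-- On the threefold coproduct the left side is a sum of `± c' ⊗ f(c'') · τ(c''')`, the right side
of `± c' ⊗ τ(c'') · f(c''')`. Cocommutativity exchanges the last two factors, and the sign in the
definition of the right action makes the terms agree. -/
theorem coextLin_twist {n : ℤ} {f : Chains L →ₗ[ℚ] N} (hf : f ∈ homDeg (Chains L) N n) :
    coextLin L N (rightAct L N ∘ₗ TensorProduct.map (sgnHom (Chains L) N f) LinearMap.id ∘ₗ
      chainSplit L) = -(chainsTwist L N ∘ₗ coextLin L N f) := by
  let g : Chains L ⊗[ℚ] Chains L →ₗ[ℚ] N := rightAct L N ∘ₗ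
    TensorProduct.map (sgnHom (Chains L) N f) LinearMap.id ∘ₗ
    TensorProduct.map (sgn (Chains L)) (chainTau L)
  have hg : g ∈ homDeg (Chains L ⊗[ℚ] Chains L) N (n - 1) :=
    comp_mem (rightAct_mem L N) (comp_mem (map_mem (wtHom_mem_homDeg _ hf) id_mem rfl)
      (map_mem sgn_mem_homDeg (chainTau_mem L) rfl) rfl) (by ring)
  have h1 : homTensor (Chains L) (Chains L) (Chains L) N LinearMap.id
      (g ∘ₗ GSym.comul (Susp L)) =
      homTensor (Chains L) (Chains L ⊗[ℚ] Chains L) (Chains L) N LinearMap.id g ∘ₗ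
        TensorProduct.map LinearMap.id (GSym.comul (Susp L)) := by
    rw [← homTensor_eq_map GSym.comul_mem, homTensor_comp _ id_mem GSym.comul_mem hg]
    simp
  have h2 : TensorProduct.map (GSym.comul (Susp L)) LinearMap.id ∘ₗ
      homTensor (Chains L) (Chains L) (Chains L) N LinearMap.id f =
      homTensor (Chains L ⊗[ℚ] Chains L) (Chains L) (Chains L ⊗[ℚ] Chains L) N LinearMap.id f ∘ₗ
        TensorProduct.map (GSym.comul (Susp L)) LinearMap.id := by
    rw [← homTensor_eq_map id_mem, ← homTensor_eq_map id_mem, homTensor_comp _ id_mem hf id_mem,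
      homTensor_comp _ GSym.comul_mem id_mem hf]
    simp
  have h3 : homTensor (Chains L) (Chains L ⊗[ℚ] Chains L) (Chains L) N LinearMap.id g ∘ₗ
      TensorProduct.map LinearMap.id (braid (Chains L) (Chains L)) ∘ₗ
      (TensorProduct.assoc ℚ (Chains L) (Chains L) (Chains L)).toLinearMap =
      -(TensorProduct.map LinearMap.id DGRep.act ∘ₗ
        (TensorProduct.assoc ℚ (Chains L) L N).toLinearMap ∘ₗ
        TensorProduct.map (TensorProduct.map (sgn (Chains L)) (chainTau L)) LinearMap.id ∘ₗ
        homTensor (Chains L ⊗[ℚ] Chains L) (Chains L) (Chains L ⊗[ℚ] Chains L) N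
          LinearMap.id f) := by
    refine tensor3_ext_deg fun p q r x hx y hy z hz => ?_
    have hgz : g (z ⊗ₜ y) = -((-1 : ℚ) ^ (n + r + (n + r) * (q - 1)) •
        DGRep.act (chainTau L y ⊗ₜ[ℚ] f z)) := by
      have hfz : f z ∈ deg N (n + r) := homDeg_apply hf hz (add_comm _ _)
      simp only [g, LinearMap.comp_apply, TensorProduct.map_tmul, LinearMap.id_apply,
        sgn_of_mem hz, sgnHom_of_mem hf, LinearMap.smul_apply, map_smul, smul_smul, ← sign_add,
        ← TensorProduct.smul_tmul', rightAct_tmul hfz (chainTau_mem L q y hy)]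
      rw [smul_neg, smul_smul, ← sign_add]
      congr 2
      exact sign_congr 0 (by ring)
    simp only [LinearMap.comp_apply, LinearEquiv.coe_coe, TensorProduct.assoc_tmul,
      TensorProduct.map_tmul, LinearMap.id_apply, braid_tmul hy hz, TensorProduct.tmul_smul,
      map_smul, homTensor_apply _ _ hg hx, hgz, LinearMap.neg_apply,
      homTensor_apply _ _ hf (tmul_mem rfl hx hy), sgn_of_mem hx, ← TensorProduct.smul_tmul',
      TensorProduct.tmul_neg, smul_neg, smul_smul, ← sign_add]
    congr 2
    exact sign_congr (q * r - p) (by ring)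
  have h4 : g ∘ₗ GSym.comul (Susp L) = rightAct L N ∘ₗ
      TensorProduct.map (sgnHom (Chains L) N f) LinearMap.id ∘ₗ chainSplit L := rfl
  have h5 : TensorProduct.map LinearMap.id (GSym.comul (Susp L)) ∘ₗ GSym.comul (Susp L) =
      TensorProduct.map LinearMap.id (braid (Chains L) (Chains L)) ∘ₗ
      (TensorProduct.assoc ℚ (Chains L) (Chains L) (Chains L)).toLinearMap ∘ₗ
      TensorProduct.map (GSym.comul (Susp L)) LinearMap.id ∘ₗ GSym.comul (Susp L) := by
    rw [GSym.comul_coassoc, ← LinearMap.comp_assoc, ← TensorProduct.map_comp, GSym.comul_cocomm]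
    rfl
  refine LinearMap.ext fun c => ?_
  have h5 := LinearMap.congr_fun h5 c
  have h3 := LinearMap.congr_fun h3 (TensorProduct.map (GSym.comul (Susp L)) LinearMap.id
    (GSym.comul (Susp L) c))
  have h2 := LinearMap.congr_fun h2 (GSym.comul (Susp L) c)
  have h6 : TensorProduct.map (chainSplit L) (LinearMap.id (M := N)) =
      TensorProduct.map (TensorProduct.map (sgn (Chains L)) (chainTau L)) LinearMap.id ∘ₗ
        TensorProduct.map (GSym.comul (Susp L)) LinearMap.id := by
    rw [← TensorProduct.map_comp]; rfl
  rw [← h4, coextLin_eq, h1, chainsTwist, h6, coextLin_eq]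
  simp only [LinearMap.comp_apply, LinearMap.neg_apply] at h5 h3 h2 ⊢
  rw [h5, h3, h2]

theorem coextLin_cochainsDAux {n : ℤ} {f : Chains L →ₗ[ℚ] N} (hf : f ∈ homDeg (Chains L) N n) :
    coextLin L N (cochainsDAux L N f) =
      chainsD L N ∘ₗ coextLin L N f - coextLin L N (sgnHom (Chains L) N f) ∘ₗ chainD L := by
  have : cochainsDAux L N f = (DGRep.d L ∘ₗ f - sgnHom (Chains L) N f ∘ₗ chainD L) +
    rightAct L N ∘ₗ TensorProduct.map (sgnHom (Chains L) N f) LinearMap.id ∘ₗ chainSplit L := rfl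
  rw [this, map_add, coextLin_untwisted hf, coextLin_twist hf, chainsD_eq, LinearMap.sub_comp]
  abel

/-- The operator of `D f` is the graded commutator of the differentials with that of `f`. -/
theorem coext_cochainsD (f : Cochains L N) : coext L N (cochainsD L N f) =
    chainsD L N ∘ₗ coext L N f - coext L N (sgn (Cochains L N) f) ∘ₗ chainD L := by
  induction f using deg_induction with
  | h0 =>
    simp only [map_zero, LinearMap.comp_zero, LinearMap.zero_comp]
    exact (sub_zero (0 : Chains L →ₗ[ℚ] Chains L ⊗[ℚ] N)).symm
  | hadd a b ha hb =>
    simp only [map_add, LinearMap.comp_add, LinearMap.add_comp, ha, hb]; abel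
  | h n f hf => exact coextLin_cochainsDAux hf

theorem chainsD_rid : (TensorProduct.rid ℚ (Chains L)).toLinearMap ∘ₗ chainsD L ℚ =
    chainD L ∘ₗ (TensorProduct.rid ℚ (Chains L)).toLinearMap := by
  have h : chainsTwist L ℚ = 0 := by
    have : (DGRep.act : L ⊗[ℚ] ℚ →ₗ[ℚ] ℚ) = 0 := rfl
    rw [chainsTwist, this, TensorProduct.map_zero_right, LinearMap.zero_comp]
  have hd : (DGRep.d L : ℚ →ₗ[ℚ] ℚ) = 0 := rfl
  have h' : chainsD L ℚ = tensorD (chainD L) (DGRep.d L) := by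
    rw [chainsD_eq, h]
    exact sub_zero (tensorD (chainD L) (DGRep.d L) : Chains L ⊗[ℚ] ℚ →ₗ[ℚ] Chains L ⊗[ℚ] ℚ)
  rw [h']
  refine TensorProduct.ext' fun c t => ?_
  simp [tensorD, hd]

theorem algOp_cochainsD (a : Alg L) : algOp L (cochainsD L ℚ a) =
    chainD L ∘ₗ algOp L a - algOp L (sgn (Alg L) a) ∘ₗ chainD L := by
  rw [algOp_eq, coext_cochainsD, LinearMap.comp_sub, ← LinearMap.comp_assoc, chainsD_rid]
  rfl

/-- The term with `f ∘ d` vanishes because `ε ∘ d = 0`, and the left counit law reduces the twisting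
term to `τ(c)`. That term is what later forces a filtration: where it is nonzero and `L` is
positively graded, its value has larger degree than `n`. -/
theorem cochainsD_constCochain {p : ℤ} {n : N} (hn : n ∈ deg N p) (c : Chains L) :
    (cochainsD L N (constCochain L N n)).val c = chainCounit L c • DGRep.d L n +
      (-1 : ℚ) ^ p • rightAct L N (n ⊗ₜ chainTau L c) := by
  have h0 : (cochainsD L N (constCochain L N n)).val c =
    DGRep.d L ((constCochain L N n).val c) -
      sgnHom (Chains L) N (constCochain L N n).val (chainD L c) +
      rightAct L N (TensorProduct.map (sgnHom (Chains L) N (constCochain L N n).val) LinearMap.id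
        (chainSplit L c)) := rfl
  have h1 := LinearMap.congr_fun (chainCounit_chainD (L := L)) c
  have h2 : TensorProduct.map (constCochain L N n).val (LinearMap.id (M := L)) ∘ₗ
      TensorProduct.map (sgn (Chains L)) (chainTau L) =
      TensorProduct.mk ℚ N L n ∘ₗ chainTau L ∘ₗ (TensorProduct.lid ℚ (Chains L)).toLinearMap ∘ₗ
        TensorProduct.map (chainCounit L) LinearMap.id := by
    refine tensor_ext_deg_left fun k x hx y => ?_
    have h := chainCounit_smul_zpow k 1 hx
    rw [one_mul] at h
    simp only [LinearMap.comp_apply, TensorProduct.map_tmul, sgn_of_mem hx, map_smul,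
      constCochain_val, smul_smul, h, LinearMap.id_apply, LinearEquiv.coe_coe,
      TensorProduct.lid_tmul, TensorProduct.mk_apply, ← TensorProduct.smul_tmul']
  have h3 := LinearMap.congr_fun h2 (GSym.comul (Susp L) c)
  have h4 := LinearMap.congr_fun (comul_counit_left (L := L)) c
  simp only [LinearMap.comp_apply, LinearMap.id_apply] at h1 h3 h4
  rw [h4] at h3
  rw [h0, sgnHom_of_mem (f := (constCochain L N n).val) (constCochain_mem hn),
    TensorProduct.map_smul_left]
  simp only [LinearMap.smul_apply, map_smul, constCochain_val, h1, LinearMap.zero_apply, zero_smul,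
    smul_zero, sub_zero, chainSplit, LinearMap.comp_apply, h3, TensorProduct.mk_apply]

end Differential


/-! ### Cup products with constant cochains and injectivity of the diagonal map -/

section DiagonalMap
set_option maxSynthPendingDepth 4
variable {L : Type*} [AddCommGroup L] [Module ℚ L] [DGLie L]
variable {N : Type*} [AddCommGroup N] [Module ℚ N] [GradedSpace N]
variable {M : Type*} [AddCommGroup M] [Module ℚ M] [GradedSpace M]

theorem cup_constCochain (m : M) (n : N) :
    cup L N M (constCochain L M m ⊗ₜ constCochain L N n) = constCochain L (M ⊗[ℚ] N) (m ⊗ₜ n) := by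
  have key : cup L N M ∘ₗ TensorProduct.map (constCochain L M) (constCochain L N) =
      constCochain L (M ⊗[ℚ] N) := by
    refine tensor_ext_deg fun p q m hm n hn => ?_
    have h : homTensor (Chains L) (Chains L) M N (constCochain L M m).val
        (constCochain L N n).val = LinearMap.toSpanSingleton ℚ (M ⊗[ℚ] N) (m ⊗ₜ n) ∘ₗ
        chainCounit L ∘ₗ (TensorProduct.lid ℚ (Chains L)).toLinearMap ∘ₗ
        TensorProduct.map (chainCounit L) LinearMap.id := by
      refine tensor_ext_deg_left fun k x hx y => ?_
      rw [homTensor_apply _ _ (constCochain_mem hn) hx, constCochain_val, constCochain_val]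
      simp only [LinearMap.comp_apply, TensorProduct.map_tmul, LinearMap.id_apply,
        LinearEquiv.coe_coe, TensorProduct.lid_tmul, map_smul, LinearMap.toSpanSingleton_apply,
        ← TensorProduct.smul_tmul', TensorProduct.tmul_smul, smul_smul,
        smul_eq_mul]
      rw [mul_comm (chainCounit L y), ← mul_assoc, chainCounit_smul_zpow k q hx]
    refine GHom.ext (LinearMap.ext fun c => ?_)
    have h2 := LinearMap.congr_fun (comul_counit_left (L := L)) c
    simp only [LinearMap.comp_apply, LinearMap.id_apply] at h2
    rw [LinearMap.comp_apply, TensorProduct.map_tmul, cup_val, h]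
    simp only [LinearMap.comp_apply, h2]
    rfl
  exact LinearMap.congr_fun key (m ⊗ₜ n)

theorem cup_constCochain_left (m : M) (g : Cochains L N) (c : Chains L) :
    (cup L N M (constCochain L M m ⊗ₜ g)).val c = m ⊗ₜ g.val c := by
  induction g using deg_induction with
  | h0 => simp
  | hadd a b ha hb => simp only [TensorProduct.tmul_add, map_add, LinearMap.add_apply, ha, hb]
  | h p g hg =>
    have h : homTensor (Chains L) (Chains L) M N (constCochain L M m).val g.val =
        TensorProduct.mk ℚ M N m ∘ₗ g.val ∘ₗ (TensorProduct.lid ℚ (Chains L)).toLinearMap ∘ₗ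
        TensorProduct.map (chainCounit L) LinearMap.id := by
      refine tensor_ext_deg_left fun k x hx y => ?_
      rw [homTensor_apply _ _ hg hx, constCochain_val]
      simp only [LinearMap.comp_apply, TensorProduct.map_tmul, LinearMap.id_apply,
        LinearEquiv.coe_coe, TensorProduct.lid_tmul, map_smul, TensorProduct.mk_apply,
        ← TensorProduct.smul_tmul', smul_smul, chainCounit_smul_zpow k p hx]
    have h2 := LinearMap.congr_fun (comul_counit_left (L := L)) c
    simp only [LinearMap.comp_apply, LinearMap.id_apply] at h2
    rw [cup_val, h]
    simp only [LinearMap.comp_apply, h2, TensorProduct.mk_apply]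

theorem cup_constCochain_right {p q : ℤ} (f : Cochains L M) {n : N} (hn : n ∈ deg N p)
    {c : Chains L} (hc : c ∈ deg (Chains L) q) :
    (cup L N M (f ⊗ₜ constCochain L N n)).val c = (-1 : ℚ) ^ (p * q) • (f.val c ⊗ₜ n) := by
  have h : homTensor (Chains L) (Chains L) M N f.val (constCochain L N n).val =
      (TensorProduct.mk ℚ M N).flip n ∘ₗ f.val ∘ₗ GradedSpace.wt ((-1) ^ p) ∘ₗ
      (TensorProduct.rid ℚ (Chains L)).toLinearMap ∘ₗ
      TensorProduct.map LinearMap.id (chainCounit L) := by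
    refine tensor_ext_deg_left fun k x hx y => ?_
    rw [homTensor_apply _ _ (constCochain_mem hn) hx, constCochain_val]
    simp only [LinearMap.comp_apply, TensorProduct.map_tmul, LinearMap.id_apply,
      LinearEquiv.coe_coe, TensorProduct.rid_tmul, map_smul, LinearMap.flip_apply,
      TensorProduct.mk_apply, GradedSpace.wt_of_mem _ k x hx, TensorProduct.tmul_smul, zpow_mul]
    rw [smul_comm]
    simp
  have h2 := LinearMap.congr_fun (comul_counit_right (L := L)) c
  simp only [LinearMap.comp_apply, LinearMap.id_apply] at h2
  rw [cup_val, h]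
  simp only [LinearMap.comp_apply, h2, GradedSpace.wt_of_mem _ q c hc]
  simp [zpow_mul]

omit [GradedSpace N] in
omit [GradedSpace N] in
theorem chainsDiag_tmul (c : Chains L) (m : M) (n : N) : chainsDiag L N M (c ⊗ₜ (m ⊗ₜ n)) =
    interchange (Chains L) (Chains L) M N (GSym.comul (Susp L) c ⊗ₜ (m ⊗ₜ n)) := rfl

/-- The diagonal map has a left inverse, which applies the augmentation to the second factor. -/
theorem chainsDiag_injective : Function.Injective (chainsDiag L N M) := by
  let s : (Chains L ⊗[ℚ] M) ⊗[ℚ] (Chains L ⊗[ℚ] N) →ₗ[ℚ] Chains L ⊗[ℚ] (M ⊗[ℚ] N) :=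
    (TensorProduct.assoc ℚ (Chains L) M N).toLinearMap ∘ₗ
      TensorProduct.map LinearMap.id ((TensorProduct.lid ℚ N).toLinearMap ∘ₗ
        TensorProduct.map (chainCounit L) LinearMap.id)
  have key : s ∘ₗ chainsDiag L N M = LinearMap.id := by
    refine TensorProduct.ext' fun c v => ?_
    induction v using TensorProduct.induction_on with
    | zero => simp
    | add a b ha hb => simp only [TensorProduct.tmul_add, map_add, ha, hb]
    | tmul m n =>
      induction m using deg_induction with
      | h0 => simp
      | hadd a b ha hb =>
        simp only [TensorProduct.add_tmul, TensorProduct.tmul_add, map_add, ha, hb]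
      | h p m hm =>
        have h : s ∘ₗ interchange (Chains L) (Chains L) M N ∘ₗ
            (TensorProduct.mk ℚ _ (M ⊗[ℚ] N)).flip (m ⊗ₜ n) =
            (TensorProduct.mk ℚ (Chains L) (M ⊗[ℚ] N)).flip (m ⊗ₜ n) ∘ₗ
            (TensorProduct.rid ℚ (Chains L)).toLinearMap ∘ₗ
            TensorProduct.map LinearMap.id (chainCounit L) := by
          refine tensor_ext_deg fun a b x hx y hy => ?_
          simp only [LinearMap.comp_apply, LinearMap.flip_apply, TensorProduct.mk_apply,
            interchange_tmul x n hy hm, map_smul, s, TensorProduct.map_tmul, LinearMap.id_apply,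
            LinearEquiv.coe_coe, TensorProduct.lid_tmul, TensorProduct.assoc_tmul,
            TensorProduct.rid_tmul, TensorProduct.tmul_smul, smul_smul]
          rw [mul_comm b p, chainCounit_smul_zpow b p hy]
        have h1 := LinearMap.congr_fun h (GSym.comul (Susp L) c)
        have h2 := LinearMap.congr_fun (comul_counit_right (L := L)) c
        simp only [LinearMap.comp_apply, LinearMap.id_apply] at h1 h2
        rw [h2] at h1
        exact h1
  exact Function.LeftInverse.injective (g := s) fun v => LinearMap.congr_fun key v

/-! ### Operators of tensor products -/

theorem rid_algOp2 (r : Alg2 L) : algOp2 L r =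
    TensorProduct.map (TensorProduct.rid ℚ (Chains L)).toLinearMap
      (TensorProduct.rid ℚ (Chains L)).toLinearMap ∘ₗ coext2 L ℚ ℚ r := by
  induction r using TensorProduct.induction_on with
  | zero => simp
  | add a b ha hb => simp only [map_add, LinearMap.comp_add, ha, hb]
  | tmul a b =>
    induction b using deg_induction with
    | h0 => simp
    | hadd b b' hb hb' => simp only [TensorProduct.tmul_add, map_add, LinearMap.comp_add, hb, hb']
    | h p b hb =>
      refine tensor_ext_deg_left fun q x hx y => ?_
      rw [algOp2_tmul, LinearMap.comp_apply, coext2_tmul, homTensor_apply _ _ (algOp_mem hb) hx,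
        homTensor_apply _ _ (coext_mem hb) hx, map_smul]
      rfl

/-- Operators turn the action of `C^*(L) ⊗ C^*(L)` into composition. -/
theorem coext2_mul (ξ : Cochains L M ⊗[ℚ] Cochains L N) (r : Alg2 L) :
    coext2 L N M (pairTensor (cupRight L M) (cupRight L N) (ξ ⊗ₜ r)) =
      coext2 L N M ξ ∘ₗ algOp2 L r := by
  have key : (coext2 L N M ∘ₗ pairTensor (cupRight L M) (cupRight L N)) =
      TensorProduct.lift ((LinearMap.llcomp ℚ (Chains L ⊗[ℚ] Chains L) (Chains L ⊗[ℚ] Chains L)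
        ((Chains L ⊗[ℚ] M) ⊗[ℚ] (Chains L ⊗[ℚ] N))).compl₁₂ (coext2 L N M) (algOp2 L)) := by
    refine tensor4_ext_deg (X := Cochains L M) (Y := Cochains L N) (Z := Alg L) (X' := Alg L)
      (A := Chains L ⊗[ℚ] Chains L →ₗ[ℚ] (Chains L ⊗[ℚ] M) ⊗[ℚ] (Chains L ⊗[ℚ] N))
      fun n k s t f hf g hg a ha b hb => ?_
    simp only [LinearMap.comp_apply, pairTensor, interchange_tmul _ _ hg ha, map_smul,
      TensorProduct.map_tmul, coext2_tmul, coext_cupRight, TensorProduct.lift.tmul,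
      LinearMap.compl₁₂_apply, LinearMap.llcomp_apply']
    rw [algOp2_tmul, homTensor_comp _ (algOp_mem ha) (algOp_mem hb) (coext_mem hg)]
  exact LinearMap.congr_fun key (ξ ⊗ₜ r)

theorem algOp2_mul (r r' : Alg2 L) :
    algOp2 L (alg2Mul L (r ⊗ₜ r')) = algOp2 L r ∘ₗ algOp2 L r' := by
  rw [rid_algOp2, coext2_mul, ← LinearMap.comp_assoc, ← rid_algOp2]

/-- This is `chainsDiag_coext_cup` for trivial coefficients, after dropping the factors `ℚ`. It says
that `Δ` is linear over `∧V ⊗ ∧V'`, acting on `C_*L` through the multiplication. -/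
theorem comul_algOp (r : Alg2 L) :
    GSym.comul (Susp L) ∘ₗ algOp L (algMul L r) = algOp2 L r ∘ₗ GSym.comul (Susp L) := by
  have h1 : GSym.comul (Susp L) ∘ₗ (TensorProduct.rid ℚ (Chains L)).toLinearMap ∘ₗ
      TensorProduct.map LinearMap.id (TensorProduct.rid ℚ ℚ).toLinearMap =
      TensorProduct.map (TensorProduct.rid ℚ (Chains L)).toLinearMap
        (TensorProduct.rid ℚ (Chains L)).toLinearMap ∘ₗ chainsDiag L ℚ ℚ := by
    refine TensorProduct.ext' fun c v => ?_
    induction v using TensorProduct.induction_on with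
    | zero => simp
    | add a b ha hb => simp only [TensorProduct.tmul_add, map_add, ha, hb]
    | tmul s t =>
      have h : (s * t) • LinearMap.id =
          TensorProduct.map (TensorProduct.rid ℚ (Chains L)).toLinearMap
          (TensorProduct.rid ℚ (Chains L)).toLinearMap ∘ₗ interchange (Chains L) (Chains L) ℚ ℚ ∘ₗ
          (TensorProduct.mk ℚ _ (ℚ ⊗[ℚ] ℚ)).flip (s ⊗ₜ t) := by
        refine tensor_ext_deg fun p q x hx y hy => ?_
        have hs : s ∈ deg ℚ 0 := by simp [deg, GradedSpace.deg]
        simp [interchange_tmul x t hy hs, ← TensorProduct.smul_tmul', TensorProduct.tmul_smul,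
          smul_smul, mul_comm]
      have h := LinearMap.congr_fun h (GSym.comul (Susp L) c)
      simp only [LinearMap.comp_apply, chainsDiag_tmul, TensorProduct.map_tmul,
        LinearMap.id_apply, LinearEquiv.coe_coe, TensorProduct.rid_tmul, map_smul, smul_eq_mul]
      simp only [LinearMap.smul_apply, LinearMap.comp_apply, LinearMap.id_apply,
        LinearMap.flip_apply, TensorProduct.mk_apply] at h
      rw [mul_comm t s, h]
  have h2 : coext L ℚ (algMul L r) =
      TensorProduct.map LinearMap.id (TensorProduct.rid ℚ ℚ).toLinearMap ∘ₗ
        coext L (ℚ ⊗[ℚ] ℚ) (cup L ℚ ℚ r) := by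
    show coextLin L ℚ ((TensorProduct.rid ℚ ℚ).toLinearMap ∘ₗ (cup L ℚ ℚ r).val) =
      TensorProduct.map LinearMap.id (TensorProduct.rid ℚ ℚ).toLinearMap ∘ₗ
        coextLin L (ℚ ⊗[ℚ] ℚ) (cup L ℚ ℚ r).val
    generalize cup L ℚ ℚ r = f
    induction f using deg_induction with
    | h0 => simp
    | hadd a b ha hb => simp only [map_add, LinearMap.comp_add, ha, hb]
    | h n f hf =>
      rw [coextLin_eq, coextLin_eq, ← LinearMap.comp_assoc, ← homTensor_eq_map (rid_mem ℚ),
        homTensor_comp _ id_mem hf (rid_mem ℚ)]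
      simp
  have h3 := chainsDiag_coext_cup (L := L) r
  rw [algOp_eq, h2, rid_algOp2, LinearMap.comp_assoc, ← h3,
    ← LinearMap.comp_assoc _ (chainsDiag L ℚ ℚ), ← h1]
  rfl

end DiagonalMap


/-! ### Derivations -/

section Derivations
set_option maxSynthPendingDepth 4

/-- The graded commutator with the differentials is a derivation of the tensor product of operators.
Applied to `coext f` and `coext g` it gives `coext2_cochainsD`. -/
theorem homTensor_derivation {X Y X' Y' : Type*} [AddCommGroup X] [Module ℚ X] [GradedSpace X]
    [AddCommGroup Y] [Module ℚ Y] [GradedSpace Y] [AddCommGroup X'] [Module ℚ X'] [GradedSpace X']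
    [AddCommGroup Y'] [Module ℚ Y'] [GradedSpace Y'] {s t : ℤ} {F : X →ₗ[ℚ] X'} {G : Y →ₗ[ℚ] Y'}
    (hF : F ∈ homDeg X X' s) (hG : G ∈ homDeg Y Y' t)
    {dX : X →ₗ[ℚ] X} {dY : Y →ₗ[ℚ] Y} {dX' : X' →ₗ[ℚ] X'} {dY' : Y' →ₗ[ℚ] Y'}
    (hdX : dX ∈ homDeg X X (-1)) (hdY : dY ∈ homDeg Y Y (-1)) (hdY' : dY' ∈ homDeg Y' Y' (-1)) :
    homTensor X Y X' Y' (dX' ∘ₗ F - (-1 : ℚ) ^ s • (F ∘ₗ dX)) G +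
      (-1 : ℚ) ^ s • homTensor X Y X' Y' F (dY' ∘ₗ G - (-1 : ℚ) ^ t • (G ∘ₗ dY)) =
    tensorD dX' dY' ∘ₗ homTensor X Y X' Y' F G -
      (-1 : ℚ) ^ (s + t) • (homTensor X Y X' Y' F G ∘ₗ tensorD dX dY) := by
  rw [tensorD_eq hdY', tensorD_eq hdY, LinearMap.add_comp, LinearMap.comp_add,
    homTensor_comp _ hF hG id_mem, homTensor_comp _ hF hG hdY', homTensor_comp _ hdX id_mem hG,
    homTensor_comp _ id_mem hdY hG, sign_congr (a := -1 * s) (b := s) (-s) (by ring),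
    sign_congr (a := t * -1) (b := t) (-t) (by ring)]
  simp only [LinearMap.id_comp, LinearMap.comp_id, map_sub, map_smul, LinearMap.sub_apply,
    LinearMap.smul_apply, zero_mul, mul_zero, zpow_zero, one_smul, smul_add, smul_sub, smul_smul,
    sign_add, mul_assoc, neg_one_zpow_mul_self, mul_one]
  abel

theorem assoc_mem {X Y Z : Type*} [AddCommGroup X] [Module ℚ X] [GradedSpace X]
    [AddCommGroup Y] [Module ℚ Y] [GradedSpace Y] [AddCommGroup Z] [Module ℚ Z] [GradedSpace Z] :
    (TensorProduct.assoc ℚ X Y Z).toLinearMap ∈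
      homDeg ((X ⊗[ℚ] Y) ⊗[ℚ] Z) (X ⊗[ℚ] (Y ⊗[ℚ] Z)) 0 := by
  refine tensor_homDeg fun p q v hv z hz => ?_
  rw [add_zero]
  induction hv using Submodule.span_induction with
  | zero => simp
  | add x y _ _ hx hy => rw [TensorProduct.add_tmul, map_add]; exact add_mem hx hy
  | smul a x _ hx => rw [← TensorProduct.smul_tmul', map_smul]; exact Submodule.smul_mem _ _ hx
  | mem v hv =>
    obtain ⟨a, b, rfl, x, hx, y, hy, rfl⟩ := hv
    exact tmul_mem (add_assoc _ _ _).symm hx (tmul_mem rfl hy hz)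

variable {L : Type*} [AddCommGroup L] [Module ℚ L] [DGLie L]
variable {N : Type*} [AddCommGroup N] [Module ℚ N] [GradedSpace N]
variable {M : Type*} [AddCommGroup M] [Module ℚ M] [GradedSpace M]

theorem cup_mem : cup L N M ∈ homDeg (Cochains L M ⊗[ℚ] Cochains L N) (Cochains L (M ⊗[ℚ] N)) 0 :=
  tensor_homDeg fun _ _ _ hf _ hg =>
    comp_mem (homTensor_mem hf hg (add_zero _).symm) GSym.comul_mem (zero_add _)

theorem cupRight_mem : cupRight L N ∈ homDeg (Cochains L N ⊗[ℚ] Alg L) (Cochains L N) 0 :=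
  tensor_homDeg fun _ _ _ hf _ hg => comp_mem (rid_mem N)
    (comp_mem (homTensor_mem hf hg (add_zero _).symm) GSym.comul_mem (zero_add _)) (add_zero _)

theorem sgn_of_homDeg_zero {X Y : Type*} [AddCommGroup X] [Module ℚ X] [GradedSpace X]
    [AddCommGroup Y] [Module ℚ Y] [GradedSpace Y] {f : X →ₗ[ℚ] Y} (hf : f ∈ homDeg X Y 0) (x : X) :
    sgn Y (f x) = f (sgn X x) := by
  rw [apply_sgn hf, zpow_zero, one_smul]

/-- The sign `(-1)^(m|y|)` in the definition is the Koszul sign for evaluating a tensor product of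
operators on `u ⊗ u`, and the two factors `(-1)^m` cancel. -/
theorem capTensorCap_eq (m : ℕ) {u : Chains L} (hu : u ∈ deg (Chains L) m)
    (ξ : Cochains L M ⊗[ℚ] Cochains L N) : capTensorCap L N M m u ξ = coext2 L N M ξ (u ⊗ₜ u) := by
  have key : capTensorCap L N M m u = LinearMap.applyₗ (u ⊗ₜ u) ∘ₗ coext2 L N M := by
    refine tensor_ext_deg fun s t f hf g hg => ?_
    have hp : ∀ k : ℕ, (sgn (Cochains L N) ^ k : Module.End ℚ (Cochains L N)) g =
        (-1 : ℚ) ^ (t * k) • g := by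
      intro k
      induction k with
      | zero => simp
      | succ k ih =>
        rw [pow_succ, Module.End.mul_apply, sgn_of_mem hg, map_smul, ih, smul_smul, ← sign_add]
        congr 2; push_cast; ring
    rw [capTensorCap, TensorProduct.map_tmul, LinearMap.comp_apply, hp, map_smul, cap_eq, cap_eq,
      LinearMap.comp_apply, LinearMap.applyₗ_apply_apply, coext2_tmul,
      homTensor_apply _ _ (coext_mem hg) hu, TensorProduct.tmul_smul,
      TensorProduct.smul_tmul_smul, ← mul_pow]
    norm_num
  rw [key]; rfl

/-! ### Differentials of operators, Leibniz rules and chain maps -/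

section Rep
variable [DGRep L N] [DGRep L M]

theorem cochainsD_mem : cochainsD L N ∈ homDeg (Cochains L N) (Cochains L N) (-1) :=
  fun _ _ hf => cochainsDAux_mem L hf

theorem chainsD_mem : chainsD L N ∈ homDeg (Chains L ⊗[ℚ] N) (Chains L ⊗[ℚ] N) (-1) :=
  Submodule.sub_mem _ (tensorD_mem (chainD_mem L) DGRep.d_mem)
    (comp_mem (map_mem id_mem DGRep.act_mem (add_zero _))
      (comp_mem assoc_mem (map_mem (chainSplit_mem L) id_mem (add_zero _)) (add_zero _))
      (add_zero _))

theorem coext2_cochainsD (ξ : Cochains L M ⊗[ℚ] Cochains L N) :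
    coext2 L N M (tensorD (cochainsD L M) (cochainsD L N) ξ) =
      tensorD (chainsD L M) (chainsD L N) ∘ₗ coext2 L N M ξ -
        coext2 L N M (sgn _ ξ) ∘ₗ tensorD (chainD L) (chainD L) := by
  induction ξ using TensorProduct.induction_on with
  | zero => simp
  | add a b ha hb => simp only [map_add, LinearMap.comp_add, LinearMap.add_comp, ha, hb]; abel
  | tmul f g =>
    induction f using deg_induction with
    | h0 => simp
    | hadd a b ha hb =>
      simp only [TensorProduct.add_tmul, map_add, LinearMap.comp_add, LinearMap.add_comp, ha, hb]
      abel
    | h s f hf =>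
      induction g using deg_induction with
      | h0 => simp
      | hadd a b ha hb =>
        simp only [TensorProduct.tmul_add, map_add, LinearMap.comp_add, LinearMap.add_comp, ha, hb]
        abel
      | h t g hg =>
        rw [tensorD_apply hf, map_add, map_smul, coext2_tmul, coext2_tmul, coext_cochainsD,
          coext_cochainsD, sgn_of_mem (tmul_mem rfl hf hg), map_smul, coext2_tmul, sgn_of_mem hf,
          sgn_of_mem hg, map_smul, map_smul]
        rw [LinearMap.smul_comp, LinearMap.smul_comp, LinearMap.smul_comp]
        exact homTensor_derivation (coext_mem hf) (coext_mem hg) (chainD_mem L) (chainD_mem L)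
          chainsD_mem

/-- For constant cochains both sides are explicit, and the twisting term of `m ⊗ n` splits because
`L` acts diagonally on `M ⊗ N`. This hand-checked instance of the Leibniz rule yields the one for
arbitrary cochains, by way of the diagonal map. -/
theorem cup_cochainsD_constCochain {p q : ℤ} {m : M} {n : N} (hm : m ∈ deg M p) (hn : n ∈ deg N q) :
    cochainsD L (M ⊗[ℚ] N) (constCochain L (M ⊗[ℚ] N) (m ⊗ₜ n)) =
      cup L N M (tensorD (cochainsD L M) (cochainsD L N)
        (constCochain L M m ⊗ₜ constCochain L N n)) := by
  refine GHom.ext (hom_ext_deg fun k c hc => ?_)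
  have hx : chainTau L c ∈ deg L (k + -1) := chainTau_mem L k c hc
  have hd : (DGRep.d L : M ⊗[ℚ] N →ₗ[ℚ] M ⊗[ℚ] N) = tensorD (DGRep.d L) (DGRep.d L) := rfl
  have ha : (DGRep.act : L ⊗[ℚ] (M ⊗[ℚ] N) →ₗ[ℚ] M ⊗[ℚ] N) = tensorAct L M N := rfl
  rw [tensorD_apply (constCochain_mem hm), map_add, map_smul, map_add, map_smul,
    LinearMap.add_apply, LinearMap.smul_apply, cup_constCochain_left,
    cup_constCochain_right _ hn hc, cochainsD_constCochain hm, cochainsD_constCochain hn,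
    cochainsD_constCochain (tmul_mem rfl hm hn), rightAct_tmul hm hx, rightAct_tmul hn hx,
    rightAct_tmul (tmul_mem rfl hm hn) hx, hd, tensorD_apply hm, ha, tensorAct_apply n hx hm]
  have h1 := chainCounit_smul_zpow k q hc
  simp only [TensorProduct.add_tmul, TensorProduct.tmul_add, smul_add, smul_smul,
    ← TensorProduct.smul_tmul', TensorProduct.tmul_smul, h1, smul_neg, TensorProduct.neg_tmul,
    TensorProduct.tmul_neg, ← sign_add]
  rw [sign_congr (a := p + q + (p + q) * (k + -1)) (b := q * k + (p + p * (k + -1))) 0 (by ring),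
    sign_congr (a := p + q + ((p + q) * (k + -1) + (k + -1) * p)) (b := p + (q + q * (k + -1)))
      (p * (k - 1)) (by ring)]
  module

-- The values of these operators are the elements `± c ⊗ (m ⊗ n)`, which span `C_*(L; M ⊗ N)`.
omit [DGRep L N] [DGRep L M] in
theorem coext_constCochain_injective {Z : Type*} [AddCommGroup Z] [Module ℚ Z]
    {F G : Chains L ⊗[ℚ] (M ⊗[ℚ] N) →ₗ[ℚ] Z}
    (h : ∀ p q, ∀ m ∈ deg M p, ∀ n ∈ deg N q,
      F ∘ₗ coext L (M ⊗[ℚ] N) (cup L N M (constCochain L M m ⊗ₜ constCochain L N n)) =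
      G ∘ₗ coext L (M ⊗[ℚ] N) (cup L N M (constCochain L M m ⊗ₜ constCochain L N n))) : F = G := by
  refine tensor_ext_deg' fun k p q c hc m hm n hn => ?_
  have h1 := LinearMap.congr_fun (h p q m hm n hn) c
  rw [LinearMap.comp_apply, LinearMap.comp_apply, cup_constCochain,
    coext_constCochain (tmul_mem rfl hm hn) hc, map_smul, map_smul] at h1
  exact smul_right_injective _ (zpow_ne_zero _ (by norm_num)) h1

/-- The diagonal map is a chain map. -/
theorem chainsDiag_isChainMap : IsChainMap (chainsD L (M ⊗[ℚ] N))
    (tensorD (chainsD L M) (chainsD L N)) (chainsDiag L N M) := by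
  refine coext_constCochain_injective fun p q m hm n hn => ?_
  set ξ := constCochain L M m ⊗ₜ[ℚ] constCochain L N n with hξ
  -- The diagonal formula is applied to `D ξ` for a product of constants and both operators are
  -- expanded as commutators. The terms ending in the differential of `C_*L` agree because `Δ` is a
  -- chain map; the others say that the diagonal map commutes with the differentials on the image of
  -- the operator of `ξ`.
  have h1 := chainsDiag_coext_cup (L := L) (tensorD (cochainsD L M) (cochainsD L N) ξ)
  rw [← cup_cochainsD_constCochain hm hn, ← cup_constCochain, ← hξ, coext_cochainsD,
    coext2_cochainsD, sgn_of_homDeg_zero cup_mem, LinearMap.comp_sub, LinearMap.sub_comp,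
    LinearMap.comp_assoc _ _ (coext2 L N M _), ← comul_chainD, LinearMap.comp_assoc _ _ (tensorD _ _),
    ← chainsDiag_coext_cup, ← LinearMap.comp_assoc (chainD L), chainsDiag_coext_cup (sgn _ ξ),
    LinearMap.comp_assoc (chainD L)] at h1
  exact sub_left_injective h1

/-- The cup product is a chain map. -/
theorem cup_isChainMap : IsChainMap (tensorD (cochainsD L M) (cochainsD L N))
    (cochainsD L (M ⊗[ℚ] N)) (cup L N M) := by
  refine LinearMap.ext fun ξ => coext_injective ?_
  -- The diagonal map is injective, so the operators may be compared after applying it, where it is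
  -- already known to be a chain map.
  have h : ∀ F G : Chains L →ₗ[ℚ] Chains L ⊗[ℚ] (M ⊗[ℚ] N),
      chainsDiag L N M ∘ₗ F = chainsDiag L N M ∘ₗ G → F = G := fun F G h =>
    LinearMap.ext fun c => chainsDiag_injective (LinearMap.congr_fun h c)
  refine h _ _ ?_
  rw [LinearMap.comp_apply, LinearMap.comp_apply, chainsDiag_coext_cup, coext_cochainsD,
    coext2_cochainsD, sgn_of_homDeg_zero cup_mem, LinearMap.comp_sub, LinearMap.sub_comp,
    ← LinearMap.comp_assoc _ _ (chainsDiag L N M), ← LinearMap.comp_assoc _ _ (chainsDiag L N M),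
    chainsDiag_coext_cup, LinearMap.comp_assoc _ _ (coext2 L N M _), ← comul_chainD,
    chainsDiag_isChainMap, LinearMap.comp_assoc, LinearMap.comp_assoc, chainsDiag_coext_cup,
    LinearMap.comp_assoc]

theorem cochainsD_cupRight (f : Cochains L N) (a : Alg L) :
    cochainsD L N (cupRight L N (f ⊗ₜ a)) = cupRight L N (cochainsD L N f ⊗ₜ a) +
      cupRight L N (sgn _ f ⊗ₜ cochainsD L ℚ a) := by
  refine coext_injective ?_
  rw [map_add, coext_cochainsD, sgn_of_homDeg_zero cupRight_mem, sgn_tmul, coext_cupRight,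
    coext_cupRight, coext_cupRight, coext_cupRight, coext_cochainsD, algOp_cochainsD,
    LinearMap.sub_comp, LinearMap.comp_sub, LinearMap.comp_assoc, LinearMap.comp_assoc,
    LinearMap.comp_assoc]
  abel

/-- The cap product with a cycle is a chain map. -/
theorem cap_isChainMap (m : ℕ) {u : Chains L} (hdu : chainD L u = 0) :
    IsChainMap (cochainsD L N) (chainsD L N) (cap L N m u) := by
  refine LinearMap.ext fun f => ?_
  rw [LinearMap.comp_apply, LinearMap.comp_apply, cap_eq, cap_eq, coext_cochainsD, map_smul,
    LinearMap.sub_apply, LinearMap.comp_apply, LinearMap.comp_apply, hdu, map_zero, sub_zero]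

theorem capTensorCap_isChainMap (m : ℕ) {u : Chains L} (hu : u ∈ deg (Chains L) m)
    (hdu : chainD L u = 0) :
    IsChainMap (tensorD (cochainsD L M) (cochainsD L N)) (tensorD (chainsD L M) (chainsD L N))
      (capTensorCap L N M m u) := by
  refine LinearMap.ext fun ξ => ?_
  rw [LinearMap.comp_apply, LinearMap.comp_apply, capTensorCap_eq m hu, capTensorCap_eq m hu,
    coext2_cochainsD, LinearMap.sub_apply, LinearMap.comp_apply, LinearMap.comp_apply,
    tensorD_apply hu, hdu, TensorProduct.zero_tmul, TensorProduct.tmul_zero, smul_zero, add_zero,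
    map_zero, sub_zero]

end Rep

/-- After the injective diagonal map both operators become `coext2 ξ ∘ algOp2 r ∘ Δ`. This is the
balancing property that lets `Φ` be computed on every `ξ · b`. -/
theorem cup_mul (ξ : Cochains L M ⊗[ℚ] Cochains L N) (r : Alg2 L) :
    cup L N M (pairTensor (cupRight L M) (cupRight L N) (ξ ⊗ₜ r)) =
      cupRight L (M ⊗[ℚ] N) (cup L N M ξ ⊗ₜ algMul L r) := by
  refine coext_injective (LinearMap.ext fun c => chainsDiag_injective (LinearMap.congr_fun
    (f := chainsDiag L N M ∘ₗ _) (g := chainsDiag L N M ∘ₗ _) ?_ c))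
  rw [chainsDiag_coext_cup, coext2_mul, coext_cupRight, LinearMap.comp_assoc, ← comul_algOp,
    ← LinearMap.comp_assoc, ← LinearMap.comp_assoc, chainsDiag_coext_cup]

theorem algOp_cochainOne : algOp L (cochainOne L) = LinearMap.id := by
  rw [algOp_eq]
  have : coext L ℚ (cochainOne L) = TensorProduct.map LinearMap.id (chainCounit L) ∘ₗ
      GSym.comul (Susp L) := by
    rw [← homTensor_eq_map (chainCounit_mem L)]; rfl
  rw [this, comul_counit_right]

theorem cochainOne_mem : cochainOne L ∈ deg (Alg L) 0 := chainCounit_mem L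

theorem cupRight_cochainOne (f : Cochains L N) : cupRight L N (f ⊗ₜ cochainOne L) = f := by
  refine coext_injective ?_
  rw [coext_cupRight, algOp_cochainOne, LinearMap.comp_id]

theorem cupRight_cupRight (f : Cochains L N) (a b : Alg L) :
    cupRight L N (cupRight L N (f ⊗ₜ a) ⊗ₜ b) = cupRight L N (f ⊗ₜ algMul L (a ⊗ₜ b)) := by
  refine coext_injective ?_
  rw [coext_cupRight, coext_cupRight, coext_cupRight, algOp_algMul, LinearMap.comp_assoc]

theorem cochainOne_algMul (a : Alg L) : algMul L (cochainOne L ⊗ₜ a) = a := by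
  refine algOp_injective ?_
  rw [algOp_algMul, algOp_cochainOne, LinearMap.id_comp]

end Derivations


/-! ### Tensor products of modules -/

section PairTensor
set_option maxSynthPendingDepth 4
variable {E F A B : Type*}
  [AddCommGroup E] [Module ℚ E] [GradedSpace E] [AddCommGroup F] [Module ℚ F] [GradedSpace F]
  [AddCommGroup A] [Module ℚ A] [GradedSpace A] [AddCommGroup B] [Module ℚ B] [GradedSpace B]

theorem tensor_induction_deg {P : E ⊗[ℚ] F → Prop} (v : E ⊗[ℚ] F) (h0 : P 0)
    (hadd : ∀ v w, P v → P w → P (v + w))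
    (h : ∀ p q, ∀ x ∈ deg E p, ∀ y ∈ deg F q, P (x ⊗ₜ y)) : P v := by
  induction v using TensorProduct.induction_on with
  | zero => exact h0
  | add a b ha hb => exact hadd _ _ ha hb
  | tmul f g =>
    induction f using deg_induction with
    | h0 => simpa using h0
    | hadd a b ha hb => rw [TensorProduct.add_tmul]; exact hadd _ _ ha hb
    | h p f hf =>
      induction g using deg_induction with
      | h0 => simpa using h0
      | hadd a b ha hb => rw [TensorProduct.tmul_add]; exact hadd _ _ ha hb
      | h q g hg => exact h p q f hf g hg

omit [GradedSpace E] [GradedSpace B] in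
theorem pairTensor_tmul {P P' : Type*} [AddCommGroup P] [Module ℚ P] [AddCommGroup P'] [Module ℚ P']
    {ρ : E ⊗[ℚ] A →ₗ[ℚ] P} {σ : F ⊗[ℚ] B →ₗ[ℚ] P'} {p q : ℤ} (e : E) {f : F} {a : A} (b : B)
    (hf : f ∈ deg F p) (ha : a ∈ deg A q) :
    pairTensor ρ σ ((e ⊗ₜ f) ⊗ₜ (a ⊗ₜ b)) = (-1 : ℚ) ^ (p * q) • (ρ (e ⊗ₜ a) ⊗ₜ σ (f ⊗ₜ b)) := by
  rw [pairTensor, LinearMap.comp_apply, interchange_tmul e b hf ha, map_smul,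
    TensorProduct.map_tmul]

variable {ρ : E ⊗[ℚ] A →ₗ[ℚ] E} {σ : F ⊗[ℚ] B →ₗ[ℚ] F}
  {μ : A ⊗[ℚ] A →ₗ[ℚ] A} {ν : B ⊗[ℚ] B →ₗ[ℚ] B}

theorem pairTensor_mem (hρ : ρ ∈ homDeg (E ⊗[ℚ] A) E 0) (hσ : σ ∈ homDeg (F ⊗[ℚ] B) F 0) :
    pairTensor ρ σ ∈ homDeg ((E ⊗[ℚ] F) ⊗[ℚ] (A ⊗[ℚ] B)) (E ⊗[ℚ] F) 0 :=
  comp_mem (map_mem hρ hσ (add_zero _)) interchange_mem (add_zero _)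

theorem pairTensor_assoc (hσ : σ ∈ homDeg (F ⊗[ℚ] B) F 0)
    (hμ : μ ∈ homDeg (A ⊗[ℚ] A) A 0)
    (h : ∀ e a a', ρ (ρ (e ⊗ₜ a) ⊗ₜ a') = ρ (e ⊗ₜ μ (a ⊗ₜ a')))
    (h' : ∀ f b b', σ (σ (f ⊗ₜ b) ⊗ₜ b') = σ (f ⊗ₜ ν (b ⊗ₜ b'))) (x : E ⊗[ℚ] F)
    (r r' : A ⊗[ℚ] B) :
    pairTensor ρ σ (pairTensor ρ σ (x ⊗ₜ r) ⊗ₜ r') =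
      pairTensor ρ σ (x ⊗ₜ pairTensor μ ν (r ⊗ₜ r')) := by
  induction x using tensor_induction_deg with
  | h0 => simp
  | hadd v w hv hw => simp only [TensorProduct.add_tmul, map_add, hv, hw]
  | h p q e he f hf =>
    induction r using tensor_induction_deg with
    | h0 => simp
    | hadd v w hv hw => simp only [TensorProduct.add_tmul, TensorProduct.tmul_add, map_add, hv, hw]
    | h s t a ha b hb =>
      induction r' using tensor_induction_deg with
      | h0 => simp
      | hadd v w hv hw => simp only [TensorProduct.tmul_add, map_add, hv, hw]
      | h s' t' a' ha' b' hb' =>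
        rw [pairTensor_tmul _ _ hf ha, ← TensorProduct.smul_tmul', map_smul,
          pairTensor_tmul _ _ (hσ _ _ (tmul_mem rfl hf hb)) ha', pairTensor_tmul _ _ hb ha',
          TensorProduct.tmul_smul, map_smul,
          pairTensor_tmul _ _ hf (hμ _ _ (tmul_mem rfl ha ha')), h, h', smul_smul, smul_smul,
          ← sign_add, ← sign_add]
        congr 2; ring

theorem pairTensor_derivation {dE : E →ₗ[ℚ] E} {dF : F →ₗ[ℚ] F} {dA : A →ₗ[ℚ] A} {dB : B →ₗ[ℚ] B}
    (hdF : dF ∈ homDeg F F (-1)) (hdA : dA ∈ homDeg A A (-1))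
    (hρ : ρ ∈ homDeg (E ⊗[ℚ] A) E 0)
    (h : ∀ e a, dE (ρ (e ⊗ₜ a)) = ρ (dE e ⊗ₜ a) + ρ (sgn E e ⊗ₜ dA a))
    (h' : ∀ f b, dF (σ (f ⊗ₜ b)) = σ (dF f ⊗ₜ b) + σ (sgn F f ⊗ₜ dB b)) (x : E ⊗[ℚ] F)
    (r : A ⊗[ℚ] B) :
    tensorD dE dF (pairTensor ρ σ (x ⊗ₜ r)) = pairTensor ρ σ (tensorD dE dF x ⊗ₜ r) +
      pairTensor ρ σ (sgn _ x ⊗ₜ tensorD dA dB r) := by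
  induction x using tensor_induction_deg with
  | h0 => simp
  | hadd v w hv hw => simp only [TensorProduct.add_tmul, map_add, hv, hw]; abel
  | h p q e he f hf =>
    induction r using tensor_induction_deg with
    | h0 => simp
    | hadd v w hv hw =>
      simp only [TensorProduct.tmul_add, map_add, hv, hw]; abel
    | h s t a ha b hb =>
      rw [pairTensor_tmul _ _ hf ha, map_smul, tensorD_apply (hρ _ _ (tmul_mem rfl he ha)),
        tensorD_apply he, tensorD_apply ha, sgn_tmul, sgn_of_mem he, sgn_of_mem hf, h, h']
      simp only [TensorProduct.add_tmul, TensorProduct.tmul_add, map_add,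
        ← TensorProduct.smul_tmul', TensorProduct.tmul_smul, map_smul, sgn_of_mem he, sgn_of_mem hf,
        pairTensor_tmul _ _ hf ha, pairTensor_tmul _ _ (hdF _ _ hf) ha,
        pairTensor_tmul _ _ hf (hdA _ _ ha), smul_add, smul_smul, ← sign_add]
      rw [sign_congr (a := q * s + (p + s + 0)) (b := p + (q + -1) * s) s (by ring),
        sign_congr (a := q * s + (p + s + 0 + q)) (b := s + (q + p) + q * s) 0 (by ring),
        sign_congr (a := q + p + q * (s + -1)) (b := q * s + p) 0 (by ring)]
      abel

theorem tensorD_tensorD {dE : E →ₗ[ℚ] E} {dF : F →ₗ[ℚ] F} (hdE : dE ∈ homDeg E E (-1))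
    (hE : ∀ x, dE (dE x) = 0) (hF : ∀ x, dF (dF x) = 0) (v : E ⊗[ℚ] F) :
    tensorD dE dF (tensorD dE dF v) = 0 := by
  induction v using tensor_induction_deg with
  | h0 => simp
  | hadd v w hv hw => simp only [map_add, hv, hw, add_zero]
  | h p q e he f hf =>
    rw [tensorD_apply he, map_add, map_smul, tensorD_apply he, tensorD_apply (hdE _ _ he), hE, hF,
      sign_add]
    simp

/-- The projection onto the component of degree `n`. -/
def degProj (X : Type*) [AddCommGroup X] [Module ℚ X] [GradedSpace X] (n : ℤ) : X →ₗ[ℚ] X :=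
  letI := Classical.decEq X
  letI := (isInternal_deg (X := X)).chooseDecomposition
  (deg X n).subtype ∘ₗ DirectSum.component ℚ ℤ (fun n => deg X n) n ∘ₗ
    (DirectSum.decomposeLinearEquiv (deg X)).toLinearMap

theorem degProj_mem (n : ℤ) (x : E) : degProj E n x ∈ deg E n := Submodule.coe_mem _

theorem degProj_of_mem {n : ℤ} {x : E} (hx : x ∈ deg E n) : degProj E n x = x := by
  let := (isInternal_deg (X := E)).chooseDecomposition
  exact DirectSum.decompose_of_mem_same (deg E) hx

theorem degProj_of_mem_ne {n k : ℤ} (h : k ≠ n) {x : E} (hx : x ∈ deg E k) : degProj E n x = 0 := by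
  let := (isInternal_deg (X := E)).chooseDecomposition
  exact DirectSum.decompose_of_mem_ne (deg E) hx h

theorem eq_zero_of_degProj {x : E} (h : ∀ n, degProj E n x = 0) : x = 0 := by
  let := (isInternal_deg (X := E)).chooseDecomposition
  refine (DirectSum.decomposeLinearEquiv (deg E)).injective ?_
  rw [map_zero]
  exact DirectSum.ext_component ℚ fun n => Subtype.ext (h n)

/-- The graded dual separates points. -/
theorem eq_zero_of_forall_gHom {x : E} (h : ∀ f : GHom E ℚ, f.val x = 0) : x = 0 := by
  refine eq_zero_of_degProj fun n => (Module.forall_dual_apply_eq_zero_iff ℚ _).1 fun g => ?_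
  have hg : g ∘ₗ degProj E n ∈ homDeg E ℚ (-n) := by
    intro k y hy
    by_cases hk : k = n
    · subst hk; simp [deg, GradedSpace.deg]
    · rw [LinearMap.comp_apply, degProj_of_mem_ne hk hy, map_zero]; exact zero_mem _
  exact h (GHom.mk _ (mem_gHom hg))

end PairTensor


/-! ### The square of the differentials -/

section SquareZero
set_option maxSynthPendingDepth 4
variable {L : Type*} [AddCommGroup L] [Module ℚ L] [DGLie L]
variable {N : Type*} [AddCommGroup N] [Module ℚ N] [GradedSpace N] [DGRep L N]

variable (L N) in
/-- The differential of `C_*(L; N)` followed by the augmentation. -/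
def counitChainsD : Chains L ⊗[ℚ] N →ₗ[ℚ] N :=
  TensorProduct.lift ((LinearMap.lsmul ℚ N).compl₁₂ (chainCounit L) (DGRep.d L)) -
    DGRep.act ∘ₗ TensorProduct.map (chainTau L) LinearMap.id

theorem counitChainsD_tmul (c : Chains L) (n : N) : counitChainsD L N (c ⊗ₜ n) =
    chainCounit L c • DGRep.d L n - DGRep.act (chainTau L c ⊗ₜ[ℚ] n) := rfl

theorem counitChainsD_eq : counitChainsD L N = (TensorProduct.lid ℚ N).toLinearMap ∘ₗ
    TensorProduct.map (chainCounit L) LinearMap.id ∘ₗ chainsD L N := by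
  refine tensor_ext_deg_left fun k c hc n => ?_
  have h1 := LinearMap.congr_fun (chainCounit_chainD (L := L)) c
  have h2 : (TensorProduct.lid ℚ N).toLinearMap ∘ₗ
      TensorProduct.map (chainCounit L) LinearMap.id ∘ₗ
      TensorProduct.map LinearMap.id DGRep.act ∘ₗ
      (TensorProduct.assoc ℚ (Chains L) L N).toLinearMap ∘ₗ
      (TensorProduct.mk ℚ (Chains L ⊗[ℚ] L) N).flip n ∘ₗ
      TensorProduct.map (sgn (Chains L)) (chainTau L) =
      DGRep.act ∘ₗ (TensorProduct.mk ℚ L N).flip n ∘ₗ chainTau L ∘ₗ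
      (TensorProduct.lid ℚ (Chains L)).toLinearMap ∘ₗ
        TensorProduct.map (chainCounit L) LinearMap.id := by
    refine tensor_ext_deg_left fun k x hx y => ?_
    have h := chainCounit_smul_zpow k 1 hx
    rw [one_mul] at h
    simp [sgn_of_mem hx, smul_smul, h, ← TensorProduct.smul_tmul']
  have h3 := LinearMap.congr_fun h2 (GSym.comul (Susp L) c)
  have h4 := LinearMap.congr_fun (comul_counit_left (L := L)) c
  simp only [LinearMap.comp_apply, LinearMap.id_apply] at h1 h3 h4
  rw [h4] at h3
  have h5 := chainCounit_smul_zpow k 1 hc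
  rw [one_mul] at h5
  rw [counitChainsD_tmul, chainsD_eq, LinearMap.comp_apply, LinearMap.comp_apply,
    LinearMap.sub_apply, tensorD_apply hc, map_sub, map_sub]
  congr 1
  · simp [h1, smul_smul, h5]
  · exact h3.symm

/-- This is the Maurer–Cartan equation of `τ`, acting on `n`. Only the augmentation of `d²` is
computed, because a cochain is determined by the augmentation of its operator. -/
theorem counitChainsD_chainsD (v : Chains L ⊗[ℚ] N) : counitChainsD L N (chainsD L N v) = 0 := by
  suffices h : counitChainsD L N ∘ₗ chainsD L N = 0 from LinearMap.congr_fun h v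
  refine tensor_ext_deg_left fun k c hc n => ?_
  have h1 := LinearMap.congr_fun (chainCounit_chainD (L := L)) c
  have hq := LinearMap.congr_fun (chainTau_chainD (L := L)) c
  have h5 := chainCounit_smul_zpow k 1 hc
  have hτ : chainTau L c ∈ deg L (k - 1) := chainTau_mem L k c hc
  have h2 : counitChainsD L N ∘ₗ TensorProduct.map LinearMap.id DGRep.act ∘ₗ
      (TensorProduct.assoc ℚ (Chains L) L N).toLinearMap ∘ₗ
      (TensorProduct.mk ℚ (Chains L ⊗[ℚ] L) N).flip n ∘ₗ
      TensorProduct.map (sgn (Chains L)) (chainTau L) =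
      DGRep.d L ∘ₗ DGRep.act ∘ₗ (TensorProduct.mk ℚ L N).flip n ∘ₗ chainTau L ∘ₗ
      (TensorProduct.lid ℚ (Chains L)).toLinearMap ∘ₗ
        TensorProduct.map (chainCounit L) LinearMap.id - tauTauAct L n := by
    refine tensor_ext_deg_left fun k x hx y => ?_
    have h := chainCounit_smul_zpow k 1 hx
    rw [one_mul] at h
    simp [sgn_of_mem hx, smul_smul, h, ← TensorProduct.smul_tmul', tauTauAct_tmul hx,
      counitChainsD_tmul, smul_sub]
  have h3 := LinearMap.congr_fun h2 (GSym.comul (Susp L) c)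
  have h4 := LinearMap.congr_fun (comul_counit_left (L := L)) c
  rw [LinearMap.sub_apply, ← maurer_cartan] at h3
  simp only [LinearMap.comp_apply, LinearMap.id_apply, LinearMap.zero_apply] at h1 h3 h4 hq
  rw [h4] at h3
  have h6 : counitChainsD L N (chainsTwist L N (c ⊗ₜ n)) = _ := h3
  rw [LinearMap.comp_apply, chainsD_eq, LinearMap.sub_apply, map_sub, h6, tensorD_apply hc, map_add,
    map_smul, counitChainsD_tmul, counitChainsD_tmul, h1, hq]
  simp only [LinearMap.flip_apply, TensorProduct.mk_apply, DGRep.d_act _ _ n hτ]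
  rw [DGRep.d_d, smul_zero, zero_smul, sign_congr (a := k - 1) (b := k + 1) (-1) (by ring),
    sign_add k 1, LinearMap.zero_apply]
  module

theorem cochainsD_sgn (f : Cochains L N) :
    sgn (Cochains L N) (cochainsD L N f) = -cochainsD L N (sgn (Cochains L N) f) := by
  rw [apply_sgn cochainsD_mem]; norm_num

namespace DiagonalModel

/-- The chain map `φ` is surjective, already on elements `a ⊗ 1`, so `D² = 0` descends from the
model to `∧V`. -/
theorem algD_algD (K : DiagonalModel L) (a : Alg L) : cochainsD L ℚ (cochainsD L ℚ a) = 0 := by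
  have h : a = K.φ (inclBase L (a ⊗ₜ cochainOne L)) := by
    rw [K.φ_base, cupRight_cochainOne]
  rw [h, ← K.φ_chain.apply, ← K.φ_chain.apply, K.D_D, map_zero]

/-- Up to sign the differential of `C^*L` is the transpose of that of `C_*L`, and the graded dual
separates points. -/
theorem chainD_chainD (K : DiagonalModel L) (c : Chains L) : chainD L (chainD L c) = 0 := by
  have h : ∀ (a : Alg L) (x : Chains L), (cochainsD L ℚ (sgn _ a)).val x = -a.val (chainD L x) := by
    intro a x
    have h1 := LinearMap.congr_fun (chainCounit_chainD (L := L)) (algOp L (sgn _ a) x)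
    rw [LinearMap.comp_apply, LinearMap.zero_apply] at h1
    rw [← counit_algOp, algOp_cochainsD, LinearMap.comp_apply, LinearMap.sub_apply, map_sub,
      LinearMap.comp_apply, h1, zero_sub, sgn_sgn, ← counit_algOp a]
    rfl
  refine eq_zero_of_forall_gHom fun a => ?_
  have h1 := h a (chainD L c)
  have h2 := h (cochainsD L ℚ (sgn _ a)) c
  rw [cochainsD_sgn, sgn_sgn, map_neg, K.algD_algD, neg_zero, map_zero, LinearMap.zero_apply, h1,
    neg_neg] at h2
  exact h2.symm

/-- The differential of the cochain complex has square zero. -/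
theorem cochainsD_cochainsD (K : DiagonalModel L) (f : Cochains L N) : cochainsD L N (cochainsD L N f) = 0 := by
  -- In the double commutator the mixed terms cancel and the square of the differential on `C_*L`
  -- vanishes, which leaves `d²` after the operator of `f`.
  have h : coext L N (cochainsD L N (cochainsD L N f)) =
      chainsD L N ∘ₗ chainsD L N ∘ₗ coext L N f := by
    refine LinearMap.ext fun c => ?_
    rw [coext_cochainsD, cochainsD_sgn, map_neg, coext_cochainsD, coext_cochainsD, sgn_sgn]
    simp only [LinearMap.comp_apply, LinearMap.sub_apply, LinearMap.neg_apply, map_sub,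
      K.chainD_chainD, map_zero]
    abel
  refine GHom.ext ?_
  rw [← counit_coext, h, ← LinearMap.comp_assoc, ← LinearMap.comp_assoc,
    LinearMap.comp_assoc _ _ (TensorProduct.lid ℚ N).toLinearMap, ← counitChainsD_eq]
  exact LinearMap.ext fun c => counitChainsD_chainsD _

end DiagonalModel

end SquareZero


/-! ### The relative model -/

section Model
set_option maxSynthPendingDepth 4
variable {L : Type*} [AddCommGroup L] [Module ℚ L] [DGLie L]

theorem alg2Mul_mem : alg2Mul L ∈ homDeg (Alg2 L ⊗[ℚ] Alg2 L) (Alg2 L) 0 :=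
  pairTensor_mem cupRight_mem cupRight_mem

theorem loopAlg2Mul_mem : loopAlg2Mul L ∈ homDeg (LoopAlg2 L ⊗[ℚ] Alg2 L) (LoopAlg2 L) 0 :=
  pairTensor_mem cupRight_mem cupRight_mem

theorem alg2D_mem : alg2D L ∈ homDeg (Alg2 L) (Alg2 L) (-1) :=
  tensorD_mem cochainsD_mem cochainsD_mem

theorem loopAlg2D_mem : loopAlg2D L ∈ homDeg (LoopAlg2 L) (LoopAlg2 L) (-1) :=
  tensorD_mem cochainsD_mem cochainsD_mem

theorem loopAlg2Mul_assoc (ξ : LoopAlg2 L) (r r' : Alg2 L) :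
    loopAlg2Mul L (loopAlg2Mul L (ξ ⊗ₜ r) ⊗ₜ r') = loopAlg2Mul L (ξ ⊗ₜ alg2Mul L (r ⊗ₜ r')) :=
  pairTensor_assoc cupRight_mem cupRight_mem cupRight_cupRight cupRight_cupRight ξ r r'

theorem loopAlg2Mul_one (ξ : LoopAlg2 L) :
    loopAlg2Mul L (ξ ⊗ₜ (cochainOne L ⊗ₜ cochainOne L)) = ξ := by
  induction ξ using tensor_induction_deg with
  | h0 => simp
  | hadd v w hv hw => simp only [TensorProduct.add_tmul, map_add, hv, hw]
  | h p q x hx y hy =>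
    rw [pairTensor_tmul _ _ hy cochainOne_mem, cupRight_cochainOne, cupRight_cochainOne]; simp

theorem alg2Mul_one (r : Alg2 L) : alg2Mul L (r ⊗ₜ (cochainOne L ⊗ₜ cochainOne L)) = r := by
  induction r using tensor_induction_deg with
  | h0 => simp
  | hadd v w hv hw => simp only [TensorProduct.add_tmul, map_add, hv, hw]
  | h p q x hx y hy =>
    rw [pairTensor_tmul _ _ hy cochainOne_mem, cupRight_cochainOne, cupRight_cochainOne]; simp

theorem loopAlg2D_mul (ξ : LoopAlg2 L) (r : Alg2 L) :
    loopAlg2D L (loopAlg2Mul L (ξ ⊗ₜ r)) = loopAlg2Mul L (loopAlg2D L ξ ⊗ₜ r) +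
      loopAlg2Mul L (sgn _ ξ ⊗ₜ alg2D L r) :=
  pairTensor_derivation cochainsD_mem cochainsD_mem cupRight_mem cochainsD_cupRight
    cochainsD_cupRight ξ r

theorem alg3Mul_inclBase (r r' : Alg2 L) (w : AlgBar L) :
    alg3Mul L (inclBase L r ⊗ₜ (r' ⊗ₜ w)) = alg2Mul L (r ⊗ₜ r') ⊗ₜ w := by
  have h : alg3Mul L ∘ₗ TensorProduct.mk ℚ (Alg3 L) (Alg3 L) (inclBase L r) ∘ₗ
      (TensorProduct.mk ℚ (Alg2 L) (AlgBar L)).flip w =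
      (TensorProduct.mk ℚ (Alg2 L) (AlgBar L)).flip w ∘ₗ alg2Mul L ∘ₗ
        TensorProduct.mk ℚ (Alg2 L) (Alg2 L) r := by
    refine hom_ext_deg fun p r' hr' => ?_
    have := pairTensor_tmul (ρ := alg2Mul L) (σ := LinearMap.mul' ℚ (AlgBar L)) r w
      (GSym.one_mem (V := GHom L ℚ)) hr'
    rw [zero_mul, zpow_zero, one_smul, LinearMap.mul'_apply, one_mul] at this
    exact this
  exact LinearMap.congr_fun h r'

theorem alg3Mul_inclBar (r : Alg2 L) (w : AlgBar L) :
    alg3Mul L (inclBase L r ⊗ₜ inclBar L w) = r ⊗ₜ w :=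
  (alg3Mul_inclBase r _ w).trans (by rw [alg2Mul_one])

theorem sgn_inclBase (r : Alg2 L) : sgn (Alg3 L) (inclBase L r) = inclBase L (sgn _ r) := by
  show sgn (Alg2 L) r ⊗ₜ sgn (AlgBar L) 1 = _
  rw [sgn_of_mem GSym.one_mem, zpow_zero, one_smul]
  rfl

variable (L) in
/-- The map `(E ⊗ E) ⊗ (∧V ⊗ ∧V' ⊗ ∧V̄) → E ⊗ E ⊗ ∧V̄`. -/
def loopAct : LoopAlg2 L ⊗[ℚ] Alg3 L →ₗ[ℚ] LoopAlg3 L :=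
  TensorProduct.map (loopAlg2Mul L) LinearMap.id ∘ₗ
    (TensorProduct.assoc ℚ (LoopAlg2 L) (Alg2 L) (AlgBar L)).symm.toLinearMap

theorem loopAct_tmul (ξ : LoopAlg2 L) (r : Alg2 L) (w : AlgBar L) :
    loopAct L (ξ ⊗ₜ (r ⊗ₜ w)) = loopAlg2Mul L (ξ ⊗ₜ r) ⊗ₜ w := rfl

theorem loopAct_inclBar (ξ : LoopAlg2 L) (w : AlgBar L) : loopAct L (ξ ⊗ₜ inclBar L w) = ξ ⊗ₜ w :=
  (loopAct_tmul ξ _ w).trans (by rw [loopAlg2Mul_one])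

/-- Scalars from `∧V ⊗ ∧V'` pass from `ξ` to `b`: the map behaves like the projection onto the
tensor product over `∧V ⊗ ∧V'`. Formulas given on `ξ ⊗ w` extend in this way to all `ξ · b`, where
Leibniz rules can be applied without expanding `D w`. -/
theorem loopAct_mul (ξ : LoopAlg2 L) (r : Alg2 L) (b : Alg3 L) :
    loopAct L (loopAlg2Mul L (ξ ⊗ₜ r) ⊗ₜ b) =
      loopAct L (ξ ⊗ₜ alg3Mul L (inclBase L r ⊗ₜ b)) := by
  induction b using TensorProduct.induction_on with
  | zero => simp
  | add v w hv hw => simp only [TensorProduct.tmul_add, map_add, hv, hw]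
  | tmul r' w => rw [alg3Mul_inclBase, loopAct_tmul, loopAct_tmul, loopAlg2Mul_assoc]

/-- Two linear maps on `E ⊗ E ⊗ ∧V̄` that agree on the elements `ξ · w` are equal. -/
theorem loopAlg3_ext {Z : Type*} [AddCommGroup Z] [Module ℚ Z] {F G : LoopAlg3 L →ₗ[ℚ] Z}
    (h : ∀ ξ b, F (loopAct L (ξ ⊗ₜ b)) = G (loopAct L (ξ ⊗ₜ b))) : F = G :=
  TensorProduct.ext' fun ξ w => by simpa only [loopAct_inclBar] using h ξ (inclBar L w)

/-- An action of `∧V ⊗ ∧V'` that is linear on generators `w ∈ ∧V̄` extends. -/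
theorem linear_extend {Z : Type*} [AddCommGroup Z] [Module ℚ Z] {F G : Alg3 L →ₗ[ℚ] Z}
    (h : ∀ r w, F (alg3Mul L (inclBase L r ⊗ₜ inclBar L w)) =
      G (alg3Mul L (inclBase L r ⊗ₜ inclBar L w))) : F = G :=
  TensorProduct.ext' fun r w => by simpa only [alg3Mul_inclBar] using h r w

namespace DiagonalModel
variable (K : DiagonalModel L)

theorem D_base_mul (r : Alg2 L) (b : Alg3 L) : K.D (alg3Mul L (inclBase L r ⊗ₜ b)) =
    alg3Mul L (inclBase L (alg2D L r) ⊗ₜ b) + alg3Mul L (inclBase L (sgn _ r) ⊗ₜ K.D b) := by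
  rw [K.D_mul, K.D_base, sgn_inclBase]

theorem φ_base_mul (r : Alg2 L) (b : Alg3 L) : K.φ (alg3Mul L (inclBase L r ⊗ₜ b)) =
    algMul L (algMul L r ⊗ₜ K.φ b) := by
  rw [K.φ_mul, K.φ_base]

theorem loopD_tmul (ξ : LoopAlg2 L) (w : AlgBar L) : K.loopD (ξ ⊗ₜ w) =
    loopAlg2D L ξ ⊗ₜ w + loopAct L (sgn _ ξ ⊗ₜ K.D (inclBar L w)) := rfl

/-- The Leibniz rule for `D'`. -/
theorem loopD_loopAct (ξ : LoopAlg2 L) (b : Alg3 L) : K.loopD (loopAct L (ξ ⊗ₜ b)) =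
    loopAct L (loopAlg2D L ξ ⊗ₜ b) + loopAct L (sgn _ ξ ⊗ₜ K.D b) := by
  suffices h : K.loopD ∘ₗ loopAct L ∘ₗ TensorProduct.mk ℚ _ _ ξ =
      loopAct L ∘ₗ TensorProduct.mk ℚ _ _ (loopAlg2D L ξ) +
      loopAct L ∘ₗ TensorProduct.mk ℚ _ _ (sgn _ ξ) ∘ₗ K.D from LinearMap.congr_fun h b
  refine linear_extend fun r w => ?_
  change K.loopD (loopAct L (ξ ⊗ₜ alg3Mul L (inclBase L r ⊗ₜ inclBar L w))) =
    loopAct L (loopAlg2D L ξ ⊗ₜ alg3Mul L (inclBase L r ⊗ₜ inclBar L w)) +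
      loopAct L (sgn _ ξ ⊗ₜ K.D (alg3Mul L (inclBase L r ⊗ₜ inclBar L w)))
  rw [← loopAct_mul, loopAct_inclBar, loopD_tmul, loopAlg2D_mul, D_base_mul,
    sgn_of_homDeg_zero loopAlg2Mul_mem, sgn_tmul, TensorProduct.tmul_add, map_add, loopAct_mul,
    ← loopAct_mul (loopAlg2D L ξ), loopAct_inclBar, ← loopAct_mul _ (alg2D L r), loopAct_inclBar,
    TensorProduct.add_tmul]
  abel

/-- It suffices to take `b = r · w`. The scalar `r` then moves into the cup product by `cup_mul`,
while `φ(r · w) = μ(r) φ(w)`. -/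
theorem loopPhi_loopAct (ξ : LoopAlg2 L) (b : Alg3 L) : K.loopPhi (loopAct L (ξ ⊗ₜ b)) =
    cupRight L (UDual L ⊗[ℚ] UDual L) (cup L (UDual L) (UDual L) ξ ⊗ₜ K.φ b) := by
  suffices h : K.loopPhi ∘ₗ loopAct L ∘ₗ TensorProduct.mk ℚ _ _ ξ =
      cupRight L (UDual L ⊗[ℚ] UDual L) ∘ₗ
        TensorProduct.mk ℚ _ _ (cup L (UDual L) (UDual L) ξ) ∘ₗ K.φ from LinearMap.congr_fun h b
  refine linear_extend fun r w => ?_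
  change K.loopPhi (loopAct L (ξ ⊗ₜ alg3Mul L (inclBase L r ⊗ₜ inclBar L w))) =
    cupRight L _ (cup L _ _ ξ ⊗ₜ K.φ (alg3Mul L (inclBase L r ⊗ₜ inclBar L w)))
  rw [← loopAct_mul, loopAct_inclBar, φ_base_mul, ← cupRight_cupRight, ← cup_mul]
  rfl

theorem loopPhi_isChainMap :
    IsChainMap K.loopD (cochainsD L (UDual L ⊗[ℚ] UDual L)) K.loopPhi := by
  refine loopAlg3_ext fun ξ b => ?_
  rw [LinearMap.comp_apply, LinearMap.comp_apply, loopD_loopAct, map_add, loopPhi_loopAct,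
    loopPhi_loopAct, loopPhi_loopAct, cochainsD_cupRight, cup_isChainMap.apply, K.φ_chain.apply,
    sgn_of_homDeg_zero cup_mem]

theorem loopMuT_tmul (μT : Alg3 L →ₗ[ℚ] Alg2 L) (ξ : LoopAlg2 L) (w : AlgBar L) :
    loopMuT μT (ξ ⊗ₜ w) = loopAlg2Mul L (ξ ⊗ₜ μT (inclBar L w)) := rfl

/-- Linearity of `μ_T` over `∧V ⊗ ∧V'` moves the scalar of `b = r · w` back to `ξ`. -/
theorem loopMuT_loopAct {m : ℕ} {T : Alg2 L} {μT : Alg3 L →ₗ[ℚ] Alg2 L}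
    (hμT : ExtendsMulBy K m T μT) (ξ : LoopAlg2 L) (b : Alg3 L) :
    loopMuT μT (loopAct L (ξ ⊗ₜ b)) = loopAlg2Mul L (ξ ⊗ₜ μT b) := by
  induction b using TensorProduct.induction_on with
  | zero => simp only [TensorProduct.tmul_zero, map_zero]
  | add v w hv hw => simp only [TensorProduct.tmul_add, map_add, hv, hw]
  | tmul r w =>
    rw [← alg3Mul_inclBar, ← loopAct_mul, loopAct_inclBar, hμT.linear, ← loopAlg2Mul_assoc,
      loopMuT_tmul]

theorem loopMuT_isChainMap {m : ℕ} {T : Alg2 L} {μT : Alg3 L →ₗ[ℚ] Alg2 L}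
    (hμT : ExtendsMulBy K m T μT) : IsChainMap K.loopD (loopAlg2D L) (loopMuT μT) := by
  refine loopAlg3_ext fun ξ b => ?_
  rw [LinearMap.comp_apply, LinearMap.comp_apply, loopD_loopAct, map_add, loopMuT_loopAct K hμT,
    loopMuT_loopAct K hμT, loopMuT_loopAct K hμT, loopAlg2D_mul, hμT.chain.apply]

theorem loopD_loopD (x : LoopAlg3 L) : K.loopD (K.loopD x) = 0 := by
  suffices h : K.loopD ∘ₗ K.loopD = 0 from LinearMap.congr_fun h x
  refine loopAlg3_ext fun ξ b => ?_
  have h1 : loopAlg2D L (loopAlg2D L ξ) = 0 :=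
    tensorD_tensorD cochainsD_mem K.cochainsD_cochainsD K.cochainsD_cochainsD ξ
  have h2 : sgn (LoopAlg2 L) (loopAlg2D L ξ) = -loopAlg2D L (sgn _ ξ) := by
    rw [apply_sgn loopAlg2D_mem]; norm_num
  rw [LinearMap.comp_apply, loopD_loopAct, map_add, loopD_loopAct, loopD_loopAct, h1, h2, K.D_D,
    TensorProduct.neg_tmul, map_neg]
  simp

end DiagonalModel

end Model


/-! ### Surjective quasi-isomorphisms -/

section SurjectiveQuasiIso
variable {X Y : Type*} [AddCommGroup X] [Module ℚ X] [AddCommGroup Y] [Module ℚ Y]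
  {dX : X →ₗ[ℚ] X} {dY : Y →ₗ[ℚ] Y} {f : X →ₗ[ℚ] Y}

theorem homologyMap_mk (hf : IsChainMap dX dY f) (x : LinearMap.ker dX) (y : LinearMap.ker dY)
    (h : f x = y) : homologyMap hf (Submodule.Quotient.mk x) = Submodule.Quotient.mk y := by
  rw [homologyMap, Submodule.mapQ_apply]
  congr 1
  exact Subtype.ext h

theorem homology_mk_eq_zero (x : LinearMap.ker dX) :
    (Submodule.Quotient.mk x : Homology dX) = 0 ↔ ∃ w, dX w = x := by
  rw [Submodule.Quotient.mk_eq_zero]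
  exact Iff.rfl

/-- The kernel of a surjective quasi-isomorphism is acyclic. -/
theorem exists_of_ker_of_bijective (hf : IsChainMap dX dY f) (hX : ∀ x, dX (dX x) = 0)
    (hs : Function.Surjective f) (hb : Function.Bijective (homologyMap hf)) {z : X}
    (hz : f z = 0) (hdz : dX z = 0) :
    ∃ w, f w = 0 ∧ dX w = z := by
  have h1 : (Submodule.Quotient.mk ⟨z, hdz⟩ : Homology dX) = 0 := by
    refine hb.1 ?_
    rw [homologyMap_mk hf ⟨z, hdz⟩ 0 hz, map_zero]
    rfl
  obtain ⟨w, hw⟩ := (homology_mk_eq_zero _).1 h1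
  have hfw : dY (f w) = 0 := by rw [← hf.apply, hw, hz]
  obtain ⟨c, hc⟩ := hb.2 (Submodule.Quotient.mk ⟨f w, hfw⟩)
  obtain ⟨⟨v, hv⟩, rfl⟩ := Submodule.Quotient.mk_surjective _ c
  have hfv : dY (f v) = 0 := by rw [← hf.apply, LinearMap.mem_ker.1 hv, map_zero]
  rw [homologyMap_mk hf _ ⟨f v, hfv⟩ rfl, ← sub_eq_zero, ← Submodule.Quotient.mk_sub] at hc
  obtain ⟨a, ha⟩ := (homology_mk_eq_zero _).1 hc
  obtain ⟨b, rfl⟩ := hs a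
  -- The element `w` bounds `z`, but `f w` is only a cycle. The cycle `v` has an image homologous to
  -- `f w`, and `b` lifts an element bounding `f v - f w`, so the correction by `v` and `dX b` puts
  -- the result into the kernel without changing its boundary.
  refine ⟨w - v + dX b, ?_, ?_⟩
  · rw [map_add, hf.apply, ha, map_sub]
    simp
  · rw [map_add, hX, add_zero, map_sub, LinearMap.mem_ker.1 hv, sub_zero, hw]

/-- A surjective chain map with acyclic kernel is a quasi-isomorphism. -/
theorem homologyMap_bijective (hf : IsChainMap dX dY f) (hX : ∀ x, dX (dX x) = 0)
    (hs : Function.Surjective f) (h : ∀ z, f z = 0 → dX z = 0 → ∃ w, f w = 0 ∧ dX w = z) :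
    Function.Bijective (homologyMap hf) := by
  constructor
  · rw [injective_iff_map_eq_zero]
    intro c hc
    obtain ⟨⟨x, hx⟩, rfl⟩ := Submodule.Quotient.mk_surjective _ c
    have hfx : dY (f x) = 0 := by rw [← hf.apply, LinearMap.mem_ker.1 hx, map_zero]
    rw [homologyMap_mk hf _ ⟨f x, hfx⟩ rfl] at hc
    obtain ⟨a, ha⟩ := (homology_mk_eq_zero _).1 hc
    obtain ⟨b, rfl⟩ := hs a
    obtain ⟨w, -, hw⟩ := h (x - dX b) (by rw [map_sub, hf.apply, ha, sub_self])
      (by rw [map_sub, hX, LinearMap.mem_ker.1 hx, sub_zero])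
    refine (homology_mk_eq_zero _).2 ⟨w + b, ?_⟩
    rw [map_add, hw, sub_add_cancel]
  · intro c
    obtain ⟨⟨y, hy⟩, rfl⟩ := Submodule.Quotient.mk_surjective _ c
    obtain ⟨x, rfl⟩ := hs y
    obtain ⟨w, hw, hdw⟩ := h (dX x) (by rw [hf.apply, LinearMap.mem_ker.1 hy]) (hX x)
    refine ⟨Submodule.Quotient.mk ⟨x - w, ?_⟩, homologyMap_mk hf _ _ ?_⟩
    · rw [LinearMap.mem_ker, map_sub, hdw, sub_self]
    · simp [hw]

/-- An acyclic subcomplex has a contracting homotopy. -/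
theorem exists_contraction {J : Submodule ℚ X} (hX : ∀ x, dX (dX x) = 0)
    (hJ : ∀ x ∈ J, dX x ∈ J) (h : ∀ z ∈ J, dX z = 0 → ∃ w ∈ J, dX w = z) :
    ∃ s : X →ₗ[ℚ] X, (∀ x, s x ∈ J) ∧ ∀ x ∈ J, dX (s x) + s (dX x) = x := by
  let C : Submodule ℚ X := J ⊓ LinearMap.ker dX
  let D : J →ₗ[ℚ] C := (dX ∘ₗ J.subtype).codRestrict C fun x => ⟨hJ _ x.2, hX _⟩
  have hD : Function.Surjective D := by
    rintro ⟨z, hz, hdz⟩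
    obtain ⟨w, hw, rfl⟩ := h z hz hdz
    exact ⟨⟨w, hw⟩, rfl⟩
  obtain ⟨s, hs⟩ := LinearMap.exists_rightInverse_of_surjective D (LinearMap.range_eq_top.2 hD)
  have hs' : ∀ z, dX (s z) = z := fun z => congrArg Subtype.val (LinearMap.congr_fun hs z)
  -- With `s` a linear section of the differential from `J` onto its cycles, `p = 1 - s d` projects
  -- `J` onto the cycles. The homotopy is `s ∘ p`, extended arbitrarily to the whole space: `d s p x
  -- = x - s d x`, while `s p d x = s d x`.
  let p : J →ₗ[ℚ] C := (J.subtype - J.subtype ∘ₗ s ∘ₗ D).codRestrict C fun x => by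
    refine ⟨sub_mem x.2 (Submodule.coe_mem _), ?_⟩
    show dX ((x : X) - (s (D x) : X)) = 0
    rw [map_sub]
    exact sub_eq_zero.2 (hs' (D x)).symm
  obtain ⟨g, hg⟩ := (s ∘ₗ p).exists_extend
  refine ⟨J.subtype ∘ₗ g, fun x => Submodule.coe_mem _, fun x hx => ?_⟩
  have hg' : ∀ y (hy : y ∈ J), g y = s (p ⟨y, hy⟩) := fun y hy => LinearMap.congr_fun hg ⟨y, hy⟩
  have h1 : p ⟨dX x, hJ x hx⟩ = D ⟨x, hx⟩ := by
    have : D ⟨dX x, hJ x hx⟩ = 0 := Subtype.ext (hX x)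
    refine Subtype.ext ?_
    show dX x - (s (D ⟨dX x, hJ x hx⟩) : X) = dX x
    rw [this, map_zero]; simp
  rw [LinearMap.comp_apply, LinearMap.comp_apply, hg' x hx, hg' _ (hJ x hx), h1]
  show dX (s (p ⟨x, hx⟩)) + (s (D ⟨x, hx⟩) : X) = x
  rw [hs']
  show x - (s (D ⟨x, hx⟩) : X) + (s (D ⟨x, hx⟩) : X) = x
  rw [sub_add_cancel]

end SurjectiveQuasiIso

/-! ### Finiteness -/

section Finiteness
variable {V : Type*} [AddCommGroup V] [Module ℚ V] [GradedSpace V]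
  {Q : Type*} [Ring Q] [Algebra ℚ Q] {j : V →ₗ[ℚ] Q}

theorem IsWord.eq_zero_or (hV : ∀ n ≤ 0, deg V n = ⊥) {n : ℤ} {w : Q} (hw : IsWord j n w) :
    w = 0 ∨ (n = 0 ∧ w = 1) ∨ 0 < n := by
  induction hw with
  | one => exact Or.inr (Or.inl ⟨rfl, rfl⟩)
  | @cons p n x w hx _ ih =>
    by_cases hp : p ≤ 0
    · rw [hV p hp, Submodule.mem_bot] at hx
      left; rw [hx, map_zero, zero_mul]
    · rcases ih with rfl | ⟨rfl, rfl⟩ | h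
      · left; rw [mul_zero]
      · right; right; omega
      · right; right; omega

theorem span_isWord_eq_bot (hV : ∀ n ≤ 0, deg V n = ⊥) {n : ℤ} (hn : n < 0) :
    Submodule.span ℚ {w | IsWord j n w} = ⊥ := by
  rw [Submodule.span_eq_bot]
  intro w hw
  rcases hw.eq_zero_or hV with h | ⟨h, -⟩ | h
  · exact h
  · omega
  · omega

theorem span_isWord_zero (hV : ∀ n ≤ 0, deg V n = ⊥) :
    Submodule.span ℚ {w | IsWord j 0 w} ≤ Submodule.span ℚ {1} := by
  rw [Submodule.span_le]
  intro w hw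
  rcases hw.eq_zero_or hV with rfl | ⟨-, rfl⟩ | h
  · exact zero_mem _
  · exact Submodule.mem_span_singleton_self 1
  · omega

/-- A nonempty word is a letter of positive degree times a word of smaller degree, so strong
induction on the degree applies. -/
theorem finiteDimensional_span_isWord (hV : ∀ n ≤ 0, deg V n = ⊥)
    (hfin : ∀ n, FiniteDimensional ℚ (deg V n)) (n : ℤ) :
    FiniteDimensional ℚ (Submodule.span ℚ {w | IsWord j n w}) := by
  rcases lt_or_ge n 0 with hn | hn
  · rw [span_isWord_eq_bot hV hn]; infer_instance
  obtain ⟨k, rfl⟩ := Int.eq_ofNat_of_zero_le hn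
  induction k using Nat.strong_induction_on with
  | h k ih =>
    -- The summand spanned by `1` accounts for the empty word; it is needed only in degree `0` but
    -- does no harm elsewhere.
    let S : Submodule ℚ Q := Submodule.span ℚ {1} ⊔ ⨆ i : Fin k,
      Submodule.map₂ (LinearMap.mul ℚ Q) ((deg V (k - i)).map j)
        (Submodule.span ℚ {w | IsWord j (i : ℕ) w})
    have hS : FiniteDimensional ℚ S := by
      have : ∀ i : Fin k, FiniteDimensional ℚ (Submodule.map₂ (LinearMap.mul ℚ Q)
          ((deg V (k - i)).map j) (Submodule.span ℚ {w | IsWord j (i : ℕ) w})) := by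
        intro i
        have h1 := ih i i.2 (by omega)
        have h2 := hfin (k - i)
        rw [← Submodule.fg_iff_finiteDimensional] at h1 h2 ⊢
        exact (h2.map j).map₂ _ h1
      infer_instance
    refine Submodule.finiteDimensional_of_le (S₂ := S) (Submodule.span_le.2 ?_)
    intro w hw
    generalize hm : ((k : ℕ) : ℤ) = m at hw
    cases hw with
    | one => exact Submodule.mem_sup_left (Submodule.mem_span_singleton_self 1)
    | @cons p n x w hx hw =>
      by_cases hp : p ≤ 0
      · rw [hV p hp, Submodule.mem_bot] at hx
        rw [hx, map_zero, zero_mul]; exact zero_mem _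
      rcases hw.eq_zero_or hV with h0 | h0
      · rw [h0, mul_zero]; exact zero_mem _
      have hn0 : 0 ≤ n := by rcases h0 with h | h <;> omega
      obtain ⟨i, rfl⟩ := Int.eq_ofNat_of_zero_le hn0
      refine Submodule.mem_sup_right (Submodule.mem_iSup_of_mem ⟨i, by omega⟩ ?_)
      refine Submodule.apply_mem_map₂ _ (Submodule.mem_map_of_mem ?_) (Submodule.subset_span hw)
      convert hx using 2
      show (k : ℤ) - i = p
      omega

variable {L : Type*} [AddCommGroup L] [Module ℚ L] [DGLie L]

theorem deg_susp_eq_bot (hpos : ∀ n : ℤ, n ≤ 0 → deg L n = ⊥) (n : ℤ) (hn : n ≤ 1) :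
    deg (Susp L) n = ⊥ := by
  rw [eq_bot_iff]
  intro x hx
  have hx' : (susp L).symm x ∈ deg L (n - 1) := hx
  rw [hpos _ (by omega), Submodule.mem_bot] at hx'
  simpa using hx'

theorem chains_deg_eq_bot (hpos : ∀ n : ℤ, n ≤ 0 → deg L n = ⊥) {n : ℤ} (hn : n < 0) :
    deg (Chains L) n = ⊥ :=
  span_isWord_eq_bot (fun n hn => deg_susp_eq_bot hpos n (by omega)) hn

theorem chains_deg_zero (hpos : ∀ n : ℤ, n ≤ 0 → deg L n = ⊥) :
    deg (Chains L) 0 ≤ Submodule.span ℚ {1} :=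
  span_isWord_zero (fun n hn => deg_susp_eq_bot hpos n (by omega))

theorem chains_deg_finite (hpos : ∀ n : ℤ, n ≤ 0 → deg L n = ⊥)
    (hfin : ∀ n : ℤ, FiniteDimensional ℚ (deg L n)) (n : ℤ) :
    FiniteDimensional ℚ (deg (Chains L) n) := by
  refine finiteDimensional_span_isWord (fun n hn => deg_susp_eq_bot hpos n (by omega)) ?_ n
  intro n
  have := hfin (n - 1)
  exact LinearEquiv.finiteDimensional (V := deg L (n - 1)) (V₂ := deg (Susp L) n)
    { toFun := fun x => ⟨susp L x.1, x.2⟩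
      invFun := fun x => ⟨(susp L).symm x.1, x.2⟩
      left_inv := fun x => rfl
      right_inv := fun x => rfl
      map_add' := fun x y => rfl
      map_smul' := fun a x => rfl }

theorem gHom_rat_apply_eq_zero {X : Type*} [AddCommGroup X] [Module ℚ X] [GradedSpace X] {n k : ℤ}
    {f : GHom X ℚ} (hf : f ∈ deg (GHom X ℚ) n) {x : X} (hx : x ∈ deg X k) (h : k + n ≠ 0) :
    f.val x = 0 := by
  have h1 : f.val x ∈ deg ℚ (k + n) := hf k x hx
  simpa [deg, GradedSpace.deg, h] using h1

theorem gHom_rat_deg_eq_bot {X : Type*} [AddCommGroup X] [Module ℚ X] [GradedSpace X]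
    (hX : ∀ n < 0, deg X n = ⊥) {n : ℤ} (hn : 0 < n) : deg (GHom X ℚ) n = ⊥ := by
  rw [eq_bot_iff]
  intro f hf
  refine (Submodule.mem_bot ℚ).2 (GHom.ext (hom_ext_deg fun k x hx => ?_))
  rcases lt_or_ge k 0 with hk | hk
  · rw [hX k hk, Submodule.mem_bot] at hx
    rw [hx, map_zero, map_zero]
  · exact (gHom_rat_apply_eq_zero hf hx (by omega)).trans (by simp)

theorem uDual_deg_eq_bot (hpos : ∀ n : ℤ, n ≤ 0 → deg L n = ⊥) {n : ℤ} (hn : 0 < n) :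
    deg (UDual L) n = ⊥ :=
  gHom_rat_deg_eq_bot (fun _ hn => span_isWord_eq_bot hpos hn) hn

/-- `C^*(L)` is connected. -/
theorem alg_deg_zero (hpos : ∀ n : ℤ, n ≤ 0 → deg L n = ⊥) {a : Alg L} (ha : a ∈ deg (Alg L) 0) :
    a = a.val 1 • cochainOne L := by
  refine GHom.ext (hom_ext_deg fun k x hx => ?_)
  have h1 : (a.val 1 • cochainOne L).val x = a.val 1 * chainCounit L x := rfl
  rw [h1]
  by_cases hk : k = 0
  · subst hk
    obtain ⟨t, rfl⟩ := Submodule.mem_span_singleton.1 (chains_deg_zero hpos hx)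
    rw [map_smul, map_smul, chainCounit_one, smul_eq_mul, smul_eq_mul]; ring
  · rw [gHom_rat_apply_eq_zero ha hx (by simpa using hk), chainCounit_of_mem hk hx, mul_zero]

end Finiteness


/-! ### Cochains and tensor products -/

section Evaluation
set_option maxSynthPendingDepth 4
variable {X N : Type*} [AddCommGroup X] [Module ℚ X] [GradedSpace X] [AddCommGroup N] [Module ℚ N]

variable (X N) in
/-- The map `N ⊗ X^∨ → Hom(X, N)`, `n ⊗ a ↦ (x ↦ a(x) n)`. -/
def gHomEval : N ⊗[ℚ] GHom X ℚ →ₗ[ℚ] (X →ₗ[ℚ] N) :=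
  TensorProduct.lift (LinearMap.mk₂ ℚ (fun n a => LinearMap.toSpanSingleton ℚ N n ∘ₗ a.val)
    (fun n n' a => by ext; simp [LinearMap.toSpanSingleton_apply])
    (fun t n a => by
      ext x; simp only [LinearMap.comp_apply, LinearMap.toSpanSingleton_apply, LinearMap.smul_apply]
      rw [smul_comm])
    (fun n a a' => by ext; simp [LinearMap.toSpanSingleton_apply, add_smul])
    (fun t n a => by ext; simp [LinearMap.toSpanSingleton_apply, mul_smul]))

theorem gHomEval_tmul (n : N) (a : GHom X ℚ) (x : X) : gHomEval X N (n ⊗ₜ a) x = a.val x • n := rfl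

/-- In a basis of `N` the coordinates of `y` are functionals on `X`, and their values are the
coordinates of the values of the associated map. -/
theorem gHomEval_injective : Function.Injective (gHomEval X N) := by
  classical
  rw [injective_iff_map_eq_zero]
  intro y hy
  let b := Module.Basis.ofVectorSpace ℚ N
  let e := TensorProduct.equivFinsuppOfBasisLeft (N := GHom X ℚ) b
  have key : ∀ (y : N ⊗[ℚ] GHom X ℚ) i x, (e y i).val x = b.coord i (gHomEval X N y x) := by
    intro y i x
    induction y using TensorProduct.induction_on with
    | zero => simp
    | add v w hv hw => simp only [map_add, Finsupp.add_apply, LinearMap.add_apply, hv, hw]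
    | tmul n a =>
      simp [e, gHomEval_tmul, mul_comm]
  refine e.injective ?_
  rw [map_zero]
  refine Finsupp.ext fun i => GHom.ext (LinearMap.ext fun x => ?_)
  rw [key, hy]
  simp

theorem gHomEval_naturality {N' : Type*} [AddCommGroup N'] [Module ℚ N'] (g : N →ₗ[ℚ] N')
    (y : N ⊗[ℚ] GHom X ℚ) :
    gHomEval X N' (TensorProduct.map g LinearMap.id y) = g ∘ₗ gHomEval X N y := by
  induction y using TensorProduct.induction_on with
  | zero => simp
  | add v w hv hw => simp only [map_add, LinearMap.comp_add, hv, hw]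
  | tmul n a => ext x; simp [gHomEval_tmul]

/-- An element of `N ⊗ X^∨` whose values lie in a subspace comes from that subspace. -/
theorem mem_range_of_gHomEval (P : Submodule ℚ N) {y : N ⊗[ℚ] GHom X ℚ}
    (h : ∀ x, gHomEval X N y x ∈ P) :
    y ∈ LinearMap.range (TensorProduct.map P.subtype (LinearMap.id (M := GHom X ℚ))) := by
  have h1 : TensorProduct.map P.mkQ (LinearMap.id (M := GHom X ℚ)) y = 0 := by
    refine gHomEval_injective ?_
    rw [gHomEval_naturality, map_zero]
    refine LinearMap.ext fun x => ?_
    exact (Submodule.Quotient.mk_eq_zero P).2 (h x)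
  have h2 := rTensor_exact (GHom X ℚ) (f := P.subtype) (g := P.mkQ)
    (LinearMap.exact_subtype_mkQ P) P.mkQ_surjective
  exact (h2 y).1 h1

/-- With a finite basis `b_i` of the component `X_k`, the map is `∑ F(b_i) ⊗ b_i^*`, where the dual
basis vanishes in all other degrees. -/
theorem comp_degProj_mem_range (k : ℤ) [FiniteDimensional ℚ (deg X k)] (F : X →ₗ[ℚ] N) :
    F ∘ₗ degProj X k ∈ LinearMap.range (gHomEval X N) := by
  let b := Module.finBasis ℚ (deg X k)
  let p : X →ₗ[ℚ] deg X k := (degProj X k).codRestrict _ (degProj_mem k)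
  have hp : ∀ i, b.coord i ∘ₗ p ∈ homDeg X ℚ (-k) := by
    intro i l x hx
    by_cases hl : l = k
    · subst hl; simp [deg, GradedSpace.deg]
    · have : p x = 0 := Subtype.ext (degProj_of_mem_ne hl hx)
      rw [LinearMap.comp_apply, this, map_zero]; exact zero_mem _
  refine ⟨∑ i, F (b i) ⊗ₜ GHom.mk _ (mem_gHom (hp i)), LinearMap.ext fun x => ?_⟩
  rw [map_sum, LinearMap.sum_apply]
  simp only [gHomEval_tmul, GHom.val_mk, LinearMap.comp_apply, Module.Basis.coord_apply]
  have h1 : F (degProj X k x) = (F ∘ₗ (deg X k).subtype) (∑ i, b.repr (p x) i • b i) := by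
    rw [b.sum_repr]; rfl
  rw [h1, map_sum]
  simp

/-- A map of degree `n` sends `X_k` to `N_{k+n}`, which vanishes for `k > -n`. Only the finitely
many degrees `0 ≤ k ≤ -n` contribute, each of them finite dimensional. -/
theorem val_mem_range_gHomEval [GradedSpace N] (hX : ∀ k < 0, deg X k = ⊥)
    (hfin : ∀ k, FiniteDimensional ℚ (deg X k)) (hN : ∀ k > 0, deg N k = ⊥) (f : GHom X N) :
    f.val ∈ LinearMap.range (gHomEval X N) := by
  induction f using deg_induction with
  | h0 => simp
  | hadd a b ha hb => rw [map_add]; exact add_mem ha hb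
  | h n f hf =>
    have : f.val = ∑ k ∈ Finset.Icc 0 (-n), f.val ∘ₗ degProj X k := by
      refine hom_ext_deg fun q x hx => ?_
      rw [LinearMap.sum_apply]
      by_cases hq : q ∈ Finset.Icc 0 (-n)
      · rw [Finset.sum_eq_single_of_mem q hq, LinearMap.comp_apply, degProj_of_mem hx]
        intro k _ hk
        rw [LinearMap.comp_apply, degProj_of_mem_ne (Ne.symm hk) hx, map_zero]
      · rw [Finset.sum_eq_zero]
        · rw [Finset.mem_Icc, not_and_or, not_le, not_le] at hq
          rcases hq with hq | hq
          · rw [hX q hq, Submodule.mem_bot] at hx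
            rw [hx, map_zero]
          · have h1 : f.val x ∈ deg N (q + n) := hf q x hx
            rwa [hN _ (by omega), Submodule.mem_bot] at h1
        · intro k hk
          rw [LinearMap.comp_apply, degProj_of_mem_ne (by rintro rfl; exact hq hk) hx, map_zero]
    rw [this]
    refine Submodule.sum_mem _ fun k _ => ?_
    have := hfin k
    exact comp_degProj_mem_range k _

end Evaluation

/-! ### Cochains as `N ⊗ C^*(L)` -/

section ConstAct
set_option maxSynthPendingDepth 4
variable {L : Type*} [AddCommGroup L] [Module ℚ L] [DGLie L]
variable {N : Type*} [AddCommGroup N] [Module ℚ N] [GradedSpace N]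

variable (L N) in
/-- The map `N ⊗ C^*(L) → C^*(L; N)`, `n ⊗ a ↦ n · a`. -/
def constAct : N ⊗[ℚ] Alg L →ₗ[ℚ] Cochains L N :=
  cupRight L N ∘ₗ TensorProduct.map (constCochain L N) LinearMap.id

theorem constAct_tmul (n : N) (a : Alg L) :
    constAct L N (n ⊗ₜ a) = cupRight L N (constCochain L N n ⊗ₜ a) := rfl

theorem constAct_val (y : N ⊗[ℚ] Alg L) : (constAct L N y).val = gHomEval (Chains L) N y := by
  induction y using TensorProduct.induction_on with
  | zero => simp
  | add v w hv hw => simp only [map_add, hv, hw]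
  | tmul n a =>
    refine LinearMap.ext fun c => ?_
    have := cup_constCochain_left n a c
    show TensorProduct.rid ℚ N ((cup L ℚ N (constCochain L N n ⊗ₜ a)).val c) = _
    rw [this, TensorProduct.rid_tmul, gHomEval_tmul]

theorem constAct_injective : Function.Injective (constAct L N) := fun y z h =>
  gHomEval_injective (by rw [← constAct_val, ← constAct_val, h])

theorem constAct_surjective (hpos : ∀ n : ℤ, n ≤ 0 → deg L n = ⊥)
    (hfin : ∀ n : ℤ, FiniteDimensional ℚ (deg L n)) (hN : ∀ k > 0, deg N k = ⊥) :
    Function.Surjective (constAct L N) := by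
  intro f
  obtain ⟨y, hy⟩ := val_mem_range_gHomEval (fun k hk => chains_deg_eq_bot hpos hk)
    (chains_deg_finite hpos hfin) hN f
  exact ⟨y, GHom.ext (by rw [constAct_val, hy])⟩

theorem tensor_deg_eq_bot {M : Type*} [AddCommGroup M] [Module ℚ M] [GradedSpace M]
    (hM : ∀ k > 0, deg M k = ⊥) (hN : ∀ k > 0, deg N k = ⊥) (k : ℤ) (hk : k > 0) :
    deg (M ⊗[ℚ] N) k = ⊥ := by
  refine Submodule.span_eq_bot.2 ?_
  rintro _ ⟨p, q, h, x, hx, y, hy, rfl⟩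
  rcases lt_or_ge 0 p with hp | hp
  · rw [hM p hp, Submodule.mem_bot] at hx
    rw [hx, TensorProduct.zero_tmul]
  · rw [hN q (by omega), Submodule.mem_bot] at hy
    rw [hy, TensorProduct.tmul_zero]

end ConstAct


/-! ### `Φ` is a quasi-isomorphism -/

section QuasiIso
set_option maxSynthPendingDepth 4

theorem interchange_interchange {X Y Z W : Type*} [AddCommGroup X] [Module ℚ X] [GradedSpace X]
    [AddCommGroup Y] [Module ℚ Y] [GradedSpace Y] [AddCommGroup Z] [Module ℚ Z] [GradedSpace Z]
    [AddCommGroup W] [Module ℚ W] [GradedSpace W] :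
    interchange X Z Y W ∘ₗ interchange X Y Z W = LinearMap.id := by
  refine tensor4_ext_deg fun p q r s x hx y hy z hz w hw => ?_
  rw [LinearMap.comp_apply, interchange_tmul _ _ hy hz, map_smul, interchange_tmul _ _ hz hy,
    smul_smul, mul_comm r q, neg_one_zpow_mul_self, one_smul, LinearMap.id_apply]

variable {L : Type*} [AddCommGroup L] [Module ℚ L] [DGLie L]

theorem interchange_bijective {X Y Z W : Type*} [AddCommGroup X] [Module ℚ X] [GradedSpace X]
    [AddCommGroup Y] [Module ℚ Y] [GradedSpace Y] [AddCommGroup Z] [Module ℚ Z] [GradedSpace Z]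
    [AddCommGroup W] [Module ℚ W] [GradedSpace W] :
    Function.Bijective (interchange X Y Z W) :=
  Function.bijective_iff_has_inverse.2 ⟨interchange X Z Y W,
    fun v => LinearMap.congr_fun interchange_interchange v,
    fun v => LinearMap.congr_fun interchange_interchange v⟩

variable (L) in
/-- Tensor products of constant cochains. -/
def constCochain2 : UDual L ⊗[ℚ] UDual L →ₗ[ℚ] LoopAlg2 L :=
  TensorProduct.map (constCochain L (UDual L)) (constCochain L (UDual L))

theorem constCochain2_tmul (n n' : UDual L) : constCochain2 L (n ⊗ₜ n') =
    constCochain L (UDual L) n ⊗ₜ constCochain L (UDual L) n' := rfl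

theorem constCochain_mem_homDeg {N : Type*} [AddCommGroup N] [Module ℚ N] [GradedSpace N] :
    constCochain L N ∈ homDeg N (Cochains L N) 0 := by
  intro k n hn
  rw [add_zero]
  exact constCochain_mem hn

theorem constCochain2_mem :
    constCochain2 L ∈ homDeg (UDual L ⊗[ℚ] UDual L) (LoopAlg2 L) 0 :=
  map_mem constCochain_mem_homDeg constCochain_mem_homDeg (add_zero _)

theorem cup_constCochain2 (v : UDual L ⊗[ℚ] UDual L) :
    cup L (UDual L) (UDual L) (constCochain2 L v) = constCochain L (UDual L ⊗[ℚ] UDual L) v := by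
  induction v using TensorProduct.induction_on with
  | zero => simp
  | add v w hv hw => simp only [map_add, hv, hw]
  | tmul n n' => exact cup_constCochain n n'

variable (L) in
/-- The map `(N ⊗ N) ⊗ (∧V ⊗ ∧V' ⊗ ∧V̄) → E ⊗ E ⊗ ∧V̄` for `N = (UL)^∨_a`. -/
def constLoopAct : (UDual L ⊗[ℚ] UDual L) ⊗[ℚ] Alg3 L →ₗ[ℚ] LoopAlg3 L :=
  loopAct L ∘ₗ TensorProduct.map (constCochain2 L) LinearMap.id

theorem constLoopAct_tmul (v : UDual L ⊗[ℚ] UDual L) (b : Alg3 L) :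
    constLoopAct L (v ⊗ₜ b) = loopAct L (constCochain2 L v ⊗ₜ b) := rfl

/-- Up to the signed interchange of the middle factors, this is two copies of `N ⊗ C^*L ≅ C^*(L;N)`
tensored with `∧V̄`. The bound on degrees needed for that isomorphism holds as `(UL)^∨` lives in
degrees `≤ 0`. -/
theorem constLoopAct_bijective (hpos : ∀ n : ℤ, n ≤ 0 → deg L n = ⊥)
    (hfin : ∀ n : ℤ, FiniteDimensional ℚ (deg L n)) : Function.Bijective (constLoopAct L) := by
  let e := LinearEquiv.ofBijective (constAct L (UDual L)) ⟨constAct_injective,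
    constAct_surjective hpos hfin fun k hk => uDual_deg_eq_bot hpos hk⟩
  let i := LinearEquiv.ofBijective (interchange (UDual L) (UDual L) (Alg L) (Alg L))
    interchange_bijective
  let f := (TensorProduct.assoc ℚ (UDual L ⊗[ℚ] UDual L) (Alg2 L) (AlgBar L)).symm ≪≫ₗ
    TensorProduct.congr (i ≪≫ₗ TensorProduct.congr e e) (LinearEquiv.refl ℚ (AlgBar L))
  have h : constLoopAct L = f.toLinearMap := by
    refine TensorProduct.ext' fun v b => ?_
    induction b using TensorProduct.induction_on with
    | zero => simp
    | add x y hx hy => simp only [TensorProduct.tmul_add, map_add, hx, hy]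
    | tmul r w =>
      have h1 : loopAlg2Mul L (constCochain2 L v ⊗ₜ r) =
          TensorProduct.map (constAct L (UDual L)) (constAct L (UDual L))
            (interchange (UDual L) (UDual L) (Alg L) (Alg L) (v ⊗ₜ r)) := by
        induction v using tensor_induction_deg with
        | h0 => simp
        | hadd x y hx hy => simp only [TensorProduct.add_tmul, map_add, hx, hy]
        | h p q n hn n' hn' =>
          induction r using tensor_induction_deg with
          | h0 => simp
          | hadd x y hx hy => simp only [TensorProduct.tmul_add, map_add, hx, hy]
          | h s t a ha b hb =>
            rw [interchange_tmul _ _ hn' ha, map_smul, TensorProduct.map_tmul, constAct_tmul,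
              constAct_tmul, constCochain2_tmul, pairTensor_tmul _ _ (constCochain_mem hn') ha]
      rw [constLoopAct_tmul, loopAct_tmul, h1]
      rfl
  rw [h]
  exact f.bijective

/-! ### The filtration by the degree of the constant part -/

variable (L) in
/-- The combinations of constant cochains of degree greater than `j`. -/
def constSpan (j : ℤ) : Submodule ℚ (LoopAlg L) :=
  Submodule.span ℚ {f | ∃ i, j < i ∧ ∃ n ∈ deg (UDual L) i, ∃ a,
    f = cupRight L (UDual L) (constCochain L (UDual L) n ⊗ₜ a)}

variable (L) in
/-- The combinations of tensor products of constant cochains of degree greater than `j`. -/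
def constSpan2 (j : ℤ) : Submodule ℚ (LoopAlg2 L) :=
  Submodule.span ℚ {ξ | ∃ i, j < i ∧ ∃ v ∈ deg (UDual L ⊗[ℚ] UDual L) i, ∃ r,
    ξ = loopAlg2Mul L (constCochain2 L v ⊗ₜ r)}

/-- The difference is the cochain `c ↦ ± n · τ(c)`. As `L` starts in degree `1`, its values have
degree strictly larger than `p`. Injectivity of the evaluation map turns this pointwise statement
into one about the coefficients of the expansion in constant cochains. -/
theorem cochainsD_constCochain_sub_mem (hpos : ∀ n : ℤ, n ≤ 0 → deg L n = ⊥)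
    (hfin : ∀ n : ℤ, FiniteDimensional ℚ (deg L n)) {p : ℤ} {n : UDual L}
    (hn : n ∈ deg (UDual L) p) :
    cochainsD L (UDual L) (constCochain L (UDual L) n) -
      constCochain L (UDual L) (DGRep.d L n) ∈ constSpan L p := by
  set g := cochainsD L (UDual L) (constCochain L (UDual L) n) -
    constCochain L (UDual L) (DGRep.d L n)
  obtain ⟨y, hy⟩ := constAct_surjective hpos hfin (fun k hk => uDual_deg_eq_bot hpos hk) g
  let S : Submodule ℚ (UDual L) := ⨆ i : Set.Ioi p, deg (UDual L) i
  have hg : ∀ c, g.val c ∈ S := by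
    intro c
    have h1 : ∀ c, g.val c = (-1 : ℚ) ^ p • rightAct L (UDual L) (n ⊗ₜ chainTau L c) := by
      intro c
      rw [map_sub, LinearMap.sub_apply, cochainsD_constCochain hn, constCochain_val,
        add_sub_cancel_left]
    induction c using deg_induction with
    | h0 => simp
    | hadd a b ha hb => rw [map_add]; exact add_mem ha hb
    | h k c hc =>
      rw [h1]
      have hτ : chainTau L c ∈ deg L (k - 1) := chainTau_mem L k c hc
      by_cases hk : k - 1 ≤ 0
      · rw [hpos _ hk, Submodule.mem_bot] at hτ
        rw [hτ, TensorProduct.tmul_zero, map_zero, smul_zero]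
        exact zero_mem _
      · exact Submodule.smul_mem _ _ (Submodule.mem_iSup_of_mem
          (⟨p + (k - 1) + 0, by simp only [Set.mem_Ioi]; omega⟩ : Set.Ioi p)
          (rightAct_mem L (UDual L) _ _ (tmul_mem rfl hn hτ)))
  obtain ⟨y, rfl⟩ := mem_range_of_gHomEval S (y := y) fun c => by
    rw [← constAct_val, hy]; exact hg c
  rw [← hy]
  clear hy
  induction y using TensorProduct.induction_on with
  | zero => simp
  | add v w hv hw => rw [map_add, map_add]; exact add_mem hv hw
  | tmul m a =>
    obtain ⟨m, hm⟩ := m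
    rw [TensorProduct.map_tmul]
    show constAct L (UDual L) (m ⊗ₜ a) ∈ _
    have : S ≤ (constSpan L p).comap (constAct L (UDual L) ∘ₗ
        (TensorProduct.mk ℚ (UDual L) (Alg L)).flip a) :=
      iSup_le fun i m hm => Submodule.subset_span ⟨i, i.2, m, hm, a, rfl⟩
    exact this hm

theorem tmul_constCochain_mem {p q : ℤ} {g : LoopAlg L} (hg : g ∈ constSpan L p) {n : UDual L}
    (hn : n ∈ deg (UDual L) q) : g ⊗ₜ constCochain L (UDual L) n ∈ constSpan2 L (p + q) := by
  induction hg using Submodule.span_induction with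
  | zero => simp
  | add x y _ _ hx hy => rw [TensorProduct.add_tmul]; exact add_mem hx hy
  | smul a x _ hx => rw [← TensorProduct.smul_tmul']; exact Submodule.smul_mem _ _ hx
  | mem f hf =>
    obtain ⟨i, hi, m, hm, a, rfl⟩ := hf
    induction a using deg_induction with
    | h0 => simp
    | hadd a b ha hb =>
      rw [TensorProduct.tmul_add, map_add, TensorProduct.add_tmul]; exact add_mem ha hb
    | h k a ha =>
      have h := pairTensor_tmul (ρ := cupRight L (UDual L)) (σ := cupRight L (UDual L))
        (constCochain L (UDual L) m) (cochainOne L) (constCochain_mem hn) ha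
      rw [cupRight_cochainOne] at h
      -- The square of a sign is inserted to undo the Koszul sign in the product of tensors.
      rw [← one_smul ℚ (_ ⊗ₜ _), ← neg_one_zpow_mul_self (q * k), mul_smul, ← h]
      exact Submodule.smul_mem _ _ (Submodule.subset_span
        ⟨i + q, by omega, m ⊗ₜ n, tmul_mem rfl hm hn, a ⊗ₜ cochainOne L, rfl⟩)

theorem constCochain_tmul_mem {p q : ℤ} {g : LoopAlg L} (hg : g ∈ constSpan L q) {n : UDual L}
    (hn : n ∈ deg (UDual L) p) : constCochain L (UDual L) n ⊗ₜ g ∈ constSpan2 L (p + q) := by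
  induction hg using Submodule.span_induction with
  | zero => simp
  | add x y _ _ hx hy => rw [TensorProduct.tmul_add]; exact add_mem hx hy
  | smul a x _ hx => rw [TensorProduct.tmul_smul]; exact Submodule.smul_mem _ _ hx
  | mem f hf =>
    obtain ⟨i, hi, m, hm, a, rfl⟩ := hf
    have h := pairTensor_tmul (ρ := cupRight L (UDual L)) (σ := cupRight L (UDual L))
      (constCochain L (UDual L) n) a (constCochain_mem hm) cochainOne_mem
    rw [cupRight_cochainOne, mul_zero, zpow_zero, one_smul] at h
    rw [← h]
    exact Submodule.subset_span
      ⟨p + i, by omega, n ⊗ₜ m, tmul_mem rfl hn hm, cochainOne L ⊗ₜ a, rfl⟩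

theorem loopAlg2D_constCochain2_sub_mem (hpos : ∀ n : ℤ, n ≤ 0 → deg L n = ⊥)
    (hfin : ∀ n : ℤ, FiniteDimensional ℚ (deg L n)) {j : ℤ} {v : UDual L ⊗[ℚ] UDual L}
    (hv : v ∈ deg (UDual L ⊗[ℚ] UDual L) j) :
    loopAlg2D L (constCochain2 L v) - constCochain2 L (DGRep.d L v) ∈ constSpan2 L j := by
  induction hv using Submodule.span_induction with
  | zero => simp
  | add x y _ _ hx hy => simp only [map_add, add_sub_add_comm]; exact add_mem hx hy
  | smul a x _ hx => simp only [map_smul, ← smul_sub]; exact Submodule.smul_mem _ _ hx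
  | mem v hv =>
    obtain ⟨p, q, rfl, n, hn, n', hn', rfl⟩ := hv
    have hd : (DGRep.d L : UDual L ⊗[ℚ] UDual L →ₗ[ℚ] _) = tensorD (DGRep.d L) (DGRep.d L) := rfl
    rw [hd, tensorD_apply hn, map_add, map_smul, constCochain2_tmul, constCochain2_tmul,
      constCochain2_tmul, tensorD_apply (constCochain_mem hn), add_sub_add_comm, ← smul_sub,
      ← TensorProduct.sub_tmul, ← TensorProduct.tmul_sub]
    exact add_mem (tmul_constCochain_mem (cochainsD_constCochain_sub_mem hpos hfin hn) hn')
      (Submodule.smul_mem _ _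
        (constCochain_tmul_mem (cochainsD_constCochain_sub_mem hpos hfin hn') hn))

namespace DiagonalModel
variable (K : DiagonalModel L)

/-- The filtration of the kernel of `Φ` by the degree of the constant part. -/
def kerFiltration (k : ℤ) : Submodule ℚ (LoopAlg3 L) :=
  Submodule.span ℚ {x | ∃ i, 0 < i + k ∧ ∃ v ∈ deg (UDual L ⊗[ℚ] UDual L) i, ∃ b, K.φ b = 0 ∧
    x = loopAct L (constCochain2 L v ⊗ₜ b)}

theorem kerFiltration_mono {k l : ℤ} (h : k ≤ l) : K.kerFiltration k ≤ K.kerFiltration l := by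
  refine Submodule.span_mono ?_
  rintro x ⟨i, hi, hx⟩
  exact ⟨i, by omega, hx⟩

theorem kerFiltration_le : ∀ k, ∀ x ∈ K.kerFiltration k, K.loopPhi x = 0 := by
  intro k x hx
  induction hx using Submodule.span_induction with
  | zero => simp
  | add x y _ _ hx hy => rw [map_add, hx, hy, add_zero]
  | smul a x _ hx => rw [map_smul, hx, smul_zero]
  | mem x hx =>
    obtain ⟨i, -, v, -, b, hb, rfl⟩ := hx
    rw [loopPhi_loopAct, hb, TensorProduct.tmul_zero, map_zero]

/-- The weak inequality is enough, because the constant parts in `constSpan2 L j` already have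
degree strictly greater than `j`; this is where a filtration step is gained. Scalars from `∧V ⊗ ∧V'`
are absorbed into `b`, since `ker φ` is stable under them. -/
theorem loopAct_constSpan2_mem {j k : ℤ} (h : 0 ≤ j + k) {ξ : LoopAlg2 L} (hξ : ξ ∈ constSpan2 L j)
    {b : Alg3 L} (hb : K.φ b = 0) : loopAct L (ξ ⊗ₜ b) ∈ K.kerFiltration k := by
  induction hξ using Submodule.span_induction with
  | zero => simp
  | add x y _ _ hx hy => rw [TensorProduct.add_tmul, map_add]; exact add_mem hx hy
  | smul a x _ hx =>
    rw [← TensorProduct.smul_tmul', map_smul]; exact Submodule.smul_mem _ _ hx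
  | mem x hx =>
    obtain ⟨i, hi, v, hv, r, rfl⟩ := hx
    rw [loopAct_mul]
    exact Submodule.subset_span ⟨i, by omega, v, hv, _,
      by rw [φ_base_mul, hb, TensorProduct.tmul_zero, map_zero], rfl⟩

theorem φ_surjective : Function.Surjective K.φ := fun a =>
  ⟨inclBase L (a ⊗ₜ cochainOne L), by rw [K.φ_base, cupRight_cochainOne]⟩

theorem loopPhi_constLoopAct (y : (UDual L ⊗[ℚ] UDual L) ⊗[ℚ] Alg3 L) :
    K.loopPhi (constLoopAct L y) =
      constAct L (UDual L ⊗[ℚ] UDual L) (TensorProduct.map LinearMap.id K.φ y) := by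
  induction y using TensorProduct.induction_on with
  | zero => simp
  | add x y hx hy => simp only [map_add, hx, hy]
  | tmul v b =>
    rw [constLoopAct_tmul, loopPhi_loopAct, cup_constCochain2, TensorProduct.map_tmul,
      constAct_tmul, LinearMap.id_apply]

theorem loopPhi_surjective (hpos : ∀ n : ℤ, n ≤ 0 → deg L n = ⊥)
    (hfin : ∀ n : ℤ, FiniteDimensional ℚ (deg L n)) : Function.Surjective K.loopPhi := by
  intro f
  obtain ⟨y, rfl⟩ := constAct_surjective hpos hfin
    (tensor_deg_eq_bot (fun k hk => uDual_deg_eq_bot hpos hk) fun k hk => uDual_deg_eq_bot hpos hk) f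
  obtain ⟨z, rfl⟩ := TensorProduct.map_surjective (g := LinearMap.id)
    Function.surjective_id K.φ_surjective y
  exact ⟨_, K.loopPhi_constLoopAct z⟩

/-- In the coordinates `(N ⊗ N) ⊗ (∧V ⊗ ∧V' ⊗ ∧V̄)` the kernel of `Φ` is the image of `(N ⊗ N) ⊗ ker
φ`, and an element involves only finitely many degrees of `N ⊗ N`. -/
theorem mem_kerFiltration (hpos : ∀ n : ℤ, n ≤ 0 → deg L n = ⊥)
    (hfin : ∀ n : ℤ, FiniteDimensional ℚ (deg L n)) {z : LoopAlg3 L} (hz : K.loopPhi z = 0) :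
    ∃ k : ℕ, z ∈ K.kerFiltration k := by
  obtain ⟨y, rfl⟩ := (constLoopAct_bijective hpos hfin).2 z
  rw [loopPhi_constLoopAct] at hz
  have h1 := constAct_injective (hz.trans (map_zero _).symm)
  have h2 := lTensor_exact (UDual L ⊗[ℚ] UDual L) (f := (LinearMap.ker K.φ).subtype) (g := K.φ)
    (LinearMap.exact_subtype_ker_map K.φ) K.φ_surjective
  obtain ⟨y, rfl⟩ := (h2 y).1 h1
  clear hz h1 h2
  have hadd : ∀ x y, (∃ k : ℕ, x ∈ K.kerFiltration k) → (∃ k : ℕ, y ∈ K.kerFiltration k) →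
      ∃ k : ℕ, x + y ∈ K.kerFiltration k := by
    rintro x y ⟨k, hk⟩ ⟨l, hl⟩
    exact ⟨k + l, add_mem (K.kerFiltration_mono (by omega) hk) (K.kerFiltration_mono (by omega) hl)⟩
  induction y using TensorProduct.induction_on with
  | zero => exact ⟨0, by simp⟩
  | add x y hx hy => rw [map_add, map_add]; exact hadd _ _ hx hy
  | tmul v b =>
    induction v using deg_induction with
    | h0 => exact ⟨0, by simp⟩
    | hadd x y hx hy => rw [TensorProduct.add_tmul, map_add, map_add]; exact hadd _ _ hx hy
    | h i v hv =>
      -- The least natural number whose sum with `i` is positive.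
      exact ⟨(1 - i).toNat, Submodule.subset_span ⟨i, by omega, v, hv, b, b.2, rfl⟩⟩

/-- A contraction of `ker φ`, applied with the constant part held fixed up to sign, is a contraction
of `ker Φ` modulo terms of larger constant degree. Since constant degrees are at most `0`, the
defect disappears after finitely many corrections. -/
theorem ker_loopPhi_acyclic (hpos : ∀ n : ℤ, n ≤ 0 → deg L n = ⊥)
    (hfin : ∀ n : ℤ, FiniteDimensional ℚ (deg L n)) {z : LoopAlg3 L} (hz : K.loopPhi z = 0)
    (hdz : K.loopD z = 0) : ∃ w, K.loopPhi w = 0 ∧ K.loopD w = z := by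
  obtain ⟨h, hφh, hh⟩ := exists_contraction (dX := K.D) (J := LinearMap.ker K.φ) K.D_D
    (fun x hx => by rw [LinearMap.mem_ker, K.φ_chain.apply, LinearMap.mem_ker.1 hx, map_zero])
    (fun z hz hdz => exists_of_ker_of_bijective K.φ_chain K.D_D K.φ_surjective K.φ_quasiIso hz hdz)
  let e := LinearEquiv.ofBijective (constLoopAct L) (constLoopAct_bijective hpos hfin)
  -- The contraction in the coordinates of `constLoopAct`. It behaves as an odd operator, so it acts
  -- on the constant part by the sign operator.
  let H : LoopAlg3 L →ₗ[ℚ] LoopAlg3 L :=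
    constLoopAct L ∘ₗ TensorProduct.map (sgn _) h ∘ₗ e.symm.toLinearMap
  have hH : ∀ v b, H (loopAct L (constCochain2 L v ⊗ₜ b)) =
      loopAct L (constCochain2 L (sgn _ v) ⊗ₜ h b) := by
    intro v b
    have : e.symm (loopAct L (constCochain2 L v ⊗ₜ b)) = v ⊗ₜ b := by
      rw [LinearEquiv.symm_apply_eq]; rfl
    simp only [H, LinearMap.comp_apply, LinearEquiv.coe_coe, this]
    rfl
  have hHF : ∀ k, ∀ x ∈ K.kerFiltration k, H x ∈ K.kerFiltration k := by
    intro k x hx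
    induction hx using Submodule.span_induction with
    | zero => simp
    | add x y _ _ hx hy => rw [map_add]; exact add_mem hx hy
    | smul a x _ hx => rw [map_smul]; exact Submodule.smul_mem _ _ hx
    | mem x hx =>
      obtain ⟨i, hi, v, hv, b, hb, rfl⟩ := hx
      rw [hH]
      exact Submodule.subset_span ⟨i, hi, _, sgn_mem hv, _, hφh b, rfl⟩
  -- The defect `1 - (D'H + HD')` moves one filtration step towards constant parts of larger degree.
  have hT : ∀ k, ∀ x ∈ K.kerFiltration (k + 1),
      x - (K.loopD (H x) + H (K.loopD x)) ∈ K.kerFiltration k := by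
    intro k x hx
    induction hx using Submodule.span_induction with
    | zero => simp
    | add x y _ _ hx hy =>
      have := add_mem hx hy
      simp only [map_add]
      convert this using 1
      abel
    | smul a x _ hx =>
      have := Submodule.smul_mem _ a hx
      simpa only [map_smul, smul_sub, smul_add] using this
    | mem x hx =>
      obtain ⟨i, hi, v, hv, b, hb, rfl⟩ := hx
      have hg := loopAlg2D_constCochain2_sub_mem hpos hfin hv
      set g := loopAlg2D L (constCochain2 L v) - constCochain2 L (DGRep.d L v) with hgdef
      have hg' : loopAlg2D L (constCochain2 L v) = constCochain2 L (DGRep.d L v) + g := by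
        rw [hgdef]; abel
      have h1 := K.loopAct_constSpan2_mem (k := k) (by omega) hg hb
      have h2 := K.loopAct_constSpan2_mem (k := k) (by omega) hg (LinearMap.mem_ker.1 (hφh b))
      have h3 : sgn _ (DGRep.d L v) = (-1 : ℚ) ^ (i - 1) • DGRep.d L v :=
        sgn_of_mem (DGRep.d_mem (L := L) i v hv)
      -- The remainder consists of the two terms that contain `g`, the part of the differential of
      -- the constants that is not constant. The terms with `d v` cancel, because the sign operator
      -- anticommutes with `d`.
      have h4 := neg_mem (add_mem (Submodule.smul_mem _ ((-1 : ℚ) ^ i) h2) (hHF _ _ h1))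
      have e1 : constCochain2 L v ⊗ₜ[ℚ] b = constCochain2 L v ⊗ₜ[ℚ] K.D (h b) +
          constCochain2 L v ⊗ₜ[ℚ] h (K.D b) := by
        rw [← TensorProduct.tmul_add, hh b (LinearMap.mem_ker.2 hb)]
      convert h4 using 1
      rw [hH, sgn_of_mem hv, map_smul, ← TensorProduct.smul_tmul', map_smul, map_smul,
        loopD_loopAct, loopD_loopAct, hg', sgn_of_homDeg_zero constCochain2_mem, sgn_of_mem hv,
        TensorProduct.add_tmul, TensorProduct.add_tmul]
      simp only [map_add, map_smul, ← TensorProduct.smul_tmul', hH, h3, sgn_of_mem hv]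
      rw [e1, map_add, neg_one_zpow_sub_one]
      have e4 := neg_one_zpow_mul_self i
      match_scalars <;> first | ring1 | linear_combination e4 | linear_combination -e4
  have hmain : ∀ k : ℕ, ∀ z ∈ K.kerFiltration k, K.loopD z = 0 →
      ∃ w, K.loopPhi w = 0 ∧ K.loopD w = z := by
    intro k
    induction k with
    | zero =>
      intro z hz _
      -- At stage `0` a generator would need a constant part of positive degree, and there is none.
      have : K.kerFiltration ((0 : ℕ) : ℤ) = ⊥ := by
        refine Submodule.span_eq_bot.2 ?_
        rintro x ⟨i, hi, v, hv, b, -, rfl⟩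
        have h0 : ∀ k > 0, deg (UDual L) k = ⊥ := fun k hk => uDual_deg_eq_bot hpos hk
        rw [tensor_deg_eq_bot h0 h0 i (by simpa using hi), Submodule.mem_bot] at hv
        rw [hv, map_zero, TensorProduct.zero_tmul, map_zero]
      rw [this, Submodule.mem_bot] at hz
      exact ⟨0, by simp, by simp [hz]⟩
    | succ k ih =>
      intro z hz hdz
      -- For a cycle `z`, `z - D'(Hz)` is a cycle one stage further down, and `Hz` stays in the
      -- kernel of `Φ`.
      have h1 := hT k z (by exact_mod_cast hz)
      rw [hdz, map_zero, add_zero] at h1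
      obtain ⟨w, hw, hdw⟩ := ih _ h1 (by rw [map_sub, hdz, K.loopD_loopD, sub_zero])
      exact ⟨w + H z, by rw [map_add, hw, K.kerFiltration_le _ _ (hHF _ _ hz), add_zero],
        by rw [map_add, hdw, sub_add_cancel]⟩
  obtain ⟨k, hk⟩ := K.mem_kerFiltration hpos hfin hz
  exact hmain k z hk hdz

theorem loopPhi_quasiIso (hpos : ∀ n : ℤ, n ≤ 0 → deg L n = ⊥)
    (hfin : ∀ n : ℤ, FiniteDimensional ℚ (deg L n)) :
    Function.Bijective (homologyMap K.loopPhi_isChainMap) :=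
  homologyMap_bijective _ K.loopD_loopD (K.loopPhi_surjective hpos hfin) fun _ hz hdz =>
    K.ker_loopPhi_acyclic hpos hfin hz hdz

end DiagonalModel

end QuasiIso


/-! ### The pairing of `C^*(L) ⊗ C^*(L)` with `C_*(L) ⊗ C_*(L)` -/

section Pairing
set_option maxSynthPendingDepth 4

theorem wt_injective {X : Type*} [AddCommGroup X] [Module ℚ X] [GradedSpace X] (t : ℚˣ) :
    Function.Injective (GradedSpace.wt t : X →ₗ[ℚ] X) := by
  have h : (GradedSpace.wt t⁻¹ : X →ₗ[ℚ] X) ∘ₗ GradedSpace.wt t = LinearMap.id := by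
    refine hom_ext_deg fun n x hx => ?_
    rw [LinearMap.comp_apply, GradedSpace.wt_of_mem t n x hx, map_smul,
      GradedSpace.wt_of_mem _ n x hx, smul_smul, ← mul_zpow]
    simp
  exact Function.LeftInverse.injective (g := GradedSpace.wt t⁻¹) (LinearMap.congr_fun h)

theorem tensor_eq_zero_of_forall_gHom {X Y : Type*} [AddCommGroup X] [Module ℚ X] [GradedSpace X]
    [AddCommGroup Y] [Module ℚ Y] [GradedSpace Y] {v : X ⊗[ℚ] Y}
    (h : ∀ (a : GHom X ℚ) (b : GHom Y ℚ), TensorProduct.map a.val b.val v = 0) : v = 0 := by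
  classical
  let e := Module.Basis.ofVectorSpace ℚ Y
  refine (TensorProduct.equivFinsuppOfBasisRight e).injective ?_
  rw [map_zero]
  refine Finsupp.ext fun i => eq_zero_of_forall_gHom fun a => ?_
  have h1 : TensorProduct.lid ℚ Y (TensorProduct.map a.val LinearMap.id v) = 0 := by
    refine eq_zero_of_forall_gHom fun b => ?_
    have h2 : TensorProduct.lid ℚ ℚ (TensorProduct.map a.val b.val v) =
        b.val (TensorProduct.lid ℚ Y (TensorProduct.map a.val LinearMap.id v)) := by
      clear h
      induction v using TensorProduct.induction_on with
      | zero => simp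
      | add v w hv hw => simp only [map_add, hv, hw]
      | tmul x y => simp
    rw [← h2, h, map_zero]
  have h3 : a.val (TensorProduct.equivFinsuppOfBasisRight e v i) =
      e.coord i (TensorProduct.lid ℚ Y (TensorProduct.map a.val LinearMap.id v)) := by
    clear h h1
    induction v using TensorProduct.induction_on with
    | zero => simp
    | add v w hv hw => simp only [map_add, Finsupp.add_apply, hv, hw]
    | tmul x y => simp [mul_comm]
  rw [h3, h1, map_zero]

variable {L : Type*} [AddCommGroup L] [Module ℚ L] [DGLie L]

variable (L) in
/-- The augmentation of `C_*(L) ⊗ C_*(L)`. -/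
def chainCounit2 : Chains L ⊗[ℚ] Chains L →ₗ[ℚ] ℚ :=
  (TensorProduct.lid ℚ ℚ).toLinearMap ∘ₗ TensorProduct.map (chainCounit L) (chainCounit L)

theorem chainCounit2_tmul (x y : Chains L) :
    chainCounit2 L (x ⊗ₜ y) = chainCounit L x * chainCounit L y := rfl

theorem chainCounit2_mem : chainCounit2 L ∈ homDeg (Chains L ⊗[ℚ] Chains L) ℚ 0 :=
  comp_mem (by
    have h : (TensorProduct.lid ℚ ℚ).toLinearMap = (TensorProduct.rid ℚ ℚ).toLinearMap :=
      TensorProduct.ext' fun x y => mul_comm x y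
    rw [h]; exact rid_mem ℚ) (map_mem (chainCounit_mem L) (chainCounit_mem L) (add_zero 0))
    (add_zero 0)

theorem chainCounit2_tensorD (v : Chains L ⊗[ℚ] Chains L) :
    chainCounit2 L (tensorD (chainD L) (chainD L) v) = 0 := by
  have h := LinearMap.congr_fun (chainCounit_chainD (L := L))
  simp only [LinearMap.comp_apply, LinearMap.zero_apply] at h
  induction v using tensor_induction_deg with
  | h0 => simp
  | hadd v w hv hw => simp only [map_add, hv, hw, add_zero]
  | h p q x hx y hy =>
    rw [tensorD_apply hx, map_add, map_smul, chainCounit2_tmul, chainCounit2_tmul, h, h]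
    simp

theorem chainCounit2_comul (c : Chains L) :
    chainCounit2 L (GSym.comul (Susp L) c) = chainCounit L c := by
  have h1 : chainCounit2 L = chainCounit L ∘ₗ (TensorProduct.lid ℚ (Chains L)).toLinearMap ∘ₗ
      TensorProduct.map (chainCounit L) LinearMap.id :=
    TensorProduct.ext' fun x y => by simp [chainCounit2_tmul]
  have h2 := LinearMap.congr_fun (comul_counit_left (L := L)) c
  simp only [LinearMap.comp_apply, LinearMap.id_apply] at h2
  rw [h1, LinearMap.comp_apply, LinearMap.comp_apply, h2]

theorem chainCounit2_algOp2_apply {q p : ℤ} (a : Alg L) {b : Alg L} (hb : b ∈ deg (Alg L) q)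
    {x : Chains L} (hx : x ∈ deg (Chains L) p) (y : Chains L) :
    chainCounit2 L (algOp2 L (a ⊗ₜ b) (x ⊗ₜ y)) = (-1 : ℚ) ^ (q * p) * (a.val x * b.val y) := by
  rw [algOp2_tmul, homTensor_apply _ _ (algOp_mem hb) hx, map_smul, chainCounit2_tmul,
    ← counit_algOp a, ← counit_algOp b]
  rfl

theorem algOp2_cochainsD (r : Alg2 L) : algOp2 L (alg2D L r) =
    tensorD (chainD L) (chainD L) ∘ₗ algOp2 L r -
      algOp2 L (sgn _ r) ∘ₗ tensorD (chainD L) (chainD L) := by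
  have h : TensorProduct.map (TensorProduct.rid ℚ (Chains L)).toLinearMap
      (TensorProduct.rid ℚ (Chains L)).toLinearMap ∘ₗ tensorD (chainsD L ℚ) (chainsD L ℚ) =
      tensorD (chainD L) (chainD L) ∘ₗ TensorProduct.map
        (TensorProduct.rid ℚ (Chains L)).toLinearMap
        (TensorProduct.rid ℚ (Chains L)).toLinearMap := by
    rw [tensorD_eq chainsD_mem, tensorD_eq (chainD_mem L), ← homTensor_eq_map (rid_mem _)]
    rw [LinearMap.comp_add, LinearMap.add_comp, homTensor_comp _ chainsD_mem id_mem (rid_mem _),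
      homTensor_comp _ id_mem chainsD_mem (rid_mem _),
      homTensor_comp _ (rid_mem _) (rid_mem _) id_mem,
      homTensor_comp _ (rid_mem _) (rid_mem _) (chainD_mem L), chainsD_rid]
    simp
  rw [rid_algOp2, coext2_cochainsD, LinearMap.comp_sub, ← LinearMap.comp_assoc, h, rid_algOp2,
    rid_algOp2]
  rfl

variable (L) in
/-- The pairing `κ ↦ (r ↦ (ε ⊗ ε)(r · κ))`. -/
def chainPairing : Chains L ⊗[ℚ] Chains L →ₗ[ℚ] Module.Dual ℚ (Alg2 L) :=
  (LinearMap.llcomp ℚ (Chains L ⊗[ℚ] Chains L) (Chains L ⊗[ℚ] Chains L) ℚ (chainCounit2 L) ∘ₗ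
    algOp2 L).flip

theorem chainPairing_apply (v : Chains L ⊗[ℚ] Chains L) (r : Alg2 L) :
    chainPairing L v r = chainCounit2 L (algOp2 L r v) := rfl

/-- On `a ⊗ b` the pairing is evaluation of `a ⊗ b` up to a sign. That sign depends only on the
degrees of `a` and `b`, as a nonzero `a(x)` forces `|x| = -|a|`. Evaluations by graded functionals
separate the points of a tensor product. -/
theorem chainPairing_injective : Function.Injective (chainPairing L) := by
  rw [injective_iff_map_eq_zero]
  intro v hv
  refine tensor_eq_zero_of_forall_gHom fun a b => (TensorProduct.lid ℚ ℚ).injective ?_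
  rw [map_zero]
  induction a using deg_induction with
  | h0 => simp
  | hadd a a' ha ha' =>
    rw [map_add, TensorProduct.map_add_left, LinearMap.add_apply, map_add, ha, ha', add_zero]
  | h s a ha =>
    induction b using deg_induction with
    | h0 => simp
    | hadd b b' hb hb' =>
      rw [map_add, TensorProduct.map_add_right, LinearMap.add_apply, map_add, hb, hb', add_zero]
    | h q b hb =>
      have h : chainCounit2 L ∘ₗ algOp2 L (a ⊗ₜ b) = (-1 : ℚ) ^ (s * q) •
          ((TensorProduct.lid ℚ ℚ).toLinearMap ∘ₗ TensorProduct.map a.val b.val) := by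
        refine tensor_ext_deg_left fun p x hx y => ?_
        rw [LinearMap.comp_apply, chainCounit2_algOp2_apply a hb hx]
        by_cases hp : p + s = 0
        · rw [sign_congr (a := q * p) (b := s * q) (-s * q) (by rw [eq_neg_of_add_eq_zero_left hp]; ring)]
          rfl
        · rw [gHom_rat_apply_eq_zero ha hx hp]
          simp [gHom_rat_apply_eq_zero ha hx hp]
      have h1 := LinearMap.congr_fun h v
      have h2 := LinearMap.congr_fun hv (a ⊗ₜ b)
      rw [chainPairing_apply, LinearMap.zero_apply] at h2
      rw [LinearMap.comp_apply, h2, eq_comm, LinearMap.smul_apply] at h1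
      exact (smul_eq_zero.1 h1).resolve_left
        (zpow_ne_zero (s * q) (show (-1 : ℚ) ≠ 0 by norm_num))

/-- An element of `C^*L ⊗ C^*L` is determined by the map `C_*L → C^*L` obtained by evaluating its
first factor. The Koszul sign of the pairing is absorbed by an injective weight operator. -/
theorem eq_zero_of_chainPairing {r : Alg2 L} (h : ∀ v, chainPairing L v r = 0) : r = 0 := by
  have key : ∀ (r : Alg2 L) p, ∀ x ∈ deg (Chains L) p, ∀ y, chainPairing L (x ⊗ₜ y) r =
      (GradedSpace.wt ((-1) ^ p)
        (gHomEval (Chains L) (Alg L) (TensorProduct.comm ℚ (Alg L) (Alg L) r) x)).val y := by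
    intro r p x hx y
    induction r using tensor_induction_deg with
    | h0 => simp
    | hadd v w hv hw => simp only [map_add, LinearMap.add_apply, hv, hw]
    | h s q a ha b hb =>
      rw [chainPairing_apply, chainCounit2_algOp2_apply a hb hx, TensorProduct.comm_tmul,
        gHomEval_tmul, map_smul, GradedSpace.wt_of_mem _ q b hb]
      simp only [map_smul, LinearMap.smul_apply, smul_eq_mul]
      push_cast
      rw [← zpow_mul, mul_comm p q]
      ring
  refine (TensorProduct.comm ℚ (Alg L) (Alg L)).injective ?_
  rw [map_zero]
  refine gHomEval_injective ?_
  rw [map_zero]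
  refine hom_ext_deg fun p x hx => wt_injective ((-1) ^ p) (GHom.ext (LinearMap.ext fun y => ?_))
  rw [← key r p x hx y, h, LinearMap.zero_apply, map_zero, map_zero, LinearMap.zero_apply]

theorem chains2_deg_finite (hpos : ∀ n : ℤ, n ≤ 0 → deg L n = ⊥)
    (hfin : ∀ n : ℤ, FiniteDimensional ℚ (deg L n)) (n : ℤ) :
    FiniteDimensional ℚ (deg (Chains L ⊗[ℚ] Chains L) n) := by
  have h1 : ∀ p : Finset.Icc 0 n, FiniteDimensional ℚ (Submodule.map₂
      (TensorProduct.mk ℚ (Chains L) (Chains L)) (deg (Chains L) p) (deg (Chains L) (n - p))) := by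
    intro p
    have h1 := chains_deg_finite hpos hfin p
    have h2 := chains_deg_finite hpos hfin (n - p)
    rw [← Submodule.fg_iff_finiteDimensional] at h1 h2 ⊢
    exact h1.map₂ _ h2
  refine Submodule.finiteDimensional_of_le (S₂ := ⨆ p : Finset.Icc 0 n, Submodule.map₂
    (TensorProduct.mk ℚ (Chains L) (Chains L)) (deg (Chains L) p) (deg (Chains L) (n - p)))
    (Submodule.span_le.2 ?_)
  rintro _ ⟨p, q, rfl, x, hx, y, hy, rfl⟩
  rcases lt_or_ge p 0 with hp | hp
  · rw [chains_deg_eq_bot hpos hp, Submodule.mem_bot] at hx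
    rw [hx, TensorProduct.zero_tmul]; exact zero_mem _
  rcases lt_or_ge q 0 with hq | hq
  · rw [chains_deg_eq_bot hpos hq, Submodule.mem_bot] at hy
    rw [hy, TensorProduct.tmul_zero]; exact zero_mem _
  refine Submodule.mem_iSup_of_mem ⟨p, by rw [Finset.mem_Icc]; omega⟩
    (Submodule.apply_mem_map₂ _ hx ?_)
  show y ∈ deg (Chains L) (p + q - p)
  rwa [add_sub_cancel_left]

theorem chainPairing_eq_zero {n j : ℤ} {v : Chains L ⊗[ℚ] Chains L}
    (hv : v ∈ deg (Chains L ⊗[ℚ] Chains L) n) {r : Alg2 L} (hr : r ∈ deg (Alg2 L) j)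
    (h : n + j ≠ 0) : chainPairing L v r = 0 := by
  have h1 : chainCounit2 L (algOp2 L r v) ∈ deg ℚ (n + j) := by
    have hop : algOp2 L r ∈ homDeg (Chains L ⊗[ℚ] Chains L) (Chains L ⊗[ℚ] Chains L) j := by
      induction hr using Submodule.span_induction with
      | zero => rw [map_zero]; exact zero_mem _
      | add x y _ _ hx hy => rw [map_add]; exact add_mem hx hy
      | smul a x _ hx => rw [map_smul]; exact Submodule.smul_mem _ _ hx
      | mem r hr =>
        obtain ⟨p, q, hpq, a, ha, b, hb, rfl⟩ := hr
        exact homTensor_mem (algOp_mem ha) (algOp_mem hb) hpq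
    have := chainCounit2_mem _ _ (hop n v hv)
    rwa [add_zero] at this
  rw [chainPairing_apply]
  simpa [deg, GradedSpace.deg, h] using h1

/-- A functional supported in one degree is represented by a chain. -/
theorem mem_range_chainPairing (hpos : ∀ n : ℤ, n ≤ 0 → deg L n = ⊥)
    (hfin : ∀ n : ℤ, FiniteDimensional ℚ (deg L n)) {n : ℤ} {ψ : Module.Dual ℚ (Alg2 L)}
    (hψ : ∀ j, j ≠ n → ∀ r ∈ deg (Alg2 L) j, ψ r = 0) :
    ψ ∈ LinearMap.range (chainPairing L) := by
  have := chains2_deg_finite hpos hfin (-n)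
  let W := deg (Chains L ⊗[ℚ] Chains L) (-n)
  let g : deg (Alg2 L) n →ₗ[ℚ] Module.Dual ℚ W :=
    ((chainPairing L).flip ∘ₗ (deg (Alg2 L) n).subtype).compl₂ W.subtype
  have hg : Function.Injective g := by
    rw [injective_iff_map_eq_zero]
    rintro ⟨r, hr⟩ h
    refine Subtype.ext (eq_zero_of_chainPairing fun v => ?_)
    induction v using deg_induction with
    | h0 => simp
    | hadd v w hv hw => rw [map_add, LinearMap.add_apply, hv, hw, add_zero]
    | h k v hv =>
      by_cases hk : k + n = 0
      · obtain rfl : k = -n := by omega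
        exact LinearMap.congr_fun h ⟨v, hv⟩
      · exact chainPairing_eq_zero hv hr hk
  -- Degree `n` of `∧V ⊗ ∧V'` embeds in the dual of the finite-dimensional space `W`, so a
  -- functional on it extends to that dual, and such an extension is evaluation at an element of
  -- `W`.
  obtain ⟨w, hw⟩ := LinearMap.dualMap_surjective_of_injective hg (ψ ∘ₗ (deg (Alg2 L) n).subtype)
  obtain ⟨v, rfl⟩ := (Module.evalEquiv ℚ W).surjective w
  refine ⟨v, hom_ext_deg fun j r hr => ?_⟩
  by_cases hj : j = n
  · subst hj
    have := LinearMap.congr_fun hw ⟨r, hr⟩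
    exact this
  · rw [hψ j hj r hr, chainPairing_eq_zero v.2 hr (by omega)]

end Pairing


/-! ### Commutativity in homology -/

section Commutativity
set_option maxSynthPendingDepth 4
variable {L : Type*} [AddCommGroup L] [Module ℚ L] [DGLie L]

theorem homologyMap_eq_of_homotopy {X Y : Type*} [AddCommGroup X] [Module ℚ X] [AddCommGroup Y]
    [Module ℚ Y] {dX : X →ₗ[ℚ] X} {dY : Y →ₗ[ℚ] Y} {f g : X →ₗ[ℚ] Y} (hf : IsChainMap dX dY f)
    (hg : IsChainMap dX dY g) (s : X →ₗ[ℚ] Y) (h : f - g = dY ∘ₗ s + s ∘ₗ dX) :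
    homologyMap hf = homologyMap hg := by
  refine LinearMap.ext fun c => ?_
  obtain ⟨⟨x, hx⟩, rfl⟩ := Submodule.Quotient.mk_surjective _ c
  have hfx : dY (f x) = 0 := by rw [← hf.apply, LinearMap.mem_ker.1 hx, map_zero]
  have hgx : dY (g x) = 0 := by rw [← hg.apply, LinearMap.mem_ker.1 hx, map_zero]
  rw [homologyMap_mk hf _ ⟨f x, hfx⟩ rfl, homologyMap_mk hg _ ⟨g x, hgx⟩ rfl, ← sub_eq_zero,
    ← Submodule.Quotient.mk_sub]
  refine (homology_mk_eq_zero _).2 ⟨s x, ?_⟩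
  have h1 := LinearMap.congr_fun h x
  simp only [LinearMap.sub_apply, LinearMap.add_apply, LinearMap.comp_apply,
    LinearMap.mem_ker.1 hx, map_zero, add_zero] at h1
  exact h1.symm

/-- A functional that vanishes on cycles factors through the differential. -/
theorem exists_comp_eq_of_ker {X : Type*} [AddCommGroup X] [Module ℚ X] [GradedSpace X]
    {d : X →ₗ[ℚ] X} (hd : d ∈ homDeg X X (-1)) {l : X →ₗ[ℚ] ℚ} {n : ℤ} (hl : l ∈ homDeg X ℚ n)
    (h : ∀ x, d x = 0 → l x = 0) :
    ∃ e : X →ₗ[ℚ] ℚ, l = e ∘ₗ d ∧ ∀ k, k ≠ -n - 1 → ∀ x ∈ deg X k, e x = 0 := by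
  have h1 : l ∈ LinearMap.range d.dualMap := by
    rw [LinearMap.range_dualMap_eq_dualAnnihilator_ker, Submodule.mem_dualAnnihilator]
    exact fun x hx => h x hx
  obtain ⟨e, rfl⟩ := h1
  -- A factorization through `d` is cut down to the one degree that matters. A functional supported
  -- in a single degree is needed later for representability by chains.
  refine ⟨e ∘ₗ degProj X (-n - 1), hom_ext_deg fun k x hx => ?_, fun k hk x hx => ?_⟩
  · by_cases hk : k = -n
    · rw [LinearMap.comp_apply, LinearMap.comp_apply, degProj_of_mem (hk ▸ hd k x hx)]
      rfl
    · rw [LinearMap.comp_apply, LinearMap.comp_apply, degProj_of_mem_ne (by omega) (hd _ x hx),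
        map_zero]
      have h2 := hl k x hx
      simpa [deg, GradedSpace.deg, show k + n ≠ 0 by omega] using h2
  · rw [LinearMap.comp_apply, degProj_of_mem_ne hk hx, map_zero]

variable (L) in
theorem alg2Mul_assoc (r r' r'' : Alg2 L) :
    alg2Mul L (alg2Mul L (r ⊗ₜ r') ⊗ₜ r'') = alg2Mul L (r ⊗ₜ alg2Mul L (r' ⊗ₜ r'')) :=
  pairTensor_assoc cupRight_mem cupRight_mem cupRight_cupRight cupRight_cupRight r r' r''

theorem alg3Mul_inclBase_assoc (r r' : Alg2 L) (b : Alg3 L) :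
    alg3Mul L (inclBase L r ⊗ₜ alg3Mul L (inclBase L r' ⊗ₜ b)) =
      alg3Mul L (inclBase L (alg2Mul L (r ⊗ₜ r')) ⊗ₜ b) := by
  induction b using TensorProduct.induction_on with
  | zero => simp only [TensorProduct.tmul_zero, map_zero]
  | add v w hv hw => simp only [TensorProduct.tmul_add, map_add, hv, hw]
  | tmul s w => rw [alg3Mul_inclBase, alg3Mul_inclBase, alg3Mul_inclBase, alg2Mul_assoc]

theorem tensorD_tmul_self {m : ℤ} {u : Chains L} (hu : u ∈ deg (Chains L) m)
    (hdu : chainD L u = 0) : tensorD (chainD L) (chainD L) (u ⊗ₜ u) = 0 := by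
  rw [tensorD_apply hu, hdu]; simp

theorem algOp2_alg2D_apply {m : ℤ} {u : Chains L} (hu : u ∈ deg (Chains L) m)
    (hdu : chainD L u = 0) (r : Alg2 L) : algOp2 L (alg2D L r) (u ⊗ₜ u) =
      tensorD (chainD L) (chainD L) (algOp2 L r (u ⊗ₜ u)) := by
  rw [algOp2_cochainsD, LinearMap.sub_apply, LinearMap.comp_apply, LinearMap.comp_apply,
    tensorD_tmul_self hu hdu, map_zero, sub_zero]

theorem algOp2_mem {j : ℤ} {r : Alg2 L} (hr : r ∈ deg (Alg2 L) j) :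
    algOp2 L r ∈ homDeg (Chains L ⊗[ℚ] Chains L) (Chains L ⊗[ℚ] Chains L) j := by
  induction hr using Submodule.span_induction with
  | zero => rw [map_zero]; exact zero_mem _
  | add x y _ _ hx hy => rw [map_add]; exact add_mem hx hy
  | smul a x _ hx => rw [map_smul]; exact Submodule.smul_mem _ _ hx
  | mem r hr =>
    obtain ⟨p, q, hpq, a, ha, b, hb, rfl⟩ := hr
    exact homTensor_mem (algOp_mem ha) (algOp_mem hb) hpq

namespace DiagonalModel
variable (K : DiagonalModel L)

/-- The element of `C_*(L) ⊗ C_*(L)` that measures the composite through `C_*(L; N ⊗ N)`. -/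
def diagCap (m : ℕ) (u : Chains L) : Alg3 L →ₗ[ℚ] Chains L ⊗[ℚ] Chains L :=
  (-1 : ℚ) ^ m • (GSym.comul (Susp L) ∘ₗ LinearMap.applyₗ u ∘ₗ algOp L ∘ₗ K.φ)

/-- The element of `C_*(L) ⊗ C_*(L)` that measures the composite through `E ⊗ E`. -/
def capCap (u : Chains L) (μT : Alg3 L →ₗ[ℚ] Alg2 L) : Alg3 L →ₗ[ℚ] Chains L ⊗[ℚ] Chains L :=
  LinearMap.applyₗ (u ⊗ₜ u) ∘ₗ algOp2 L ∘ₗ μT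

theorem diagCap_apply (m : ℕ) (u : Chains L) (b : Alg3 L) : K.diagCap m u b =
    (-1 : ℚ) ^ m • GSym.comul (Susp L) (algOp L (K.φ b) u) := rfl

theorem capCap_apply (u : Chains L) (μT : Alg3 L →ₗ[ℚ] Alg2 L) (b : Alg3 L) :
    capCap u μT b = algOp2 L (μT b) (u ⊗ₜ u) := rfl

/-- The coefficients enter only through the operator of `ξ`; what is left is an element of `C_*L ⊗
C_*L` depending on `b`. The comparison of the two composites thereby becomes one of maps from the
model to `C_*L ⊗ C_*L`. -/
theorem chainsDiag_cap_loopPhi (m : ℕ) (u : Chains L) (ξ : LoopAlg2 L) (b : Alg3 L) :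
    chainsDiag L (UDual L) (UDual L) (cap L (UDual L ⊗[ℚ] UDual L) m u
      (K.loopPhi (loopAct L (ξ ⊗ₜ b)))) = coext2 L (UDual L) (UDual L) ξ (K.diagCap m u b) := by
  have h := LinearMap.congr_fun (chainsDiag_coext_cup ξ) (algOp L (K.φ b) u)
  simp only [LinearMap.comp_apply] at h
  rw [loopPhi_loopAct, cap_eq, coext_cupRight, map_smul, LinearMap.comp_apply, h, diagCap_apply,
    map_smul]

/-- The same reduction for the other composite, by evaluating the product operator at `u ⊗ u`. -/
theorem capTensorCap_loopMuT {m : ℕ} {u : Chains L} (hu : u ∈ deg (Chains L) m) {T : Alg2 L}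
    {μT : Alg3 L →ₗ[ℚ] Alg2 L} (hμT : ExtendsMulBy K m T μT) (ξ : LoopAlg2 L) (b : Alg3 L) :
    capTensorCap L (UDual L) (UDual L) m u (loopMuT μT (loopAct L (ξ ⊗ₜ b))) =
      coext2 L (UDual L) (UDual L) ξ (capCap u μT b) := by
  rw [loopMuT_loopAct K hμT, capTensorCap_eq m hu, coext2_mul, LinearMap.comp_apply, capCap_apply]

theorem diagCap_mul (m : ℕ) (u : Chains L) (r : Alg2 L) (b : Alg3 L) :
    K.diagCap m u (alg3Mul L (inclBase L r ⊗ₜ b)) = algOp2 L r (K.diagCap m u b) := by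
  have h := LinearMap.congr_fun (comul_algOp r) (algOp L (K.φ b) u)
  simp only [LinearMap.comp_apply] at h
  rw [diagCap_apply, diagCap_apply, φ_base_mul, algOp_algMul, LinearMap.comp_apply, h, map_smul]

theorem capCap_mul (u : Chains L) {m : ℕ} {T : Alg2 L}
    {μT : Alg3 L →ₗ[ℚ] Alg2 L} (hμT : ExtendsMulBy K m T μT) (r : Alg2 L) (b : Alg3 L) :
    capCap u μT (alg3Mul L (inclBase L r ⊗ₜ b)) = algOp2 L r (capCap u μT b) := by
  rw [capCap_apply, capCap_apply, hμT.linear, algOp2_mul, LinearMap.comp_apply]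

theorem tensorD_diagCap (m : ℕ) {u : Chains L} (hdu : chainD L u = 0) (b : Alg3 L) :
    tensorD (chainD L) (chainD L) (K.diagCap m u b) = K.diagCap m u (K.D b) := by
  have h := LinearMap.congr_fun (comul_chainD (L := L)) (algOp L (K.φ b) u)
  simp only [LinearMap.comp_apply] at h
  rw [diagCap_apply, diagCap_apply, K.φ_chain.apply, algOp_cochainsD, map_smul, ← h,
    LinearMap.sub_apply, LinearMap.comp_apply, LinearMap.comp_apply, hdu, map_zero, sub_zero]

theorem tensorD_capCap {m : ℕ} {u : Chains L} (hu : u ∈ deg (Chains L) m) (hdu : chainD L u = 0)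
    {T : Alg2 L} {μT : Alg3 L →ₗ[ℚ] Alg2 L} (hμT : ExtendsMulBy K m T μT) (b : Alg3 L) :
    tensorD (chainD L) (chainD L) (capCap u μT b) = capCap u μT (K.D b) := by
  rw [capCap_apply, capCap_apply, hμT.chain.apply, algOp2_alg2D_apply hu hdu]

theorem diagCap_mem {m : ℕ} {u : Chains L} (hu : u ∈ deg (Chains L) m) :
    K.diagCap m u ∈ homDeg (Alg3 L) (Chains L ⊗[ℚ] Chains L) m := by
  intro k b hb
  rw [diagCap_apply]
  have h1 : K.φ b ∈ deg (Alg L) k := by simpa using K.φ_mem k b hb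
  exact Submodule.smul_mem _ _ (homDeg_apply GSym.comul_mem (algOp_mem h1 m u hu) (by ring))

theorem capCap_mem {m : ℕ} {u : Chains L} (hu : u ∈ deg (Chains L) m)
    {T : Alg2 L} {μT : Alg3 L →ₗ[ℚ] Alg2 L} (hμT : ExtendsMulBy K m T μT) :
    capCap u μT ∈ homDeg (Alg3 L) (Chains L ⊗[ℚ] Chains L) m := by
  intro k b hb
  rw [capCap_apply]
  exact homDeg_apply (algOp2_mem (hμT.mem k b hb)) (tmul_mem rfl hu hu) (by ring)

/-- If the difference of two such maps has a null-homotopic augmentation it is null-homotopic. -/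
theorem exists_homotopy (hpos : ∀ n : ℤ, n ≤ 0 → deg L n = ⊥)
    (hfin : ∀ n : ℤ, FiniteDimensional ℚ (deg L n)) {m : ℤ}
    {β : Alg3 L →ₗ[ℚ] Chains L ⊗[ℚ] Chains L}
    (hβ : β ∈ homDeg (Alg3 L) (Chains L ⊗[ℚ] Chains L) m)
    (hmul : ∀ r b, β (alg3Mul L (inclBase L r ⊗ₜ b)) = algOp2 L r (β b))
    (hε : ∀ b, K.D b = 0 → chainCounit2 L (β b) = 0) :
    ∃ s : Alg3 L →ₗ[ℚ] Chains L ⊗[ℚ] Chains L,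
      (∀ r b, s (alg3Mul L (inclBase L r ⊗ₜ b)) = algOp2 L (sgn _ r) (s b)) ∧
      ∀ b, β b = tensorD (chainD L) (chainD L) (s b) + s (K.D b) := by
  -- The augmentation of `β` vanishes on cycles, so it factors as `η ∘ D`. The functional `η` is the
  -- augmentation of the homotopy to be constructed.
  obtain ⟨η, hη, hη0⟩ := exists_comp_eq_of_ker K.D_mem (comp_mem chainCounit2_mem hβ (add_zero m)) hε
  have hη' : ∀ b, η (K.D b) = chainCounit2 L (β b) := fun b => (LinearMap.congr_fun hη b).symm
  -- The only candidate: a map `s` that is linear up to sign, with augmentation `η`, must pair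
  -- `s(b)` with `r` to `η(± r · b)`, the sign being that of moving the odd `s` past `r`.
  let ψ : Alg3 L →ₗ[ℚ] Module.Dual ℚ (Alg2 L) :=
    (TensorProduct.curry (η ∘ₗ alg3Mul L) ∘ₗ inclBase L ∘ₗ sgn (Alg2 L)).flip
  have hψ : ∀ b r, ψ b r = η (alg3Mul L (inclBase L (sgn _ r) ⊗ₜ b)) := fun b r => rfl
  -- For homogeneous `b` the functional lives in one degree, since `η` does; finite type then
  -- represents it by an element of `C_*L ⊗ C_*L`.
  have hrange : ∀ b, ψ b ∈ LinearMap.range (chainPairing L) := by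
    intro b
    induction b using deg_induction with
    | h0 => rw [map_zero]; exact zero_mem _
    | hadd x y hx hy => rw [map_add]; exact add_mem hx hy
    | h k b hb =>
      refine mem_range_chainPairing hpos hfin (n := -m - 1 - k) fun j hj r hr => ?_
      rw [hψ]
      refine hη0 (j + k) (by omega) _ ?_
      have h1 : inclBase L (sgn _ r) ∈ deg (Alg3 L) j :=
        tmul_mem (add_zero j) (sgn_mem hr) GSym.one_mem
      have h2 := pairTensor_mem alg2Mul_mem (GSym.mul_mem (V := GHom L ℚ)) _ _ (tmul_mem rfl h1 hb)
      rwa [add_zero] at h2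
  let e := LinearEquiv.ofInjective (chainPairing L) chainPairing_injective
  obtain ⟨s, hs⟩ : ∃ s : Alg3 L →ₗ[ℚ] Chains L ⊗[ℚ] Chains L, ∀ b r,
      chainPairing L (s b) r = η (alg3Mul L (inclBase L (sgn _ r) ⊗ₜ b)) := by
    refine ⟨e.symm.toLinearMap ∘ₗ ψ.codRestrict _ hrange, fun b r => ?_⟩
    have h1 : e (e.symm (ψ.codRestrict _ hrange b)) = ⟨ψ b, hrange b⟩ := e.apply_symm_apply _
    exact LinearMap.congr_fun (congrArg Subtype.val h1) r
  refine ⟨s, fun r b => ?_, fun b => ?_⟩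
  -- Linearity up to sign is associativity of the action, tested against every `r'`.
  · refine chainPairing_injective (LinearMap.ext fun r' => ?_)
    have h1 : chainPairing L (algOp2 L (sgn _ r) (s b)) r' =
        chainPairing L (s b) (alg2Mul L (r' ⊗ₜ sgn _ r)) := by
      rw [chainPairing_apply, chainPairing_apply, algOp2_mul, LinearMap.comp_apply]
    rw [h1, hs, hs, alg3Mul_inclBase_assoc, sgn_of_homDeg_zero alg2Mul_mem, sgn_tmul, sgn_sgn]
  -- Pairing `β(b)` with `r` gives `(ε ⊗ ε)β(r · b) = η(D(r · b))`, and the Leibniz rule splits this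
  -- into the pairings of `d s(b)` and `s(D b)` with `r`.
  · refine chainPairing_injective (LinearMap.ext fun r => ?_)
    have h1 : chainPairing L (tensorD (chainD L) (chainD L) (s b)) r =
        -chainPairing L (s b) (alg2D L (sgn _ r)) := by
      rw [chainPairing_apply, chainPairing_apply, algOp2_cochainsD, LinearMap.sub_apply, map_sub,
        LinearMap.comp_apply, LinearMap.comp_apply, chainCounit2_tensorD, sgn_sgn]
      ring
    have h2 : sgn (Alg2 L) (alg2D L (sgn _ r)) = -alg2D L r := by
      rw [apply_sgn alg2D_mem, map_smul, sgn_sgn]; norm_num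
    rw [map_add, LinearMap.add_apply, h1, hs, hs, h2, chainPairing_apply, ← hmul, ← hη',
      D_base_mul, map_add, map_neg (inclBase L), TensorProduct.neg_tmul, map_neg, map_neg, neg_neg]

/-- The homotopy is `ξ · b ↦ coext2(± ξ)(s b)`. The signed linearity of `s` makes this formula hold
for all `ξ · b`, although the map is defined on `ξ ⊗ w` only; the commutator formula for the
operator of `dξ` then gives the homotopy identity. -/
theorem exists_loop_homotopy {β s : Alg3 L →ₗ[ℚ] Chains L ⊗[ℚ] Chains L}
    (hs : ∀ r b, s (alg3Mul L (inclBase L r ⊗ₜ b)) = algOp2 L (sgn _ r) (s b))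
    (hβ : ∀ b, β b = tensorD (chainD L) (chainD L) (s b) + s (K.D b))
    {F : LoopAlg3 L →ₗ[ℚ] (Chains L ⊗[ℚ] UDual L) ⊗[ℚ] (Chains L ⊗[ℚ] UDual L)}
    (hF : ∀ ξ b, F (loopAct L (ξ ⊗ₜ b)) = coext2 L (UDual L) (UDual L) ξ (β b)) :
    ∃ S : LoopAlg3 L →ₗ[ℚ] (Chains L ⊗[ℚ] UDual L) ⊗[ℚ] (Chains L ⊗[ℚ] UDual L),
      F = tensorD (chainsD L (UDual L)) (chainsD L (UDual L)) ∘ₗ S + S ∘ₗ K.loopD := by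
  let S : LoopAlg3 L →ₗ[ℚ] (Chains L ⊗[ℚ] UDual L) ⊗[ℚ] (Chains L ⊗[ℚ] UDual L) :=
    TensorProduct.lift ((coext2 L (UDual L) (UDual L) ∘ₗ sgn (LoopAlg2 L)).compl₂
      (s ∘ₗ inclBar L))
  have hS0 : ∀ ξ w, S (ξ ⊗ₜ w) = coext2 L (UDual L) (UDual L) (sgn _ ξ) (s (inclBar L w)) :=
    fun ξ w => rfl
  have hS : ∀ ξ b, S (loopAct L (ξ ⊗ₜ b)) = coext2 L (UDual L) (UDual L) (sgn _ ξ) (s b) := by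
    intro ξ b
    induction b using TensorProduct.induction_on with
    | zero => simp only [TensorProduct.tmul_zero, map_zero]
    | add v w hv hw => simp only [TensorProduct.tmul_add, map_add, hv, hw]
    | tmul r w =>
      rw [← alg3Mul_inclBar, ← loopAct_mul, loopAct_inclBar, hS0,
        sgn_of_homDeg_zero loopAlg2Mul_mem, sgn_tmul, coext2_mul, hs, LinearMap.comp_apply]
  refine ⟨S, loopAlg3_ext fun ξ b => ?_⟩
  have h1 := LinearMap.congr_fun (coext2_cochainsD (sgn _ ξ)) (s b)
  have h2 : sgn (LoopAlg2 L) (loopAlg2D L ξ) = -loopAlg2D L (sgn _ ξ) := by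
    rw [apply_sgn loopAlg2D_mem]; norm_num
  rw [LinearMap.sub_apply, LinearMap.comp_apply, LinearMap.comp_apply, sgn_sgn] at h1
  rw [LinearMap.add_apply, LinearMap.comp_apply, LinearMap.comp_apply, loopD_loopAct, map_add, hS,
    hS, hS, h2, sgn_sgn, map_neg, LinearMap.neg_apply, h1, hF, hβ, map_add]
  abel

/-- The augmentation of the measuring map of the composite through `C_*(L; N ⊗ N)`. -/
theorem counit_diagCap (m : ℕ) (u : Chains L) (b : Alg3 L) :
    chainCounit2 L (K.diagCap m u b) = (-1 : ℚ) ^ m * (K.φ b).val u := by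
  rw [diagCap_apply, map_smul, chainCounit2_comul, ← counit_algOp]
  rfl

end DiagonalModel

/-- `u ⊗ u` evaluates `(a ⊗ 1) T` to `± a(u)`, where `T` is the diagonal class. -/
theorem counit_mul_diagonal (hpos : ∀ n : ℤ, n ≤ 0 → deg L n = ⊥)
    {m : ℕ} {u : Chains L} (hu : u ∈ deg (Chains L) m)
    {ι : Type*} [Fintype ι] [DecidableEq ι] (p : ι → ℤ) (a a' : ι → Alg L)
    (ha : ∀ i, a i ∈ deg (Alg L) (-p i)) (ha' : ∀ i, a' i ∈ deg (Alg L) (-(m - p i)))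
    (h0 : ∃ i, p i = 0) (hdual : ∀ i j, (algMul L (a i ⊗ₜ a' j)).val u = if i = j then 1 else 0)
    (b : Alg L) :
    chainCounit2 L (algOp2 L (alg2Mul L ((b ⊗ₜ cochainOne L) ⊗ₜ
      ∑ i, (-1 : ℚ) ^ p i • (a i ⊗ₜ[ℚ] a' i))) (u ⊗ₜ u)) = (-1 : ℚ) ^ m * b.val u := by
  obtain ⟨i₀, hi₀⟩ := h0
  -- Connectedness of `C^*L`: a basis element of degree `0` is a multiple of the unit, so its
  -- products are known explicitly.
  have hscalar : ∀ i, p i = 0 → a i = (a i).val 1 • cochainOne L := fun i hi =>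
    alg_deg_zero hpos (by simpa [hi] using ha i)
  have hval : ∀ i j, p i = 0 → (a i).val 1 * (a' j).val u = if i = j then 1 else 0 := by
    intro i j hi
    rw [← hdual i j]
    conv_rhs => rw [hscalar i hi, ← TensorProduct.smul_tmul', map_smul, cochainOne_algMul]
    rfl
  have hterm : ∀ i, chainCounit2 L (algOp2 L (alg2Mul L ((b ⊗ₜ cochainOne L) ⊗ₜ
      (a i ⊗ₜ[ℚ] a' i))) (u ⊗ₜ u)) =
        (-1 : ℚ) ^ (-(m - p i) * m) * ((algMul L (b ⊗ₜ a i)).val u * (a' i).val u) := by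
    intro i
    rw [pairTensor_tmul b (a' i) cochainOne_mem (ha i), cochainOne_algMul, zero_mul, zpow_zero, one_smul,
      chainCounit2_algOp2_apply _ (ha' i) hu]
  simp only [TensorProduct.tmul_sum, TensorProduct.tmul_smul, map_sum, map_smul,
    LinearMap.sum_apply, LinearMap.smul_apply, hterm]
  -- Only the summand with `a_i` of degree `0` survives. There the Koszul sign is `(-1)^(m·m) =
  -- (-1)^m`, and duality gives `a_{i₀}(1) a_{i₀}^#(u) = 1`.
  rw [Finset.sum_eq_single i₀]
  · have h1 : (algMul L (b ⊗ₜ a i₀)).val u = (a i₀).val 1 * b.val u := by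
      conv_lhs => rw [hscalar i₀ hi₀, TensorProduct.tmul_smul, map_smul, cupRight_cochainOne]
      rfl
    have h2 := hval i₀ i₀ hi₀
    rw [if_pos rfl] at h2
    have h3 : (-1 : ℚ) ^ (-((m : ℤ) - 0) * m) = (-1 : ℚ) ^ m := by
      rw [sub_zero, neg_mul, zpow_neg, ← inv_zpow, inv_neg_one, zpow_mul, zpow_natCast]
      rcases Nat.even_or_odd m with h | h <;> simp [h.neg_one_pow]
    rw [h1, hi₀, zpow_zero, one_smul, h3]
    linear_combination ((-1 : ℚ) ^ m * b.val u) * h2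
  · intro i _ hi
    -- If `p i ≠ 0`, the degree of `a_i^#` differs from `m` and it vanishes on `u`. If `p i = 0`,
    -- orthogonality to `a_{i₀}`, a nonzero multiple of the unit, gives the vanishing.
    have h1 : (a' i).val u = 0 := by
      by_cases hpi : p i = 0
      · have h2 := hval i₀ i₀ hi₀
        rw [if_pos rfl] at h2
        have h3 := hval i₀ i hi₀
        rw [if_neg (Ne.symm hi)] at h3
        exact (mul_eq_zero.1 h3).resolve_left (left_ne_zero_of_mul_eq_one h2)
      · exact gHom_rat_apply_eq_zero (ha' i) hu (by omega)
    rw [h1, mul_zero, mul_zero, smul_zero]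
  · simp

theorem cochainsD_cochainOne : cochainsD L ℚ (cochainOne L) = 0 := by
  refine algOp_injective ?_
  rw [algOp_cochainsD, sgn_of_mem cochainOne_mem, zpow_zero, one_smul, algOp_cochainOne,
    LinearMap.comp_id, LinearMap.id_comp, sub_self, map_zero]

theorem chainD_one : chainD L 1 = 0 := by
  rw [chainD_eq, LinearMap.comp_apply, GSym.comul_one, chainDPre_tmul]
  simp [chainQ, chainData_one]

/-- Both `d 1` and `ε ∘ d` vanish. Hence evaluation at `1` is an invariant of cohomology classes,
with value `1` on the unit. -/
theorem cochainsD_val_one (s : Alg L) : (cochainsD L ℚ s).val 1 = 0 := by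
  have h1 := LinearMap.congr_fun (chainCounit_chainD (L := L)) (algOp L s 1)
  rw [LinearMap.comp_apply, LinearMap.zero_apply] at h1
  rw [← counit_algOp, LinearMap.comp_apply, algOp_cochainsD, LinearMap.sub_apply, map_sub,
    LinearMap.comp_apply, LinearMap.comp_apply, h1, chainD_one, map_zero, map_zero, sub_zero]

/-- Among classes of homogeneous cocycles that span the cohomology one has degree `0`. -/
theorem exists_degree_eq_zero {ι : Type*} [Fintype ι] (p : ι → ℤ)
    (a : ι → LinearMap.ker (cochainsD L ℚ)) (ha : ∀ i, (a i : Alg L) ∈ deg (Alg L) (-p i))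
    (hspan : Submodule.span ℚ
      (Set.range fun i => (Submodule.Quotient.mk (a i) : Homology (cochainsD L ℚ))) = ⊤) :
    ∃ i, p i = 0 := by
  have hone : cochainsD L ℚ (cochainOne L) = 0 := cochainsD_cochainOne
  have h1 : (Submodule.Quotient.mk ⟨cochainOne L, hone⟩ : Homology (cochainsD L ℚ)) ∈
      Submodule.span ℚ (Set.range fun i => Submodule.Quotient.mk (a i)) := by
    rw [hspan]; trivial
  obtain ⟨t, ht⟩ := (Submodule.mem_span_range_iff_exists_fun ℚ).1 h1
  -- Otherwise every `a_i` vanishes on `1` for degree reasons, as coboundaries do, whereas the unit,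
  -- which is a combination of the `a_i` up to a coboundary, does not.
  by_contra hp
  have h2 : (Submodule.Quotient.mk (⟨cochainOne L, hone⟩ - ∑ i, t i • a i) :
      Homology (cochainsD L ℚ)) = 0 := by
    rw [Submodule.Quotient.mk_sub, ← ht, sub_eq_zero]
    exact (map_sum (Submodule.mkQ _) (fun i => t i • a i) Finset.univ).symm
  obtain ⟨s, hs⟩ := (homology_mk_eq_zero _).1 h2
  have h3 : cochainsD L ℚ s = cochainOne L - ∑ i, t i • (a i : Alg L) := by
    rw [hs]; simp
  have h4 := cochainsD_val_one s
  have h5 : ∀ i, (a i : Alg L).val 1 = 0 := fun i =>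
    gHom_rat_apply_eq_zero (ha i) GSym.one_mem (by simpa using fun h => hp ⟨i, h⟩)
  have h6 : (cochainOne L).val 1 = 1 := chainCounit_one
  rw [h3, map_sub, LinearMap.sub_apply, map_sum, LinearMap.sum_apply] at h4
  simp [h5, h6] at h4

/-- The two measuring maps have the same augmentation on cycles. -/
theorem DiagonalModel.counit_diagCap_eq_counit_capCap (K : DiagonalModel L)
    (hpos : ∀ n : ℤ, n ≤ 0 → deg L n = ⊥)
    {m : ℕ} {u : Chains L} (hu : u ∈ deg (Chains L) m) (hdu : chainD L u = 0)
    {ι : Type*} [Fintype ι] [DecidableEq ι] (p : ι → ℤ) (a a' : ι → Alg L)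
    (ha : ∀ i, a i ∈ deg (Alg L) (-p i)) (ha' : ∀ i, a' i ∈ deg (Alg L) (-(m - p i)))
    (h0 : ∃ i, p i = 0) (hdual : ∀ i j, (algMul L (a i ⊗ₜ a' j)).val u = if i = j then 1 else 0)
    {μT : Alg3 L →ₗ[ℚ] Alg2 L}
    (hμT : ExtendsMulBy K m (∑ i, (-1 : ℚ) ^ p i • (a i ⊗ₜ[ℚ] a' i)) μT) {b : Alg3 L}
    (hb : K.D b = 0) : chainCounit2 L (K.diagCap m u b) = chainCounit2 L (capCap u μT b) := by
  have hφb : cochainsD L ℚ (K.φ b) = 0 := by rw [← K.φ_chain.apply, hb, map_zero]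
  have hr : alg2D L (K.φ b ⊗ₜ cochainOne L) = 0 := by
    rw [alg2D, tensorD, LinearMap.add_apply, TensorProduct.map_tmul, TensorProduct.map_tmul, hφb,
      cochainsD_cochainOne, TensorProduct.zero_tmul, TensorProduct.tmul_zero, add_zero]
  have hφr : K.φ (inclBase L (K.φ b ⊗ₜ cochainOne L)) = K.φ b := by
    rw [K.φ_base, cupRight_cochainOne]
  -- The cycles `b` and `φ(b) ⊗ 1` have the same image under the surjective quasi-isomorphism `φ`,
  -- so they differ by a boundary. Both measuring maps are chain maps and `ε ⊗ ε` kills boundaries,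
  -- so it suffices to compare them on `φ(b) ⊗ 1`.
  obtain ⟨w, -, hw⟩ := exists_of_ker_of_bijective K.φ_chain K.D_D K.φ_surjective K.φ_quasiIso
    (z := b - inclBase L (K.φ b ⊗ₜ cochainOne L)) (by rw [map_sub, hφr, sub_self])
    (by rw [map_sub, K.D_base, hb, hr, map_zero, sub_zero])
  have h1 : chainCounit2 L (K.diagCap m u (inclBase L (K.φ b ⊗ₜ cochainOne L))) =
      chainCounit2 L (capCap u μT (inclBase L (K.φ b ⊗ₜ cochainOne L))) := by
    -- On a cycle of `∧V ⊗ ∧V'` the map `μ_T` is multiplication by `T` up to a boundary; acting on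
    -- the cycle `u ⊗ u`, that boundary becomes a boundary of chains, which `ε ⊗ ε` does not see.
    obtain ⟨s, hs⟩ := hμT.restrict _ hr
    rw [counit_diagCap, hφr, capCap_apply, ← sub_add_cancel (μT _) (alg2Mul L _), ← hs, map_add,
      LinearMap.add_apply, map_add, algOp2_alg2D_apply hu hdu, chainCounit2_tensorD, zero_add,
      counit_mul_diagonal hpos hu p a a' ha ha' h0 hdual]
  rw [← sub_add_cancel b (inclBase L (K.φ b ⊗ₜ cochainOne L)), ← hw, map_add, map_add, map_add,
    map_add, h1, ← K.tensorD_diagCap m hdu, ← tensorD_capCap K hu hdu hμT, chainCounit2_tensorD,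
    chainCounit2_tensorD]

/-- The two composites around the diagram are homotopic. -/
theorem DiagonalModel.exists_diagram_homotopy (K : DiagonalModel L)
    (hpos : ∀ n : ℤ, n ≤ 0 → deg L n = ⊥) (hfin : ∀ n : ℤ, FiniteDimensional ℚ (deg L n))
    {m : ℕ} {u : Chains L} (hu : u ∈ deg (Chains L) m)
    {T : Alg2 L} {μT : Alg3 L →ₗ[ℚ] Alg2 L} (hμT : ExtendsMulBy K m T μT)
    (hε : ∀ b, K.D b = 0 → chainCounit2 L (K.diagCap m u b) = chainCounit2 L (capCap u μT b)) :
    ∃ S, chainsDiag L (UDual L) (UDual L) ∘ₗ cap L (UDual L ⊗[ℚ] UDual L) m u ∘ₗ K.loopPhi -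
        capTensorCap L (UDual L) (UDual L) m u ∘ₗ loopMuT μT =
      tensorD (chainsD L (UDual L)) (chainsD L (UDual L)) ∘ₗ S + S ∘ₗ K.loopD := by
  obtain ⟨s, hs, hβ⟩ := K.exists_homotopy hpos hfin (β := K.diagCap m u - capCap u μT)
    (Submodule.sub_mem _ (K.diagCap_mem hu) (capCap_mem K hu hμT))
    (fun r b => by
      rw [LinearMap.sub_apply, LinearMap.sub_apply, diagCap_mul, capCap_mul K u hμT, map_sub])
    (fun b hb => by rw [LinearMap.sub_apply, map_sub, hε b hb, sub_self])
  refine K.exists_loop_homotopy hs hβ fun ξ b => ?_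
  rw [LinearMap.sub_apply, LinearMap.sub_apply, map_sub, ← chainsDiag_cap_loopPhi,
    ← capTensorCap_loopMuT K hu hμT]
  rfl

theorem IsChainMap.comp {X Y Z : Type*} [AddCommGroup X] [Module ℚ X] [AddCommGroup Y]
    [Module ℚ Y] [AddCommGroup Z] [Module ℚ Z] {dX : X →ₗ[ℚ] X} {dY : Y →ₗ[ℚ] Y}
    {dZ : Z →ₗ[ℚ] Z} {f : X →ₗ[ℚ] Y} {g : Y →ₗ[ℚ] Z} (hg : IsChainMap dY dZ g)
    (hf : IsChainMap dX dY f) : IsChainMap dX dZ (g ∘ₗ f) := by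
  rw [IsChainMap, LinearMap.comp_assoc, hf, ← LinearMap.comp_assoc, hg, LinearMap.comp_assoc]

theorem homologyMap_comp {X Y Z : Type*} [AddCommGroup X] [Module ℚ X] [AddCommGroup Y]
    [Module ℚ Y] [AddCommGroup Z] [Module ℚ Z] {dX : X →ₗ[ℚ] X} {dY : Y →ₗ[ℚ] Y}
    {dZ : Z →ₗ[ℚ] Z} {f : X →ₗ[ℚ] Y} {g : Y →ₗ[ℚ] Z} (hg : IsChainMap dY dZ g)
    (hf : IsChainMap dX dY f) :
    homologyMap (hg.comp hf) = homologyMap hg ∘ₗ homologyMap hf := by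
  refine LinearMap.ext fun c => ?_
  obtain ⟨x, rfl⟩ := Submodule.Quotient.mk_surjective _ c
  rfl

end Commutativity

end
end LieLoop

theorem theorem8 {L : Type*} [AddCommGroup L] [Module ℚ L] [DGLie L]
    (hpos : ∀ n : ℤ, n ≤ 0 → deg L n = ⊥)
    (hfin : ∀ n : ℤ, FiniteDimensional ℚ (deg L n))
    (m : ℕ) (u : Chains L) (hu : u ∈ deg (Chains L) m) (hdu : chainD L u = 0)
    {ι : Type*} [Fintype ι] [DecidableEq ι] (p : ι → ℤ)
    (a a' : ι → LinearMap.ker (cochainsD L ℚ))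
    (ha : ∀ i, (a i : Alg L) ∈ deg (Alg L) (-p i))
    (ha' : ∀ i, (a' i : Alg L) ∈ deg (Alg L) (-(m - p i)))
    (hli : LinearIndependent ℚ fun i => (Submodule.Quotient.mk (a i) : Homology (cochainsD L ℚ)))
    (hspan : Submodule.span ℚ
      (Set.range fun i => (Submodule.Quotient.mk (a i) : Homology (cochainsD L ℚ))) = ⊤)
    (hdual : ∀ i j, (algMul L ((a i : Alg L) ⊗ₜ (a' j : Alg L))).val u = if i = j then 1 else 0)
    (K : DiagonalModel L) (μT : Alg3 L →ₗ[ℚ] Alg2 L)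
    (hμT : ExtendsMulBy K m (∑ i, (-1 : ℚ) ^ p i • ((a i : Alg L) ⊗ₜ[ℚ] (a' i : Alg L))) μT) :
    ∃ (hΦ : IsChainMap K.loopD (cochainsD L (UDual L ⊗[ℚ] UDual L)) K.loopPhi)
      (hcap : IsChainMap (cochainsD L (UDual L ⊗[ℚ] UDual L)) (chainsD L (UDual L ⊗[ℚ] UDual L))
        (cap L (UDual L ⊗[ℚ] UDual L) m u))
      (hΔ : IsChainMap (chainsD L (UDual L ⊗[ℚ] UDual L))
        (tensorD (chainsD L (UDual L)) (chainsD L (UDual L)))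
        (chainsDiag L (UDual L) (UDual L)))
      (hT : IsChainMap K.loopD (loopAlg2D L) (loopMuT μT))
      (hcap2 : IsChainMap (loopAlg2D L) (tensorD (chainsD L (UDual L)) (chainsD L (UDual L)))
        (capTensorCap L (UDual L) (UDual L) m u)),
      Function.Bijective (homologyMap hΦ) ∧
        homologyMap hΔ ∘ₗ homologyMap hcap ∘ₗ homologyMap hΦ =
          homologyMap hcap2 ∘ₗ homologyMap hT := by
  refine ⟨K.loopPhi_isChainMap, cap_isChainMap m hdu, chainsDiag_isChainMap,
    K.loopMuT_isChainMap hμT, capTensorCap_isChainMap m hu hdu, K.loopPhi_quasiIso hpos hfin, ?_⟩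
  -- That the classes span is used to find a basis element of degree `0`, the one that makes the
  -- augmentations agree.
  obtain ⟨S, hS⟩ := K.exists_diagram_homotopy hpos hfin hu hμT fun b hb =>
    K.counit_diagCap_eq_counit_capCap hpos hu hdu p (fun i => a i) (fun i => a' i) ha ha'
      (exists_degree_eq_zero p a ha hspan) hdual hμT hb
  rw [← homologyMap_comp, ← homologyMap_comp, ← homologyMap_comp]
  exact homologyMap_eq_of_homotopy _ _ S hS
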